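/- **Setting.** For an open set $\Omega\subset\mathbb R^d$, or $\Omega=[0,\infty)\times\mathbb R$ (with one-sided derivatives at $t=0$), let $\mathcal G(\Omega)=\mathcal E_M(\Omega)/\mathcal N(\Omega)$ be the special Colombeau algebra. Here $\mathcal E_M(\Omega)$ consists of the nets $(u^\varepsilon)_{\varepsilon\in(0,1]}$ of real-valued smooth functions on $\Omega$ such that for every compact $K\subset\Omega$ and every $\alpha$ there is $p\ge 0$ with $\sup_K|\partial^\alpha u^\varepsilon|=O(\varepsilon^{-p})$ as $\varepsilon\downarrow0$, and $\mathcal N(\Omega)$ of those with $\sup_K|\partial^\alpha u^\varepsilon|=O(\varepsilon^{q})$ for all $K$, $\alpha$ and $q\ge 0$. An element belongs to $\mathcal G^\infty(\Omega)$ if it has a representative such that for every compact $K\subset\Omega$ there is $p\ge0$ with $\sup_K|\partial^\alpha u^\varepsilon|=O(\varepsilon^{-p})$ for all $\alpha$. The set $\operatorname{sing\,supp}_{\mathcal G^\infty}U$ is the complement in $\Omega$ of the largest (relatively) open subset of $\Omega$ on which $U$ is $\mathcal G^\infty$. A *mollifier* is a function $\varphi\in C_0^\infty(\mathbb R)$ that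 is symmetric, with $\varphi'\ge0$ on $[-1,0]$, $\operatorname{supp}\varphi\subset[-1,1]$ and $\int\varphi=1$; put $\varphi_h(x)=\varphi(x/h)/h$. A net $(r^\varepsilon)$ is *slow scale* if $|r^\varepsilon|^p=O(\varepsilon^{-1})$ as $\varepsilon\downarrow 0$ for every $p\ge0$. Let $c_0,c_1>0$, $c_0\neq c_1$, and $c(t)=c_0+(c_1-c_0)H(t-1)$, where $H$ is the Heaviside function. We say that $C\in\mathcal G(\mathbb R)$ *regularizes* $c$ if it has a representative $(c^\varepsilon)$ such that $c^\varepsilon\to c$ in $\mathcal D'(\mathbb R)$ as $\varepsilon\downarrow0$, and there are constants $a,b,B>0$ with $a\le c^\varepsilon(t)\le b$ and $\int_0^\infty|(c^\varepsilon)'(s)|\,ds\le B$ for all $\varepsilon\in(0,1]$ and $t\ge0$. Let $\varphi$ be a mollifier, $U_0=0$, and let $U_1\in\mathcal G(\mathbb R)$ be the class of $(\varphi_\varepsilon)_{\varepsilon\in(0,1]}$. **Theorem 5.1.** 1. Let $\psi$ be a mollifier and $h:(0,1]\to(0,\infty)$ with $h(\varepsilon)\to0$ as $\varepsilon\downarrow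 0$ and $(1/h(\varepsilon))_{\varepsilon}$ slow scale. Then $(c*\psi_{h(\varepsilon)})_{\varepsilon}$ is the representative of an element $C\in\mathcal G(\mathbb R)$ that regularizes $c$, and $C\in\mathcal G^\infty(\mathbb R)$. 2. Let $C\in\mathcal G(\mathbb R)$ regularize $c$, and let $U\in\mathcal G([0,\infty)\times\mathbb R)$ be the solution of $$\partial_t^2U-C^2\partial_x^2U=0\ \text{ in }\mathcal G([0,\infty)\times\mathbb R),\qquad U|_{t=0}=U_0,\quad \partial_tU|_{t=0}=U_1\ \text{ in }\mathcal G(\mathbb R),$$ where $C$ is regarded as a generalized function of $(t,x)$ independent of $x$. If $C\in\mathcal G^\infty(\mathbb R)$, then $$\operatorname{sing\,supp}_{\mathcal G^\infty}U=\Big\{(t,x)\ \Big|\ t\ge0,\ x=\pm\int_0^tc(s)\,ds\Big\}.$$ In particular, the rays $x=\pm\big(2\int_0^1c(s)\,ds-\int_0^tc(s)\,ds\big)$, $t>1$, contain no point of the singular support. -/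

import Mathlib

open Set Filter Topology MeasureTheory
open scoped ContDiff

noncomputable section

namespace Colombeau

/-- The index set `(0, 1]` of the regularization parameter `ε`. -/
abbrev Eps : Type := Ioc (0 : ℝ) 1

/-- The filter on `(0, 1]` describing `ε ↓ 0`. -/
def atZero : Filter Eps := comap (fun ε : Eps => (ε : ℝ)) (𝓝 0)

/-- A set on which smooth functions have unique derivatives of every order (an open set, or the
closed half plane `[0, ∞) × ℝ`, where derivatives at the boundary are one-sided). -/
structure Domain (E : Type*) [NormedAddCommGroup E] [NormedSpace ℝ E] where
  /-- the underlying set -/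
  carrier : Set E
  uniqueDiffOn : UniqueDiffOn ℝ carrier

section Algebra

variable {E : Type*} [NormedAddCommGroup E] [NormedSpace ℝ E]
variable {F : Type*} [NormedAddCommGroup F] [NormedSpace ℝ F]

/-- The part of a domain that lies in an open set. -/
def Domain.inter (Ω : Domain E) (O : Set E) (hO : IsOpen O) : Domain E :=
  ⟨Ω.carrier ∩ O, Ω.uniqueDiffOn.inter hO⟩

/-- `sup_{x ∈ K} |∂^n u^ε (x)| = O(ε ^ m)` as `ε ↓ 0`, for the total derivative of order `n`
on `Ω`; its norm controls and is controlled by the partial derivatives `∂^α` with `|α| = n`. -/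
def DerivBound (Ω : Domain E) (u : Eps → E → ℝ) (K : Set E) (n : ℕ) (m : ℤ) : Prop :=
  ∃ A : ℝ, ∀ᶠ ε in atZero, ∀ x ∈ K,
    ‖iteratedFDerivWithin ℝ n (u ε) Ω.carrier x‖ ≤ A * ((ε : Eps) : ℝ) ^ m

theorem DerivBound.mono {Ω : Domain E} {u : Eps → E → ℝ} {K : Set E} {n : ℕ} {m m' : ℤ}
    (h : DerivBound Ω u K n m) (hm : m' ≤ m) : DerivBound Ω u K n m' := by
  obtain ⟨A, hA⟩ := h
  refine ⟨|A|, hA.mono fun ε hε x hx => (hε x hx).trans ?_⟩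
  have h0 : (0 : ℝ) < ε := ε.2.1
  calc A * (ε : ℝ) ^ m ≤ |A| * (ε : ℝ) ^ m := by
        gcongr
        exact le_abs_self A
    _ ≤ |A| * (ε : ℝ) ^ m' := by
        exact mul_le_mul_of_nonneg_left (zpow_le_zpow_right_of_le_one₀ h0 ε.2.2 hm) (abs_nonneg A)

theorem DerivBound.add {Ω : Domain E} {u v : Eps → E → ℝ} {K : Set E} {n : ℕ} {m : ℤ}
    (hK : K ⊆ Ω.carrier) (hu : ∀ ε, ContDiffOn ℝ ∞ (u ε) Ω.carrier)
    (hv : ∀ ε, ContDiffOn ℝ ∞ (v ε) Ω.carrier)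
    (h : DerivBound Ω u K n m) (h' : DerivBound Ω v K n m) : DerivBound Ω (u + v) K n m := by
  obtain ⟨A, hA⟩ := h
  obtain ⟨B, hB⟩ := h'
  refine ⟨A + B, ?_⟩
  filter_upwards [hA, hB] with ε h1 h2 x hx
  have hn : (n : ℕ∞ω) ≤ ∞ := by exact_mod_cast le_top
  rw [Pi.add_apply, iteratedFDerivWithin_add_apply (((hu ε).of_le hn) x (hK hx))
    (((hv ε).of_le hn) x (hK hx)) Ω.uniqueDiffOn (hK hx), add_mul]
  exact (norm_add_le _ _).trans (add_le_add (h1 x hx) (h2 x hx))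

theorem DerivBound.neg {Ω : Domain E} {u : Eps → E → ℝ} {K : Set E} {n : ℕ} {m : ℤ}
    (hK : K ⊆ Ω.carrier) (h : DerivBound Ω u K n m) : DerivBound Ω (-u) K n m := by
  obtain ⟨A, hA⟩ := h
  refine ⟨A, hA.mono fun ε h1 x hx => ?_⟩
  rw [Pi.neg_apply, iteratedFDerivWithin_neg_apply Ω.uniqueDiffOn (hK hx), norm_neg]
  exact h1 x hx

theorem DerivBound.mul {Ω : Domain E} {u v : Eps → E → ℝ} {K : Set E} {n : ℕ} {m k : ℤ}
    (hK : K ⊆ Ω.carrier) (hu : ∀ ε, ContDiffOn ℝ ∞ (u ε) Ω.carrier)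
    (hv : ∀ ε, ContDiffOn ℝ ∞ (v ε) Ω.carrier)
    (h : ∀ i ≤ n, DerivBound Ω u K i m) (h' : ∀ i ≤ n, DerivBound Ω v K i k) :
    DerivBound Ω (u * v) K n (m + k) := by
  choose! A hA using h
  choose! B hB using h'
  refine ⟨∑ i ∈ Finset.range (n + 1), (n.choose i : ℝ) * A i * B (n - i), ?_⟩
  have h1 : ∀ᶠ ε in atZero, ∀ i ∈ Finset.range (n + 1), ∀ x ∈ K,
      ‖iteratedFDerivWithin ℝ i (u ε) Ω.carrier x‖ ≤ A i * ((ε : Eps) : ℝ) ^ m :=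
    (eventually_all_finset _).2 fun i hi => hA i (Nat.lt_succ_iff.1 (Finset.mem_range.1 hi))
  have h2 : ∀ᶠ ε in atZero, ∀ i ∈ Finset.range (n + 1), ∀ x ∈ K,
      ‖iteratedFDerivWithin ℝ (n - i) (v ε) Ω.carrier x‖ ≤
        B (n - i) * ((ε : Eps) : ℝ) ^ k :=
    (eventually_all_finset _).2 fun i _ => hB (n - i) (Nat.sub_le _ _)
  filter_upwards [h1, h2] with ε h1 h2 x hx
  have hn : (n : ℕ∞ω) ≤ ∞ := by exact_mod_cast le_top
  refine (norm_iteratedFDerivWithin_mul_le (hu ε) (hv ε) Ω.uniqueDiffOn (hK hx) hn).trans ?_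
  rw [Finset.sum_mul]
  refine Finset.sum_le_sum fun i hi => ?_
  have h0 : (ε : ℝ) ≠ 0 := ε.2.1.ne'
  have a1 := h1 i hi x hx
  have a2 := h2 i hi x hx
  rw [zpow_add₀ h0]
  calc (n.choose i : ℝ) * ‖iteratedFDerivWithin ℝ i (u ε) Ω.carrier x‖ *
        ‖iteratedFDerivWithin ℝ (n - i) (v ε) Ω.carrier x‖
      ≤ (n.choose i : ℝ) * (A i * (ε : ℝ) ^ m) * (B (n - i) * (ε : ℝ) ^ k) := by
        have := (norm_nonneg _).trans a1
        gcongr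
    _ = _ := by ring

/-- Moderate growth of all derivatives on all compact subsets of `Ω`. -/
def IsModerate (Ω : Domain E) (u : Eps → E → ℝ) : Prop :=
  (∀ ε, ContDiffOn ℝ ∞ (u ε) Ω.carrier) ∧
    ∀ K ⊆ Ω.carrier, IsCompact K → ∀ n : ℕ, ∃ p : ℕ, DerivBound Ω u K n (-(p : ℤ))

/-- Rapid decay of all derivatives on all compact subsets of `Ω`. -/
def IsNegligible (Ω : Domain E) (u : Eps → E → ℝ) : Prop :=
  ∀ K ⊆ Ω.carrier, IsCompact K → ∀ n : ℕ, ∀ q : ℕ, DerivBound Ω u K n (q : ℤ)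

theorem IsModerate.exists_uniform {Ω : Domain E} {u : Eps → E → ℝ} (hu : IsModerate Ω u)
    {K : Set E} (hK : K ⊆ Ω.carrier) (hc : IsCompact K) (n : ℕ) :
    ∃ p : ℕ, ∀ i ≤ n, DerivBound Ω u K i (-(p : ℤ)) := by
  choose p hp using hu.2 K hK hc
  refine ⟨(Finset.range (n + 1)).sup p, fun i hi => (hp i).mono ?_⟩
  have : p i ≤ (Finset.range (n + 1)).sup p :=
    Finset.le_sup (Finset.mem_range.2 (Nat.lt_succ_of_le hi))
  omega

theorem IsModerate.const (Ω : Domain E) (a : ℝ) : IsModerate Ω (fun _ _ => a) := by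
  refine ⟨fun ε => contDiffOn_const, fun K _ _ n => ⟨0, ?_⟩⟩
  rcases Nat.eq_zero_or_pos n with rfl | hn
  · exact ⟨‖a‖, Eventually.of_forall fun ε x _ => by simp⟩
  · refine ⟨0, Eventually.of_forall fun ε x _ => ?_⟩
    rw [iteratedFDerivWithin_const_of_ne hn.ne']
    simp

/-- The algebra `E_M(Ω)` of moderate nets of smooth functions. -/
def moderate (Ω : Domain E) : Subring (Eps → E → ℝ) where
  carrier := {u | IsModerate Ω u}
  zero_mem' := IsModerate.const Ω 0
  one_mem' := IsModerate.const Ω 1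
  add_mem' := by
    intro u v hu hv
    refine ⟨fun ε => (hu.1 ε).add (hv.1 ε), fun K hK hc n => ?_⟩
    obtain ⟨p, hp⟩ := hu.2 K hK hc n
    obtain ⟨q, hq⟩ := hv.2 K hK hc n
    exact ⟨p + q, .add hK hu.1 hv.1 (hp.mono (by push_cast; omega))
      (hq.mono (by push_cast; omega))⟩
  neg_mem' := by
    intro u hu
    refine ⟨fun ε => (hu.1 ε).neg, fun K hK hc n => ?_⟩
    obtain ⟨p, hp⟩ := hu.2 K hK hc n
    exact ⟨p, hp.neg hK⟩
  mul_mem' := by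
    intro u v hu hv
    refine ⟨fun ε => (hu.1 ε).mul (hv.1 ε), fun K hK hc n => ?_⟩
    obtain ⟨p, hp⟩ := hu.exists_uniform hK hc n
    obtain ⟨q, hq⟩ := hv.exists_uniform hK hc n
    refine ⟨p + q, ?_⟩
    have := DerivBound.mul hK hu.1 hv.1 hp hq
    rwa [show (-((p + q : ℕ) : ℤ)) = -(p : ℤ) + -(q : ℤ) by push_cast; ring]

/-- The ideal `N(Ω)` of negligible nets. -/
def negligible (Ω : Domain E) : Ideal (moderate Ω) where
  carrier := {u | IsNegligible Ω u.1}
  zero_mem' := by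
    intro K _ _ n q
    refine ⟨0, Eventually.of_forall fun ε x _ => ?_⟩
    have : ((0 : moderate Ω) : Eps → E → ℝ) ε = 0 := rfl
    rw [this, iteratedFDerivWithin_zero]
    simp
  add_mem' := by
    intro u v hu hv K hK hc n q
    exact .add hK u.2.1 v.2.1 (hu K hK hc n q) (hv K hK hc n q)
  smul_mem' := by
    intro u v hv K hK hc n q
    obtain ⟨p, hp⟩ := IsModerate.exists_uniform u.2 hK hc n
    have := DerivBound.mul (n := n) hK u.2.1 v.2.1 hp (fun i _ => hv K hK hc i (p + q))
    have e : -(p : ℤ) + ((p : ℤ) + (q : ℤ)) = q := by ring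
    rw [Nat.cast_add, e] at this
    exact this

/-- The Colombeau algebra `G(Ω) = E_M(Ω) / N(Ω)`. -/
abbrev GenFun (Ω : Domain E) : Type _ := moderate Ω ⧸ negligible Ω

/-- The generalized function `U` is the class of the net `u`. -/
def Represents {Ω : Domain E} (u : Eps → E → ℝ) (U : GenFun Ω) : Prop :=
  ∃ hu : IsModerate Ω u, Ideal.Quotient.mk (negligible Ω) ⟨u, hu⟩ = U

theorem DerivBound.pullback {Ω : Domain E} {Ω' : Domain F} (L : E →L[ℝ] F)
    (hL : MapsTo L Ω.carrier Ω'.carrier) {u : Eps → F → ℝ}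
    (hu : ∀ ε, ContDiffOn ℝ ∞ (u ε) Ω'.carrier) {K : Set E} (hK : K ⊆ Ω.carrier) {n : ℕ} {m : ℤ}
    (h : DerivBound Ω' u (L '' K) n m) : DerivBound Ω (fun ε x => u ε (L x)) K n m := by
  obtain ⟨A, hA⟩ := h
  refine ⟨A * ‖L‖ ^ n, hA.mono fun ε h1 x hx => ?_⟩
  have hn : (n : ℕ∞ω) ≤ ∞ := by exact_mod_cast le_top
  have T := (((hu ε).ftaylorSeriesWithin Ω'.uniqueDiffOn).compContinuousLinearMap L).mono hL
  have e := T.eq_iteratedFDerivWithin_of_uniqueDiffOn hn Ω.uniqueDiffOn (hK hx)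
  have e' : iteratedFDerivWithin ℝ n (fun x => u ε (L x)) Ω.carrier x =
    (iteratedFDerivWithin ℝ n (u ε) Ω'.carrier (L x)).compContinuousLinearMap fun _ => L :=
    e.symm
  rw [e']
  refine (ContinuousMultilinearMap.norm_compContinuousLinearMap_le _ _).trans ?_
  rw [Finset.prod_const, Finset.card_univ, Fintype.card_fin]
  calc _ ≤ (A * (ε : ℝ) ^ m) * ‖L‖ ^ n := by
        gcongr
        exact h1 (L x) (mem_image_of_mem L hx)
    _ = _ := by ring

/-- Composition of moderate nets with a continuous linear map. -/
def moderatePullback {Ω : Domain E} {Ω' : Domain F} (L : E →L[ℝ] F)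
    (hL : MapsTo L Ω.carrier Ω'.carrier) : moderate Ω' →+* moderate Ω where
  toFun u := ⟨fun ε x => u.1 ε (L x), fun ε => (u.2.1 ε).comp L.contDiff.contDiffOn hL,
    fun K hK hc n => by
      obtain ⟨p, hp⟩ := u.2.2 (L '' K) ((image_mono hK).trans hL.image_subset)
        (hc.image L.continuous) n
      exact ⟨p, hp.pullback L hL u.2.1 hK⟩⟩
  map_one' := rfl
  map_mul' _ _ := rfl
  map_zero' := rfl
  map_add' _ _ := rfl

/-- The class of `(u^ε)` is sent to the class of `(u^ε ∘ L)`, for a continuous linear map `L`. -/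
def pullback {Ω : Domain E} {Ω' : Domain F} (L : E →L[ℝ] F)
    (hL : MapsTo L Ω.carrier Ω'.carrier) : GenFun Ω' →+* GenFun Ω :=
  Ideal.quotientMap (negligible Ω) (moderatePullback L hL) (by
    intro u hu K hK hc n q
    exact DerivBound.pullback L hL u.2.1 hK
      (hu (L '' K) ((image_mono hK).trans hL.image_subset) (hc.image L.continuous) n q))

/-- Restriction of a generalized function to a relatively open subset of its domain. -/
def restrict {Ω : Domain E} (O : Set E) (hO : IsOpen O) :
    GenFun Ω →+* GenFun (Ω.inter O hO) :=
  pullback (ContinuousLinearMap.id ℝ E) (fun _ hx => hx.1)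

theorem DerivBound.dir {Ω : Domain E} (v : E) {u : Eps → E → ℝ}
    (hu : ∀ ε, ContDiffOn ℝ ∞ (u ε) Ω.carrier) {K : Set E} (hK : K ⊆ Ω.carrier) {n : ℕ} {m : ℤ}
    (h : DerivBound Ω u K (n + 1) m) :
    DerivBound Ω (fun ε x => fderivWithin ℝ (u ε) Ω.carrier x v) K n m := by
  obtain ⟨A, hA⟩ := h
  refine ⟨‖v‖ * A, hA.mono fun ε h1 x hx => ?_⟩
  have hn : (n : ℕ∞ω) ≤ ∞ := by exact_mod_cast le_top
  have hd : ContDiffOn ℝ ∞ (fderivWithin ℝ (u ε) Ω.carrier) Ω.carrier :=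
    (hu ε).fderivWithin Ω.uniqueDiffOn (by simp)
  refine (norm_iteratedFDerivWithin_clm_apply_const (hd x (hK hx)) Ω.uniqueDiffOn (hK hx)
    hn).trans ?_
  rw [norm_iteratedFDerivWithin_fderivWithin Ω.uniqueDiffOn (hK hx), mul_assoc]
  gcongr
  exact h1 x hx

theorem DerivBound.congr {Ω : Domain E} {u v : Eps → E → ℝ} {K : Set E} (hK : K ⊆ Ω.carrier)
    {n : ℕ} {m : ℤ} (huv : ∀ ε, EqOn (v ε) (u ε) Ω.carrier) (h : DerivBound Ω u K n m) :
    DerivBound Ω v K n m := by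
  obtain ⟨A, hA⟩ := h
  refine ⟨A, hA.mono fun ε h1 x hx => ?_⟩
  rw [iteratedFDerivWithin_congr (huv ε) (hK hx)]
  exact h1 x hx

/-- The derivative in the direction `v` of a moderate net. -/
def moderateDeriv {Ω : Domain E} (v : E) (u : moderate Ω) : moderate Ω :=
  ⟨fun ε x => fderivWithin ℝ (u.1 ε) Ω.carrier x v,
    fun ε => ((u.2.1 ε).fderivWithin Ω.uniqueDiffOn (by simp)).clm_apply contDiffOn_const,
    fun K hK hc n => by
      obtain ⟨p, hp⟩ := u.2.2 K hK hc (n + 1)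
      exact ⟨p, hp.dir v u.2.1 hK⟩⟩

theorem moderateDeriv_sub {Ω : Domain E} (v : E) {u w : moderate Ω}
    (h : u - w ∈ negligible Ω) : moderateDeriv v u - moderateDeriv v w ∈ negligible Ω := by
  intro K hK hc n q
  refine DerivBound.congr hK ?_ ((h K hK hc (n + 1) q).dir v (u - w).2.1 hK)
  intro ε x hx
  have du : DifferentiableWithinAt ℝ (u.1 ε) Ω.carrier x :=
    ((u.2.1 ε).differentiableOn (by simp)) x hx
  have dw : DifferentiableWithinAt ℝ (w.1 ε) Ω.carrier x :=
    ((w.2.1 ε).differentiableOn (by simp)) x hx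
  have e : ((u - w : moderate Ω) : Eps → E → ℝ) ε = u.1 ε - w.1 ε := rfl
  change fderivWithin ℝ (u.1 ε) Ω.carrier x v - fderivWithin ℝ (w.1 ε) Ω.carrier x v =
    fderivWithin ℝ (((u - w : moderate Ω) : Eps → E → ℝ) ε) Ω.carrier x v
  rw [e, fderivWithin_sub (Ω.uniqueDiffOn x hx) du dw]
  rfl

/-- The derivative `∂_v U` of a generalized function: the class of `(∂_v u^ε)`. -/
def pderiv {Ω : Domain E} (v : E) (U : GenFun Ω) : GenFun Ω :=
  Quotient.liftOn' U (fun u => Ideal.Quotient.mk (negligible Ω) (moderateDeriv v u))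
    fun _ _ h => Ideal.Quotient.eq.2 (moderateDeriv_sub v ((Submodule.quotientRel_def _).1 h))

/-- Regular generalized functions, the elements of `G^∞(Ω)`: on every compact set, one power of
`ε` bounds the derivatives of all orders. -/
def IsGInfty {Ω : Domain E} (U : GenFun Ω) : Prop :=
  ∃ u : Eps → E → ℝ, Represents u U ∧
    ∀ K ⊆ Ω.carrier, IsCompact K → ∃ p : ℕ, ∀ n : ℕ, DerivBound Ω u K n (-(p : ℤ))

/-- The `G^∞`-singular support: the complement in `Ω` of the union of all (relatively) open sets
on which `U` is regular. -/
def singSupp {Ω : Domain E} (U : GenFun Ω) : Set E :=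
  Ω.carrier \ ⋃₀ {O | ∃ hO : IsOpen O, IsGInfty (restrict O hO U)}

end Algebra

/-- The real line. -/
def line : Domain ℝ := ⟨univ, uniqueDiffOn_univ⟩

/-- The closed half plane of all `(t, x)` with `t ≥ 0`. -/
def halfPlane : Domain (ℝ × ℝ) := ⟨Ici 0 ×ˢ univ, (uniqueDiffOn_Ici 0).prod uniqueDiffOn_univ⟩

/-- A generalized function of `t`, viewed as a generalized function of `(t, x)`. -/
def ofTime : GenFun line →+* GenFun halfPlane :=
  pullback (ContinuousLinearMap.fst ℝ ℝ ℝ) (fun _ _ => mem_univ _)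

/-- The restriction of a generalized function on the half plane to the line `t = 0`. -/
def trace : GenFun halfPlane →+* GenFun line :=
  pullback (ContinuousLinearMap.inr ℝ ℝ ℝ) (fun _ _ => ⟨le_refl (0 : ℝ), mem_univ _⟩)

/-- `U` solves `∂_t² U - C² ∂_x² U = 0`, `U|_{t = 0} = U₀`, `∂_t U|_{t = 0} = U₁`, where the
coefficient `C` depends on `t` only. -/
def IsSolution (C : GenFun line) (U₀ U₁ : GenFun line) (U : GenFun halfPlane) : Prop :=
  pderiv (1, 0) (pderiv (1, 0) U) - ofTime C ^ 2 * pderiv (0, 1) (pderiv (0, 1) U) = 0 ∧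
    trace U = U₀ ∧ trace (pderiv (1, 0) U) = U₁

/-- The mollifiers used here: smooth, even, increasing on `[-1, 0]`, supported in `[-1, 1]`, of
integral one. -/
structure IsMollifier (φ : ℝ → ℝ) : Prop where
  smooth : ContDiff ℝ ∞ φ
  even : ∀ x, φ (-x) = φ x
  deriv_nonneg : ∀ x ∈ Icc (-1 : ℝ) 0, 0 ≤ deriv φ x
  support : tsupport φ ⊆ Icc (-1) 1
  integral_eq_one : ∫ x, φ x = 1

/-- The rescaled function `φ_h (x) = φ (x / h) / h`. -/
def rescale (φ : ℝ → ℝ) (h : ℝ) (x : ℝ) : ℝ := φ (x / h) / h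

theorem isModerate_rescale {φ : ℝ → ℝ} (hφ : IsMollifier φ) :
    IsModerate line (fun ε : Eps => rescale φ ε) := by
  have hs : ∀ h : ℝ, ContDiff ℝ ∞ (rescale φ h) := fun h =>
    (hφ.smooth.comp (contDiff_id.div_const h)).div_const h
  refine ⟨fun ε => (hs ε).contDiffOn, fun K _ _ n => ⟨n + 1, ?_⟩⟩
  have hn : (n : ℕ∞ω) ≤ ∞ := by exact_mod_cast le_top
  have hcs : HasCompactSupport φ := isCompact_Icc.of_isClosed_subset (isClosed_tsupport φ)
    hφ.support
  obtain ⟨A, hA⟩ := (hcs.iteratedFDeriv (𝕜 := ℝ) n).exists_bound_of_continuous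
    (hφ.smooth.continuous_iteratedFDeriv hn)
  refine ⟨A, Eventually.of_forall fun ε x _ => ?_⟩
  have h0 : (0 : ℝ) < ε := ε.2.1
  have e : rescale φ ε = fun y => (ε : ℝ)⁻¹ * φ ((ε : ℝ)⁻¹ * y) := by
    funext y
    simp only [rescale, div_eq_inv_mul]
  change ‖iteratedFDerivWithin ℝ n (rescale φ ε) univ x‖ ≤ _
  rw [iteratedFDerivWithin_univ, norm_iteratedFDeriv_eq_norm_iteratedDeriv, e,
    iteratedDeriv_const_mul_field, iteratedDeriv_comp_const_mul (hφ.smooth.of_le hn)]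
  have hb := hA ((ε : ℝ)⁻¹ * x)
  rw [norm_iteratedFDeriv_eq_norm_iteratedDeriv] at hb
  rw [norm_mul, norm_mul, norm_pow, Real.norm_of_nonneg (inv_nonneg.2 h0.le), zpow_neg,
    zpow_natCast, ← inv_pow, pow_succ]
  calc _ ≤ (ε : ℝ)⁻¹ * ((ε : ℝ)⁻¹ ^ n * A) := by gcongr
    _ = _ := by ring

/-- The class of `(φ_ε)`, a generalized function associated with the delta function. -/
def delta (φ : ℝ → ℝ) (hφ : IsMollifier φ) : GenFun line :=
  Ideal.Quotient.mk (negligible line) ⟨fun ε : Eps => rescale φ ε, isModerate_rescale hφ⟩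

/-- The speed `c₀ + (c₁ - c₀) H(t - 1)`, with `H` the Heaviside function. -/
def speed (c₀ c₁ : ℝ) (t : ℝ) : ℝ := if t < 1 then c₀ else c₁

/-- The convolution `f * ψ_h`. -/
def mollify (f ψ : ℝ → ℝ) (h : ℝ) (t : ℝ) : ℝ := ∫ s, f (t - s) * rescale ψ h s

/-- `C` is a generalized function regularizing the speed `c`: it is the class of a net `c^ε`
with values in a fixed compact subset of `(0, ∞)` for `t ≥ 0`, of total variation on `[0, ∞)`
bounded uniformly in `ε`, and converging to `c` in the sense of distributions. -/
def Regularizes (C : GenFun line) (c : ℝ → ℝ) : Prop :=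
  ∃ u : Eps → ℝ → ℝ, Represents u C ∧
    (∃ a b : ℝ, 0 < a ∧ ∀ ε, ∀ t, 0 ≤ t → a ≤ u ε t ∧ u ε t ≤ b) ∧
    (∃ B : ℝ, ∀ ε, IntegrableOn (deriv (u ε)) (Ioi 0) ∧
      ∫ t in Ioi (0 : ℝ), |deriv (u ε) t| ≤ B) ∧
    ∀ χ : ℝ → ℝ, ContDiff ℝ ∞ χ → HasCompactSupport χ →
      Tendsto (fun ε => ∫ t, u ε t * χ t) atZero (𝓝 (∫ t, c t * χ t))

/-- Slow scale nets: `|r^ε|^p = O(ε^{-1})` as `ε ↓ 0` for every `p ≥ 0`. -/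
def IsSlowScale (r : Eps → ℝ) : Prop :=
  ∀ p : ℝ, 0 ≤ p → (fun ε => |r ε| ^ p) =O[atZero] fun ε => ((ε : ℝ))⁻¹

end Colombeau

end

open Colombeau

noncomputable section

namespace Colombeau

/-! ### Powers of the regularization parameter -/

/-! Part one is direct: the mollified jump is a fixed smooth step evaluated at `(t - 1) / h`, so `n`
derivatives cost `h ^ (-n)`, and the slow scale condition bounds this by `ε ^ (-1)` for every `n`.

For part two, the decisive remark is that a bounded `G^∞` coefficient is slow. If all derivatives of
`c^ε` are `O(ε ^ (-p))` with one `p` and `c^ε` is bounded, then Landau's inequality between `f`,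
`f'` and `f''`, iterated, makes every derivative `O(ε ^ (-δ))` for every `δ > 0`
(`OrderLE.iteratedDeriv_of_uniform`). Multiplying by the coefficient, its inverse or its derivatives
thus costs no fixed power of `ε`.

For `σ = ±1` let `D_σ = c⁻¹ ∂_t + σ ∂_x` and `P_σ = c^(-1/2) (∂_t w - σ c ∂_x w)`. These derivations
commute, and the wave equation becomes `D_σ P_σ = -g P_{-σ} + n` with the slow coupling `g = ∂_t c /
(2 c²)` (`WaveNet.D_P`). Since `D_{-σ} P_{-σ}` is expressed by `P_σ`, all `D_{-σ}`-derivatives of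
`P_σ` can be estimated successively by integration along the characteristics of `D_σ`, always with
the same power of `ε`, provided these start away from the support of `φ_ε` (`growth_transversal`).
So `P_σ` is transversally regular off its own front `σ x = S(t)`, where `S` is the primitive of
`c^ε`; off both fronts the two transversal regularities combine to regularity in all directions
(`exists_bound_off_characteristics`). Reflection at `t = 1` comes from the slow coupling `g` and
creates no singularity.

On the front, the bound on the variation of `c^ε` gives sup norm estimates uniform in `ε`: `P_{±1} =
O(1 / ε)`, and `O(1)` ahead of the front. A transversal characteristic stays near the front for a
time `O(ε)` only, so `P_{-σ}` has slow growth there, and `P_σ` equals its initial profile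
`c(0)^(-1/2) φ_ε` up to `O(ε ^ (-1/2))` (`exists_abs_P_front_sub_le`). Differences of order `p` and
step `ε` are then of size `1 / ε`, which contradicts a bound `ε ^ (-p)` for the `p`-th derivative;
as `p` is arbitrary, `w` is not `G^∞` at the front (`not_bounded_at_front`).

Finally, distributional convergence of bounded nets gives convergence of `S`, so the regularized
fronts tend to the limiting rays. -/

theorem Eps.pos (ε : Eps) : (0 : ℝ) < ε := ε.2.1

theorem Eps.le_one (ε : Eps) : (ε : ℝ) ≤ 1 := ε.2.2

theorem tendsto_coe_atZero : Tendsto (fun ε : Eps => (ε : ℝ)) atZero (𝓝 0) := tendsto_comap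

/-- Without this, eventual bounds could not be refuted by passing to the limit at the front. -/
instance atZero_neBot : atZero.NeBot := by
  refine comap_neBot fun t ht => ?_
  obtain ⟨r, hr, hrt⟩ := Metric.mem_nhds_iff.1 ht
  refine ⟨⟨min (r / 2) 1, by positivity, min_le_right _ _⟩, hrt ?_⟩
  rw [Metric.mem_ball, dist_zero_right, Real.norm_of_nonneg (by positivity)]
  exact (min_le_left _ _).trans_lt (half_lt_self hr)

theorem eventually_lt_atZero {r : ℝ} (hr : 0 < r) : ∀ᶠ ε : Eps in atZero, (ε : ℝ) < r :=
  tendsto_coe_atZero.eventually (gt_mem_nhds hr)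

theorem Eps.rpow_neg_mono (ε : Eps) {s t : ℝ} (h : s ≤ t) : (ε : ℝ) ^ (-s) ≤ (ε : ℝ) ^ (-t) :=
  Real.rpow_le_rpow_of_exponent_ge ε.pos ε.le_one (neg_le_neg h)

theorem Eps.one_le_rpow_neg (ε : Eps) {s : ℝ} (h : 0 ≤ s) : 1 ≤ (ε : ℝ) ^ (-s) := by
  simpa using ε.rpow_neg_mono h

theorem mul_rpow_neg_mono (ε : Eps) {A s t : ℝ} (h : s ≤ t) :
    A * (ε : ℝ) ^ (-s) ≤ |A| * (ε : ℝ) ^ (-t) :=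
  mul_le_mul (le_abs_self A) (ε.rpow_neg_mono h) (Real.rpow_nonneg ε.pos.le _) (abs_nonneg A)

/-! ### Interpolation of derivatives -/

/-- Landau's inequality. On a window of length `h` inside `[0, T]` containing `x`, the mean value
theorem gives a point where the derivative is at most `2 A / h`; the bound on the second derivative
carries this to `x`. -/
theorem abs_deriv_le_of_bounds {f : ℝ → ℝ} (hf : ContDiff ℝ 2 f) {T h A B x : ℝ} (hh : 0 < h)
    (hhT : h ≤ T) (hA : ∀ y ∈ Icc 0 T, |f y| ≤ A) (hB : ∀ y ∈ Icc 0 T, |deriv (deriv f) y| ≤ B)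
    (hx : x ∈ Icc 0 T) : |deriv f x| ≤ 2 * A / h + h * B := by
  have hf1 : ContDiff ℝ 1 (deriv f) := by
    have : ContDiff ℝ (1 + 1) f := by simpa [one_add_one_eq_two] using hf
    exact (contDiff_succ_iff_deriv.1 this).2.2
  set u := min x (T - h) with hu
  have hu0 : 0 ≤ u := le_min hx.1 (by linarith)
  have hux : u ≤ x := min_le_left _ _
  have huT : u + h ≤ T := by have := min_le_right x (T - h); linarith
  have hxu : x ≤ u + h := by
    rcases le_total x (T - h) with h1 | h1
    · rw [hu, min_eq_left h1]; linarith
    · rw [hu, min_eq_right h1]; linarith [hx.2]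
  obtain ⟨ξ, hξ, e⟩ := exists_deriv_eq_slope f (show u < u + h by linarith)
    hf.continuous.continuousOn ((hf.differentiable (by norm_num)).differentiableOn)
  have h1 : |deriv f ξ| ≤ 2 * A / h := by
    rw [e, add_sub_cancel_left, abs_div, abs_of_pos hh]
    have := abs_sub (f (u + h)) (f u)
    have a1 := hA (u + h) ⟨by linarith, huT⟩
    have a2 := hA u ⟨hu0, by linarith⟩
    gcongr
    linarith
  have h2 : |deriv f x - deriv f ξ| ≤ B * |x - ξ| := by
    have := (convex_Icc (0 : ℝ) T).norm_image_sub_le_of_norm_deriv_le (f := deriv f) (C := B)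
      (fun y _ => (hf1.differentiable (by norm_num)) y) hB
      (show ξ ∈ Icc 0 T from ⟨by linarith [hξ.1], by linarith [hξ.2]⟩) hx
    simpa using this
  have h3 : |x - ξ| ≤ h := by rw [abs_le]; constructor <;> linarith [hξ.1, hξ.2]
  have hB0 : 0 ≤ B := (abs_nonneg _).trans (hB x hx)
  have h4 : |deriv f x| ≤ |deriv f x - deriv f ξ| + |deriv f ξ| := by
    simpa using abs_add_le (deriv f x - deriv f ξ) (deriv f ξ)
  nlinarith

/-- `sup_{[0, T]} |g^ε| = O(ε^{-s})`. -/
def OrderLE (T : ℝ) (g : Eps → ℝ → ℝ) (s : ℝ) : Prop :=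
  ∃ A : ℝ, ∀ᶠ ε in atZero, ∀ x ∈ Icc 0 T, |g ε x| ≤ A * (ε : ℝ) ^ (-s)

theorem OrderLE.mono {T : ℝ} {g : Eps → ℝ → ℝ} {s s' : ℝ} (h : OrderLE T g s) (hs : s ≤ s') :
    OrderLE T g s' := by
  obtain ⟨A, hA⟩ := h
  exact ⟨|A|, hA.mono fun ε h1 x hx => (h1 x hx).trans (mul_rpow_neg_mono ε hs)⟩

theorem OrderLE.deriv_of_second {T : ℝ} (hT : 1 ≤ T) {g : Eps → ℝ → ℝ}
    (hg : ∀ ε, ContDiff ℝ 2 (g ε)) {s t : ℝ} (hst : s ≤ t) (h : OrderLE T g s)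
    (h' : OrderLE T (fun ε => deriv (deriv (g ε))) t) :
    OrderLE T (fun ε => deriv (g ε)) ((s + t) / 2) := by
  obtain ⟨A, hA⟩ := h
  obtain ⟨B, hB⟩ := h'
  refine ⟨2 * A + B, ?_⟩
  filter_upwards [hA, hB] with ε h1 h2 x hx
  -- The window length `ε ^ ((t - s) / 2)` balances the two terms of Landau's inequality.
  have hr : (ε : ℝ) ^ ((t - s) / 2) ≤ 1 := Real.rpow_le_one ε.pos.le ε.le_one (by linarith)
  have := abs_deriv_le_of_bounds (hg ε) (Real.rpow_pos_of_pos ε.pos ((t - s) / 2)) (hr.trans hT)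
    h1 h2 hx
  refine this.trans (le_of_eq ?_)
  have e1 : (ε : ℝ) ^ (-s) / (ε : ℝ) ^ ((t - s) / 2) = (ε : ℝ) ^ (-((s + t) / 2)) := by
    rw [← Real.rpow_sub ε.pos]; congr 1; ring
  have e2 : (ε : ℝ) ^ ((t - s) / 2) * (ε : ℝ) ^ (-t) = (ε : ℝ) ^ (-((s + t) / 2)) := by
    rw [← Real.rpow_add ε.pos]; congr 1; ring
  calc _ = 2 * A * ((ε : ℝ) ^ (-s) / (ε : ℝ) ^ ((t - s) / 2)) +
        B * ((ε : ℝ) ^ ((t - s) / 2) * (ε : ℝ) ^ (-t)) := by ring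
    _ = _ := by rw [e1, e2]; ring

/-- One more derivative costs an arbitrarily small fraction of the available gap `p - s`. The
trivial bound is `m = 0`; each further step applies the previous one to two successive derivatives
and then interpolates. -/
theorem OrderLE.iteratedDeriv_succ_improve {T : ℝ} (hT : 1 ≤ T) {g : Eps → ℝ → ℝ}
    (hg : ∀ ε, ContDiff ℝ ∞ (g ε)) {p : ℝ}
    (hp : ∀ k, OrderLE T (fun ε => iteratedDeriv k (g ε)) p) (m : ℕ) :
    ∀ k s, s ≤ p → OrderLE T (fun ε => iteratedDeriv k (g ε)) s →
      OrderLE T (fun ε => iteratedDeriv (k + 1) (g ε)) (s + 2 / (m + 2) * (p - s)) := by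
  induction m with
  | zero =>
    intro k s _ _
    refine (hp (k + 1)).mono (le_of_eq ?_)
    norm_num
  | succ m ih =>
    intro k s hs h
    have hm : (0 : ℝ) < m + 2 := by positivity
    set x : ℝ := 2 / (m + 2) with hx
    have hx0 : 0 ≤ x := by positivity
    have hx1 : x ≤ 1 := by rw [hx, div_le_one hm]; linarith [(Nat.cast_nonneg m : (0 : ℝ) ≤ m)]
    have h1 := ih k s hs h
    have hs1 : s + x * (p - s) ≤ p := by nlinarith
    have h2 := ih (k + 1) _ hs1 h1
    have e1 : ∀ j, (fun ε => iteratedDeriv (j + 1) (g ε)) =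
        fun ε => deriv (iteratedDeriv j (g ε)) := fun j => by
      funext ε; exact iteratedDeriv_succ
    have h3 := OrderLE.deriv_of_second hT (g := fun ε => iteratedDeriv k (g ε))
      (fun ε => by
        rw [iteratedDeriv_eq_iterate]
        exact ((hg ε).iterate_deriv k).of_le (WithTop.coe_le_coe.2 le_top))
      (s := s) (t := s + x * (p - s) + x * (p - (s + x * (p - s)))) (by nlinarith) h
      (by simpa only [iteratedDeriv_succ] using h2)
    rw [e1]
    refine h3.mono ?_
    have hps : 0 ≤ p - s := by linarith
    -- Two losses of the fraction `x` leave `(1 - x) ^ 2` of the gap; interpolation with `s` halves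
    -- the total loss `2 x - x ^ 2`.
    have key : x - x ^ 2 / 2 ≤ 2 / ((m + 1 : ℕ) + 2 : ℝ) := by
      rw [hx]
      push_cast
      rw [div_sub' (by positivity), div_le_div_iff₀ (by positivity) (by positivity)]
      field_simp
      nlinarith [(Nat.cast_nonneg m : (0 : ℝ) ≤ m)]
    nlinarith

/-- Bounded nets on `[0, T]` whose derivatives satisfy a common moderate bound have derivatives
of arbitrarily small order. -/
theorem OrderLE.iteratedDeriv_of_uniform {T : ℝ} (hT : 1 ≤ T) {g : Eps → ℝ → ℝ}
    (hg : ∀ ε, ContDiff ℝ ∞ (g ε)) {p : ℝ} (h0 : OrderLE T g 0)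
    (hp : ∀ k, OrderLE T (fun ε => iteratedDeriv k (g ε)) p) (k : ℕ) :
    ∀ δ : ℝ, 0 < δ → OrderLE T (fun ε => iteratedDeriv k (g ε)) δ := by
  induction k with
  | zero =>
    intro δ hδ
    simpa using h0.mono hδ.le
  | succ k ih =>
    intro δ hδ
    rcases le_total p (δ / 2) with h | h
    · exact (hp _).mono (by linarith)
    -- Half of `δ` is granted to the lower derivative; this `m` makes the additional loss at most
    -- the other half.
    obtain ⟨m, hm⟩ := exists_nat_gt (4 * p / δ)
    refine (OrderLE.iteratedDeriv_succ_improve hT hg hp m k (δ / 2) h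
      (ih _ (half_pos hδ))).mono ?_
    have h1 : 2 / (m + 2 : ℝ) * (p - δ / 2) ≤ δ / 2 := by
      rw [div_lt_iff₀ hδ] at hm
      rw [div_mul_eq_mul_div, div_le_iff₀ (by positivity)]
      nlinarith
    linarith

/-! ### Mollifiers -/

namespace IsMollifier

variable {φ : ℝ → ℝ} (hφ : IsMollifier φ)
include hφ

theorem hasCompactSupport : HasCompactSupport φ :=
  isCompact_Icc.of_isClosed_subset (isClosed_tsupport φ) hφ.support

/-- The endpoints are covered by continuity. The value at `1` matters: the wave front is sampled
exactly at integer multiples of `ε`. -/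
theorem eq_zero_of_one_le_abs {x : ℝ} (hx : 1 ≤ |x|) : φ x = 0 := by
  have key : ∀ y : ℝ, 1 < y → φ y = 0 := fun y hy =>
    image_eq_zero_of_notMem_tsupport fun h => by linarith [(hφ.support h).2]
  have h1 : φ 1 = 0 := by
    have hc : Tendsto φ (𝓝[>] 1) (𝓝 (φ 1)) :=
      (hφ.smooth.continuous.tendsto 1).mono_left nhdsWithin_le_nhds
    refine tendsto_nhds_unique (hc.congr' ?_) tendsto_const_nhds
    filter_upwards [self_mem_nhdsWithin] with y hy using key y hy
  have h2 : φ |x| = 0 := by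
    rcases hx.eq_or_lt with h | h
    · rw [← h, h1]
    · exact key _ h
  rcases abs_choice x with h | h
  · rwa [h] at h2
  · rwa [h, hφ.even] at h2

theorem monotoneOn : MonotoneOn φ (Icc (-1) 0) :=
  monotoneOn_of_deriv_nonneg (convex_Icc _ _) hφ.smooth.continuous.continuousOn
    (hφ.smooth.differentiable (by simp)).differentiableOn
    fun x hx => hφ.deriv_nonneg x (interior_subset hx)

theorem nonneg (x : ℝ) : 0 ≤ φ x := by
  rcases le_total 1 |x| with h | h
  · rw [hφ.eq_zero_of_one_le_abs h]
  have h1 : φ (-|x|) = φ x := by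
    rcases abs_choice x with h | h <;> rw [h] <;> simp [hφ.even]
  rw [← h1, ← hφ.eq_zero_of_one_le_abs (x := -1) (by simp)]
  exact hφ.monotoneOn (by simp) ⟨by linarith, by simp⟩ (by linarith)

theorem le_apply_zero (x : ℝ) : φ x ≤ φ 0 := by
  rcases le_total 1 |x| with h | h
  · rw [hφ.eq_zero_of_one_le_abs h]
    exact hφ.nonneg 0
  have h1 : φ (-|x|) = φ x := by
    rcases abs_choice x with h | h <;> rw [h] <;> simp [hφ.even]
  rw [← h1]
  exact hφ.monotoneOn ⟨by linarith, by simp⟩ (by simp) (by simp)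

/-- This is the amplitude of the singularity at the front. The maximum of `φ` is at `0`, so if it
vanished, `φ` would be zero and could not have integral one. -/
theorem apply_zero_pos : 0 < φ 0 := by
  refine (hφ.nonneg 0).lt_of_ne fun h => ?_
  have : φ = 0 := funext fun x => le_antisymm ((hφ.le_apply_zero x).trans h.ge) (hφ.nonneg x)
  have h1 := hφ.integral_eq_one
  rw [this] at h1
  simp at h1

theorem integrable : Integrable φ :=
  hφ.smooth.continuous.integrable_of_hasCompactSupport hφ.hasCompactSupport

theorem hasDerivAt_integral_Iic (x : ℝ) :
    HasDerivAt (fun x => ∫ r in Iic x, φ r) (φ x) x := by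
  have e : (fun x => ∫ r in Iic x, φ r) =
      fun x => (∫ r in (0 : ℝ)..x, φ r) + ∫ r in Iic (0 : ℝ), φ r := by
    funext y
    rw [← intervalIntegral.integral_Iic_sub_Iic hφ.integrable.integrableOn
      hφ.integrable.integrableOn]
    ring
  rw [e]
  exact (hφ.smooth.continuous.integral_hasStrictDerivAt 0 x).hasDerivAt.add_const _

theorem contDiff_integral_Iic : ContDiff ℝ ∞ fun x => ∫ r in Iic x, φ r := by
  rw [contDiff_infty_iff_deriv]
  refine ⟨fun x => (hφ.hasDerivAt_integral_Iic x).differentiableAt, ?_⟩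
  rw [funext fun x => (hφ.hasDerivAt_integral_Iic x).deriv]
  exact hφ.smooth

theorem integral_Iic_mem_Icc (x : ℝ) : ∫ r in Iic x, φ r ∈ Icc (0 : ℝ) 1 := by
  refine ⟨setIntegral_nonneg measurableSet_Iic fun r _ => hφ.nonneg r, ?_⟩
  rw [← hφ.integral_eq_one]
  exact setIntegral_le_integral hφ.integrable (Eventually.of_forall hφ.nonneg)

theorem integral_Iic_of_le {x : ℝ} (hx : x ≤ -1) : ∫ r in Iic x, φ r = 0 := by
  refine setIntegral_eq_zero_of_forall_eq_zero fun r hr => hφ.eq_zero_of_one_le_abs ?_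
  rw [abs_of_nonpos (by linarith [mem_Iic.1 hr])]
  linarith [mem_Iic.1 hr]

theorem integral_Iic_of_ge {x : ℝ} (hx : 1 ≤ x) : ∫ r in Iic x, φ r = 1 := by
  rw [← hφ.integral_eq_one]
  refine setIntegral_eq_integral_of_forall_compl_eq_zero fun r hr => hφ.eq_zero_of_one_le_abs ?_
  have : x < r := not_le.1 hr
  rw [abs_of_nonneg (by linarith)]
  linarith

theorem exists_bound_iteratedDeriv_integral_Iic (n : ℕ) :
    ∃ A, ∀ x, |iteratedDeriv n (fun x => ∫ r in Iic x, φ r) x| ≤ A := by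
  cases n with
  | zero =>
    refine ⟨1, fun x => ?_⟩
    have := hφ.integral_Iic_mem_Icc x
    rw [iteratedDeriv_zero, abs_of_nonneg this.1]
    exact this.2
  | succ n =>
    have hn : (n : ℕ∞ω) ≤ ∞ := by exact_mod_cast le_top
    obtain ⟨A, hA⟩ := (hφ.hasCompactSupport.iteratedFDeriv (𝕜 := ℝ) n).exists_bound_of_continuous
      (hφ.smooth.continuous_iteratedFDeriv hn)
    refine ⟨A, fun x => ?_⟩
    rw [iteratedDeriv_succ', funext fun x => (hφ.hasDerivAt_integral_Iic x).deriv,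
      ← Real.norm_eq_abs, ← norm_iteratedFDeriv_eq_norm_iteratedDeriv]
    exact hA x

omit hφ in
theorem _root_.Colombeau.integral_comp_div_mul_inv {h : ℝ} (hh : 0 < h) (f : ℝ → ℝ) :
    ∫ s, f (s / h) / h = ∫ r, f r := by
  rw [integral_div, Measure.integral_comp_div, abs_of_pos hh, smul_eq_mul]
  field_simp

/-- After rescaling, `t - h r` lies beyond the jump exactly when `r ≤ (t - 1) / h`. -/
theorem mollify_speed (c₀ c₁ : ℝ) {h : ℝ} (hh : 0 < h) (t : ℝ) :
    mollify (speed c₀ c₁) φ h t = c₀ + (c₁ - c₀) * ∫ r in Iic ((t - 1) / h), φ r := by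
  have e1 : mollify (speed c₀ c₁) φ h t =
      ∫ s, (fun r => speed c₀ c₁ (t - h * r) * φ r) (s / h) / h := by
    refine integral_congr_ae (Eventually.of_forall fun s => ?_)
    simp only [rescale]
    rw [mul_div_cancel₀ s hh.ne', mul_div_assoc]
  have e2 : ∀ r, speed c₀ c₁ (t - h * r) * φ r =
      c₀ * φ r + (c₁ - c₀) * (Iic ((t - 1) / h)).indicator φ r := by
    intro r
    by_cases hr : r ≤ (t - 1) / h
    · rw [indicator_of_mem (mem_Iic.2 hr)]
      rw [le_div_iff₀ hh] at hr
      rw [speed, if_neg (by linarith)]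
      ring
    · rw [indicator_of_notMem (by simpa using hr)]
      rw [le_div_iff₀ hh] at hr
      rw [speed, if_pos (by linarith)]
      ring
  rw [e1, integral_comp_div_mul_inv hh fun r => speed c₀ c₁ (t - h * r) * φ r,
    integral_congr_ae (Eventually.of_forall e2),
    integral_add (hφ.integrable.const_mul _)
      ((hφ.integrable.indicator measurableSet_Iic).const_mul _), integral_const_mul,
    integral_const_mul, integral_indicator measurableSet_Iic, hφ.integral_eq_one, mul_one]

end IsMollifier

/-! ### Regularization of a jump by slow scale mollification -/

section Mollification

variable {c₀ c₁ : ℝ} {ψ : ℝ → ℝ} (hψ : IsMollifier ψ) {h : Eps → ℝ} (hh : ∀ ε, 0 < h ε)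
include hψ hh

theorem mollify_speed_eq (c₀ c₁ : ℝ) (ε : Eps) : mollify (speed c₀ c₁) ψ (h ε) =
    fun t => c₀ + (c₁ - c₀) * ∫ r in Iic ((h ε)⁻¹ * (t - 1)), ψ r := by
  funext t
  rw [hψ.mollify_speed c₀ c₁ (hh ε), div_eq_inv_mul]

theorem contDiff_mollify_speed (ε : Eps) : ContDiff ℝ ∞ (mollify (speed c₀ c₁) ψ (h ε)) := by
  rw [mollify_speed_eq hψ hh]
  exact contDiff_const.add (contDiff_const.mul
    (hψ.contDiff_integral_Iic.comp (contDiff_const.mul (contDiff_id.sub contDiff_const))))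

/-- The factor `h ^ (-n)` of the `n`-th derivative is `O(ε ^ (-1))` by the slow scale condition, so
the same exponent serves for all `n`. -/
theorem derivBound_mollify_speed (hs : IsSlowScale fun ε => 1 / h ε) (K : Set ℝ) (n : ℕ) :
    DerivBound line (fun ε => mollify (speed c₀ c₁) ψ (h ε)) K n (-1) := by
  obtain ⟨A, hA⟩ := hψ.exists_bound_iteratedDeriv_integral_Iic n
  have hA0 : 0 ≤ A := (abs_nonneg _).trans (hA 0)
  obtain ⟨B, hB⟩ := (hs n (Nat.cast_nonneg n)).bound
  refine ⟨|c₀| + |c₁ - c₀| * A * B, hB.mono fun ε hε x _ => ?_⟩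
  have hε0 := ε.pos
  have hh0 : 0 ≤ (h ε)⁻¹ := (inv_pos.2 (hh ε)).le
  have h1 : (1 : ℝ) ≤ (ε : ℝ)⁻¹ := (one_le_inv₀ hε0).2 ε.le_one
  change ‖iteratedFDerivWithin ℝ n (mollify (speed c₀ c₁) ψ (h ε)) univ x‖ ≤ _
  rw [iteratedFDerivWithin_univ, norm_iteratedFDeriv_eq_norm_iteratedDeriv, zpow_neg_one]
  have hn : (n : ℕ∞ω) ≤ ∞ := by exact_mod_cast le_top
  have hsm : ContDiff ℝ n fun t => (c₁ - c₀) * ∫ r in Iic ((h ε)⁻¹ * t), ψ r :=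
    (contDiff_const.mul
    (hψ.contDiff_integral_Iic.comp (contDiff_const.mul contDiff_id))).of_le hn
  have e : iteratedDeriv n (mollify (speed c₀ c₁) ψ (h ε)) x =
      iteratedDeriv n (fun _ => c₀) (x - 1) + (c₁ - c₀) * ((h ε)⁻¹ ^ n *
        iteratedDeriv n (fun x => ∫ r in Iic x, ψ r) ((h ε)⁻¹ * (x - 1))) := by
    rw [mollify_speed_eq hψ hh]
    have e1 := congrFun (iteratedDeriv_comp_sub_const n
      (fun t => c₀ + (c₁ - c₀) * ∫ r in Iic ((h ε)⁻¹ * t), ψ r) 1) x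
    rw [e1, iteratedDeriv_fun_add contDiff_const.contDiffAt hsm.contDiffAt,
      iteratedDeriv_const_mul_field,
      iteratedDeriv_comp_const_mul (hψ.contDiff_integral_Iic.of_le hn)]
  have h2 : |iteratedDeriv n (fun _ => c₀) (x - 1)| ≤ |c₀| := by
    rw [iteratedDeriv_const]
    split_ifs <;> simp
  have h3 : |(h ε)⁻¹ ^ n| ≤ B * (ε : ℝ)⁻¹ := by
    have := hε
    rw [Real.norm_of_nonneg (by positivity), Real.norm_of_nonneg (by positivity),
      Real.rpow_natCast] at this
    simp only [one_div, abs_of_nonneg hh0] at this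
    rwa [abs_of_nonneg (by positivity)]
  rw [e, Real.norm_eq_abs]
  refine (abs_add_le _ _).trans ?_
  rw [abs_mul, abs_mul, add_mul]
  refine add_le_add (h2.trans (le_mul_of_one_le_right (abs_nonneg _) h1)) ?_
  calc _ ≤ |c₁ - c₀| * ((B * (ε : ℝ)⁻¹) * A) := by
        gcongr
        exact (abs_nonneg _).trans h3
        exact hA _
    _ = _ := by ring

theorem mollify_speed_mem_Icc (ε : Eps) (t : ℝ) :
    mollify (speed c₀ c₁) ψ (h ε) t ∈ Icc (min c₀ c₁) (max c₀ c₁) := by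
  have h1 := hψ.integral_Iic_mem_Icc ((h ε)⁻¹ * (t - 1))
  rw [mollify_speed_eq hψ hh]
  dsimp only
  constructor
  · rcases min_cases c₀ c₁ with ⟨e, _⟩ | ⟨e, _⟩ <;> rw [e] <;> nlinarith [h1.1, h1.2]
  · rcases max_cases c₀ c₁ with ⟨e, _⟩ | ⟨e, _⟩ <;> rw [e] <;> nlinarith [h1.1, h1.2]

theorem deriv_mollify_speed (ε : Eps) : deriv (mollify (speed c₀ c₁) ψ (h ε)) =
    fun t => (c₁ - c₀) * (ψ ((t - 1) / h ε) / h ε) := by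
  funext t
  have h1 : HasDerivAt (fun t : ℝ => (t - 1) / h ε) (1 / h ε) t :=
    ((hasDerivAt_id t).sub_const 1).div_const _
  have h2 := (((hψ.hasDerivAt_integral_Iic ((t - 1) / h ε)).comp t h1).const_mul
    (c₁ - c₀)).const_add c₀
  rw [funext (hψ.mollify_speed c₀ c₁ (hh ε))]
  rw [mul_one_div] at h2
  exact h2.deriv

theorem integrable_deriv_mollify_speed (ε : Eps) :
    Integrable (deriv (mollify (speed c₀ c₁) ψ (h ε))) := by
  rw [deriv_mollify_speed hψ hh]
  exact (((hψ.integrable.comp_div (hh ε).ne').comp_sub_right 1).div_const _).const_mul _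

theorem integral_abs_deriv_mollify_speed (ε : Eps) :
    ∫ t in Ioi (0 : ℝ), |deriv (mollify (speed c₀ c₁) ψ (h ε)) t| ≤ |c₁ - c₀| := by
  refine (setIntegral_le_integral (integrable_deriv_mollify_speed hψ hh ε).abs
    (Eventually.of_forall fun _ => abs_nonneg _)).trans (le_of_eq ?_)
  rw [deriv_mollify_speed hψ hh]
  have e : ∀ t, |(c₁ - c₀) * (ψ ((t - 1) / h ε) / h ε)| =
      |c₁ - c₀| * (fun s => ψ (s / h ε) / h ε) (t - 1) := fun t => by
    rw [abs_mul, abs_of_nonneg (div_nonneg (hψ.nonneg _) (hh ε).le)]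
  rw [funext e, integral_const_mul, integral_sub_right_eq_self (fun s => ψ (s / h ε) / h ε),
    integral_comp_div_mul_inv (hh ε), hψ.integral_eq_one, mul_one]

theorem mollify_speed_eq_speed (ε : Eps) {t : ℝ} (ht : h ε ≤ |t - 1|) :
    mollify (speed c₀ c₁) ψ (h ε) t = speed c₀ c₁ t := by
  rw [hψ.mollify_speed c₀ c₁ (hh ε)]
  have h0 := hh ε
  rcases lt_or_ge t 1 with h1 | h1
  · rw [abs_of_neg (by linarith)] at ht
    rw [hψ.integral_Iic_of_le (by rw [div_le_iff₀ h0]; linarith), speed, if_pos h1]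
    ring
  · rw [abs_of_nonneg (by linarith)] at ht
    rw [hψ.integral_Iic_of_ge (by rw [le_div_iff₀ h0]; linarith), speed, if_neg h1.not_gt]
    ring

omit hψ hh in
theorem measurable_speed (c₀ c₁ : ℝ) : Measurable (speed c₀ c₁) :=
  Measurable.ite measurableSet_Iio measurable_const measurable_const

omit hψ hh in
theorem speed_mem_Icc (c₀ c₁ t : ℝ) : speed c₀ c₁ t ∈ Icc (min c₀ c₁) (max c₀ c₁) := by
  unfold speed
  split_ifs <;> simp

omit hψ hh in
theorem integrable_mul_of_mem_Icc {f χ : ℝ → ℝ} {a b : ℝ} (hf : Measurable f)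
    (hab : ∀ t, f t ∈ Icc a b) (hχ : Integrable χ) : Integrable fun t => f t * χ t := by
  refine hχ.bdd_mul hf.aestronglyMeasurable (c := max |a| |b|) (Eventually.of_forall fun t => ?_)
  exact abs_le_max_abs_abs (hab t).1 (hab t).2

/-- The mollified and the original speed differ only on `[1 - h, 1 + h]`, and there by a bounded
amount. -/
theorem tendsto_integral_mollify_speed_mul (h0 : Tendsto h atZero (𝓝 0)) {χ : ℝ → ℝ}
    (hχ : ContDiff ℝ ∞ χ) (hc : HasCompactSupport χ) :
    Tendsto (fun ε => ∫ t, mollify (speed c₀ c₁) ψ (h ε) t * χ t) atZero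
      (𝓝 (∫ t, speed c₀ c₁ t * χ t)) := by
  obtain ⟨A, hA⟩ := hc.exists_bound_of_continuous hχ.continuous
  have hA0 : 0 ≤ A := (norm_nonneg _).trans (hA 0)
  have hχi := hχ.continuous.integrable_of_hasCompactSupport (μ := volume) hc
  set B := max c₀ c₁ - min c₀ c₁ with hB
  have hB0 : 0 ≤ B := sub_nonneg.2 min_le_max
  rw [tendsto_iff_norm_sub_tendsto_zero]
  refine squeeze_zero (fun _ => norm_nonneg _) (g := fun ε => B * A * (2 * h ε)) (fun ε => ?_)
    (by simpa using (h0.const_mul 2).const_mul (B * A))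
  have hm := contDiff_mollify_speed (c₀ := c₀) (c₁ := c₁) hψ hh ε
  rw [← integral_sub (integrable_mul_of_mem_Icc hm.continuous.measurable
      (mollify_speed_mem_Icc hψ hh ε) hχi)
    (integrable_mul_of_mem_Icc (measurable_speed _ _) (speed_mem_Icc c₀ c₁) hχi)]
  have e : ∀ t, t ∉ Icc (1 - h ε) (1 + h ε) →
      mollify (speed c₀ c₁) ψ (h ε) t * χ t - speed c₀ c₁ t * χ t = 0 := by
    intro t ht
    rw [mollify_speed_eq_speed hψ hh ε, sub_self]
    by_contra hlt
    have := abs_lt.1 (not_le.1 hlt)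
    exact ht ⟨by linarith, by linarith⟩
  rw [← setIntegral_eq_integral_of_forall_compl_eq_zero e]
  refine (norm_setIntegral_le_of_norm_le_const (C := B * A) measure_Icc_lt_top
    fun t _ => ?_).trans (le_of_eq ?_)
  · rw [← sub_mul, norm_mul]
    refine mul_le_mul ?_ (hA t) (norm_nonneg _) hB0
    have h1 := mollify_speed_mem_Icc (c₀ := c₀) (c₁ := c₁) hψ hh ε t
    have h2 := speed_mem_Icc c₀ c₁ t
    rw [Real.norm_eq_abs, abs_le]
    constructor <;> linarith [h1.1, h1.2, h2.1, h2.2]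
  · have := hh ε
    rw [measureReal_def, Real.volume_Icc, ENNReal.toReal_ofReal (by linarith)]
    ring

theorem exists_regularizes_mollify_speed (hc₀ : 0 < c₀) (hc₁ : 0 < c₁)
    (h0 : Tendsto h atZero (𝓝 0)) (hs : IsSlowScale fun ε => 1 / h ε) :
    ∃ C : GenFun line, Represents (fun ε => mollify (speed c₀ c₁) ψ (h ε)) C ∧
      Regularizes C (speed c₀ c₁) ∧ IsGInfty C := by
  have hm : IsModerate line fun ε => mollify (speed c₀ c₁) ψ (h ε) :=
    ⟨fun ε => (contDiff_mollify_speed hψ hh ε).contDiffOn,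
      fun K _ _ n => ⟨1, derivBound_mollify_speed hψ hh hs K n⟩⟩
  refine ⟨Ideal.Quotient.mk _ ⟨_, hm⟩, ⟨hm, rfl⟩,
    ⟨_, ⟨hm, rfl⟩, ⟨min c₀ c₁, max c₀ c₁, lt_min hc₀ hc₁,
      fun ε t _ => mollify_speed_mem_Icc hψ hh ε t⟩,
      ⟨|c₁ - c₀|, fun ε => ⟨(integrable_deriv_mollify_speed hψ hh ε).integrableOn,
        integral_abs_deriv_mollify_speed hψ hh ε⟩⟩,
      fun χ hχ hc => tendsto_integral_mollify_speed_mul hψ hh h0 hχ hc⟩,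
    _, ⟨hm, rfl⟩, fun K _ _ => ⟨1, fun n => derivBound_mollify_speed hψ hh hs K n⟩⟩

end Mollification

/-! ### Regularity with respect to derivations -/

section Derivations

variable {A : Type*} [CommRing A] [Algebra ℝ A] {G : Subalgebra ℝ A}

/-- A derivation that preserves a subalgebra of coefficients. -/
def Preserves (G : Subalgebra ℝ A) (D : Derivation ℝ A A) : Prop := ∀ a ∈ G, D a ∈ G

theorem coeff_mul_mem (B : Submodule G A) {a f : A} (ha : a ∈ G) (hf : f ∈ B) : a * f ∈ B :=
  B.smul_mem (⟨a, ha⟩ : G) hf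

theorem coeff_mem {B : Submodule G A} (hB : (1 : A) ∈ B) {a : A} (ha : a ∈ G) : a ∈ B := by
  simpa using coeff_mul_mem B ha hB

theorem real_smul_mem (B : Submodule G A) (r : ℝ) {f : A} (hf : f ∈ B) : r • f ∈ B := by
  rw [Algebra.smul_def]
  exact coeff_mul_mem B (G.algebraMap_mem r) hf

theorem coeff_sub_mem (B : Submodule G A) {f g : A} (hf : f ∈ B) (hg : g ∈ B) : f - g ∈ B :=
  B.sub_mem hf hg

/-- The elements of `B` whose derivative lies in `B`. -/
def derivStep {D : Derivation ℝ A A} (hD : Preserves G D) (B : Submodule G A) :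
    Submodule G A where
  carrier := {f | f ∈ B ∧ D f ∈ B}
  zero_mem' := ⟨B.zero_mem, by simp⟩
  add_mem' := fun hf hg => ⟨B.add_mem hf.1 hg.1, by rw [map_add]; exact B.add_mem hf.2 hg.2⟩
  smul_mem' := fun a f hf => by
    refine ⟨B.smul_mem a hf.1, ?_⟩
    change D ((a : A) * f) ∈ B
    rw [D.leibniz, smul_eq_mul, smul_eq_mul, mul_comm f]
    exact B.add_mem (coeff_mul_mem B a.2 hf.2) (coeff_mul_mem B (hD a a.2) hf.1)

/-- The elements of `B` whose derivatives up to order `k` lie in `B`. -/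
def reg {D : Derivation ℝ A A} (hD : Preserves G D) (B : Submodule G A) : ℕ → Submodule G A
  | 0 => B
  | k + 1 => derivStep hD (reg hD B k)

/-- The elements of `B` all of whose derivatives lie in `B`. -/
def regInf {D : Derivation ℝ A A} (hD : Preserves G D) (B : Submodule G A) : Submodule G A :=
  ⨅ k, reg hD B k

/-- The elements of `B` whose mixed derivatives up to order `k` lie in `B`. -/
def mixedReg {D D' : Derivation ℝ A A} (hD : Preserves G D) (hD' : Preserves G D')
    (B : Submodule G A) : ℕ → Submodule G A
  | 0 => B
  | k + 1 => derivStep hD (mixedReg hD hD' B k) ⊓ derivStep hD' (mixedReg hD hD' B k)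

section

variable {D D' E E' : Derivation ℝ A A} (hD : Preserves G D) (hD' : Preserves G D')
  (hE : Preserves G E) (hE' : Preserves G E') {B : Submodule G A}

theorem one_mem_derivStep (hB : (1 : A) ∈ B) : (1 : A) ∈ derivStep hD B :=
  ⟨hB, by rw [D.map_one_eq_zero]; exact B.zero_mem⟩

theorem one_mem_reg (hB : (1 : A) ∈ B) (k : ℕ) : (1 : A) ∈ reg hD B k := by
  induction k with
  | zero => exact hB
  | succ k ih => exact one_mem_derivStep hD ih

theorem one_mem_regInf (hB : (1 : A) ∈ B) : (1 : A) ∈ regInf hD B :=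
  (Submodule.mem_iInf _).2 (one_mem_reg hD hB)

theorem one_mem_mixedReg (hB : (1 : A) ∈ B) (k : ℕ) : (1 : A) ∈ mixedReg hD hD' B k := by
  induction k with
  | zero => exact hB
  | succ k ih => exact ⟨one_mem_derivStep hD ih, one_mem_derivStep hD' ih⟩

theorem mem_reg_iff (k : ℕ) (f : A) : f ∈ reg hD B k ↔ ∀ i ≤ k, D^[i] f ∈ B := by
  induction k generalizing f with
  | zero => simp [reg]
  | succ k ih =>
    change f ∈ reg hD B k ∧ D f ∈ reg hD B k ↔ _
    rw [ih, ih]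
    constructor
    · rintro ⟨h1, h2⟩ i hi
      cases i with
      | zero => exact h1 0 (Nat.zero_le _)
      | succ i => exact h2 i (by omega)
    · intro h
      exact ⟨fun i hi => h i (by omega), fun i hi => h (i + 1) (by omega)⟩

theorem mem_regInf_iff (f : A) : f ∈ regInf hD B ↔ ∀ i, D^[i] f ∈ B := by
  simp only [regInf, Submodule.mem_iInf, mem_reg_iff]
  exact ⟨fun h i => h i i le_rfl, fun h _ i _ => h i⟩

theorem mem_reg_succ {k : ℕ} {f : A} (h : f ∈ B) (h' : D f ∈ reg hD B k) :
    f ∈ reg hD B (k + 1) := by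
  rw [mem_reg_iff] at h' ⊢
  intro i hi
  cases i with
  | zero => exact h
  | succ i => exact h' i (by omega)

theorem mem_regInf_of_deriv {f : A} (h : f ∈ B) (h' : D f ∈ regInf hD B) : f ∈ regInf hD B := by
  rw [mem_regInf_iff] at h' ⊢
  intro i
  cases i with
  | zero => exact h
  | succ i => exact h' i

theorem deriv_mem_regInf {f : A} (h : f ∈ regInf hD B) : D f ∈ regInf hD B := by
  rw [mem_regInf_iff] at h ⊢
  exact fun i => h (i + 1)

theorem mem_of_mem_regInf {f : A} (h : f ∈ regInf hD B) : f ∈ B :=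
  (mem_regInf_iff hD f).1 h 0

theorem deriv_mem_reg_of_commute (hc : ∀ f, E (D f) = D (E f)) (hB : ∀ f ∈ B, E f ∈ B) {k : ℕ}
    {f : A} (h : f ∈ reg hD B k) : E f ∈ reg hD B k := by
  induction k generalizing f with
  | zero => exact hB f h
  | succ k ih => exact ⟨ih h.1, by rw [← hc]; exact ih h.2⟩

/-- The hypothesis ranges over all submodules because the induction uses it for the mixed regularity
module of each order, not for `B` alone. -/
theorem mixedReg_le (h : ∀ C : Submodule G A, ∀ f, D f ∈ C → D' f ∈ C → E f ∈ C ∧ E' f ∈ C)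
    (k : ℕ) : mixedReg hD hD' B k ≤ mixedReg hE hE' B k := by
  induction k with
  | zero => exact le_rfl
  | succ k ih =>
    rintro f ⟨⟨h0, h1⟩, -, h2⟩
    have := h _ f (ih h1) (ih h2)
    exact ⟨⟨ih h0, this.1⟩, ih h0, this.2⟩

end

/-! ### Propagation of regularity for a two by two system -/

/-- The system `D P = -g Q + n`, `D' Q = -g P + n` for commuting derivations `D` and `D'`. -/
structure IsTransportSystem (G : Subalgebra ℝ A) (D D' : Derivation ℝ A A) (g n P Q : A) :
    Prop where
  preserves : Preserves G D
  preserves' : Preserves G D'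
  comm : ∀ f, D (D' f) = D' (D f)
  coeff_mem : g ∈ G
  rhs_mem : n ∈ G
  eq : D P = -(g * Q) + n
  eq' : D' Q = -(g * P) + n

namespace IsTransportSystem

variable {D D' : Derivation ℝ A A} {g n P Q : A} (S : IsTransportSystem G D D' g n P Q)
  {B : Submodule G A}
include S

theorem symm : IsTransportSystem G D' D g n Q P :=
  ⟨S.preserves', S.preserves, fun f => (S.comm f).symm, S.coeff_mem, S.rhs_mem, S.eq', S.eq⟩

theorem deriv_mem (hB : (1 : A) ∈ B) (hQ : Q ∈ B) : D P ∈ B := by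
  rw [S.eq]
  exact B.add_mem (B.neg_mem (coeff_mul_mem B S.coeff_mem hQ)) (Colombeau.coeff_mem hB S.rhs_mem)

theorem deriv_mem' (hB : (1 : A) ∈ B) (hP : P ∈ B) : D' Q ∈ B := S.symm.deriv_mem hB hP

theorem comm_iterate (f : A) (k : ℕ) : D (D'^[k] f) = D'^[k] (D f) := by
  induction k generalizing f with
  | zero => rfl
  | succ k ih => rw [Function.iterate_succ_apply, ih, S.comm, Function.iterate_succ_apply]

/-- If one can integrate in the direction `D`, then `P` and `Q` are regular in the
direction `D'`. -/
theorem mem_reg_of_integration (hB : (1 : A) ∈ B) (hP : P ∈ B) (hQ : Q ∈ B)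
    (hint : ∀ k, D (D'^[k] P) ∈ B → D'^[k] P ∈ B) (k : ℕ) :
    P ∈ reg S.preserves' B k ∧ Q ∈ reg S.preserves' B k := by
  induction k with
  | zero => exact ⟨hP, hQ⟩
  | succ k ih =>
    have h1 := one_mem_reg S.preserves' hB
    -- `D' Q` involves only `P`, so `Q` is one derivative ahead of `P`. Hence `D (D'^[k + 1] P) =
    -- D'^[k + 1] (D P)` lies in `B` and can be integrated.
    have hQ' : Q ∈ reg S.preserves' B (k + 1) :=
      mem_reg_succ S.preserves' hQ (S.deriv_mem' (h1 k) ih.1)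
    refine ⟨(mem_reg_iff _ _ _).2 fun i hi => ?_, hQ'⟩
    rcases Nat.lt_or_ge k i with h | h
    · obtain rfl : i = k + 1 := by omega
      refine hint _ ?_
      rw [S.comm_iterate]
      exact (mem_reg_iff _ _ _).1 (S.deriv_mem (h1 (k + 1)) hQ') _ le_rfl
    · exact (mem_reg_iff _ _ _).1 ih.1 i h

/-- Regularity in one direction `X` implies regularity in the direction `D' = D - r X`. -/
theorem iterate_mem_of_regInf {X : Derivation ℝ A A} (hX : Preserves G X) {r : ℝ}
    (hr : ∀ f, D' f = D f - r • X f) (hc : ∀ f, X (D' f) = D' (X f)) (hB : (1 : A) ∈ B)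
    (hP : P ∈ regInf hX B) (hQ : Q ∈ regInf hX B) (k : ℕ) : D'^[k] P ∈ B := by
  have h1 := one_mem_regInf hX hB
  have key : ∀ k, P ∈ reg S.preserves' (regInf hX B) k ∧ Q ∈ reg S.preserves' (regInf hX B) k := by
    intro k
    induction k with
    | zero => exact ⟨hP, hQ⟩
    | succ k ih =>
      have h2 := one_mem_reg S.preserves' h1 k
      refine ⟨⟨ih.1, ?_⟩, ih.2, S.deriv_mem' h2 ih.1⟩
      -- In `D' P = D P - r • X P` the equation trades `D P` for `Q`, and `X P` is as regular as `P`
      -- because `X` commutes with `D'`.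
      rw [hr]
      exact coeff_sub_mem _ (S.deriv_mem h2 ih.2) (real_smul_mem _ _
        (deriv_mem_reg_of_commute S.preserves' hc (fun f => deriv_mem_regInf hX) ih.1))
  exact mem_of_mem_regInf hX ((mem_reg_iff _ _ _).1 (key k).1 k le_rfl)

/-- Regularity in each of the two characteristic directions implies joint regularity. -/
theorem mem_mixedReg (hB : (1 : A) ∈ B) (hP : P ∈ regInf S.preserves' B)
    (hQ : Q ∈ regInf S.preserves B) (k : ℕ) :
    P ∈ mixedReg S.preserves S.preserves' B k ∧ Q ∈ mixedReg S.preserves S.preserves' B k := by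
  -- The induction carries infinite transversal regularity measured in the mixed module of order
  -- `k`. Transversal derivatives are available by assumption; the remaining one, `D P` or `D' Q`,
  -- is supplied by the system.
  have key : ∀ k, P ∈ regInf S.preserves' (mixedReg S.preserves S.preserves' B k) ∧
      Q ∈ regInf S.preserves (mixedReg S.preserves S.preserves' B k) := by
    intro k
    induction k with
    | zero => exact ⟨hP, hQ⟩
    | succ k ih =>
      have h1 := one_mem_mixedReg S.preserves S.preserves' hB k
      have hQ' : Q ∈ regInf S.preserves' (mixedReg S.preserves S.preserves' B k) :=
        mem_regInf_of_deriv _ (mem_of_mem_regInf _ ih.2)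
          (S.deriv_mem' (one_mem_regInf _ h1) ih.1)
      have hP' : P ∈ regInf S.preserves (mixedReg S.preserves S.preserves' B k) :=
        mem_regInf_of_deriv _ (mem_of_mem_regInf _ ih.1)
          (S.deriv_mem (one_mem_regInf _ h1) ih.2)
      have aP := (mem_regInf_iff _ _).1 ih.1
      have aQ := (mem_regInf_iff _ _).1 ih.2
      refine ⟨(mem_regInf_iff _ _).2 fun i => ⟨⟨aP i, ?_⟩, aP i, ?_⟩,
        (mem_regInf_iff _ _).2 fun i => ⟨⟨aQ i, ?_⟩, aQ i, ?_⟩⟩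
      · rw [S.comm_iterate]
        exact (mem_regInf_iff _ _).1 (S.deriv_mem (one_mem_regInf _ h1) hQ') i
      · rw [← Function.iterate_succ_apply' D']
        exact aP (i + 1)
      · rw [← Function.iterate_succ_apply' D]
        exact aQ (i + 1)
      · rw [S.symm.comm_iterate]
        exact (mem_regInf_iff _ _).1 (S.deriv_mem' (one_mem_regInf _ h1) hP') i
  exact ⟨mem_of_mem_regInf _ (key k).1, mem_of_mem_regInf _ (key k).2⟩

end IsTransportSystem

end Derivations

/-! ### The algebra of nets of smooth functions on the half plane -/

/-- The projection onto the closed half plane. -/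
def clamp (z : ℝ × ℝ) : ℝ × ℝ := (max 0 z.1, z.2)

theorem mem_halfPlane {z : ℝ × ℝ} : z ∈ halfPlane.carrier ↔ 0 ≤ z.1 := by
  simp [halfPlane]

theorem clamp_mem (z : ℝ × ℝ) : clamp z ∈ halfPlane.carrier :=
  mem_halfPlane.2 (le_max_left _ _)

theorem clamp_of_mem {z : ℝ × ℝ} (hz : z ∈ halfPlane.carrier) : clamp z = z :=
  Prod.ext (max_eq_right (mem_halfPlane.1 hz)) rfl

theorem clamp_clamp (z : ℝ × ℝ) : clamp (clamp z) = clamp z := clamp_of_mem (clamp_mem z)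

/-- The algebra of nets of smooth functions on the half plane, extended constantly in `t` to
`t ≤ 0`. -/
def netAlgebra : Subalgebra ℝ (Eps → ℝ × ℝ → ℝ) where
  carrier := {f | ∀ ε, ContDiffOn ℝ ∞ (f ε) halfPlane.carrier ∧ ∀ z, f ε (clamp z) = f ε z}
  mul_mem' := fun hf hg ε => ⟨(hf ε).1.mul (hg ε).1, fun z => by
    simp only [Pi.mul_apply, (hf ε).2 z, (hg ε).2 z]⟩
  add_mem' := fun hf hg ε => ⟨(hf ε).1.add (hg ε).1, fun z => by
    simp only [Pi.add_apply, (hf ε).2 z, (hg ε).2 z]⟩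
  algebraMap_mem' := fun r ε => ⟨contDiffOn_const (c := r), fun _ => rfl⟩

/-- Nets of smooth functions on the half plane. -/
abbrev Net : Type := netAlgebra

namespace Net

theorem contDiffOn (f : Net) (ε : Eps) : ContDiffOn ℝ ∞ (f.1 ε) halfPlane.carrier := (f.2 ε).1

theorem differentiableWithinAt (f : Net) (ε : Eps) {z : ℝ × ℝ} (hz : z ∈ halfPlane.carrier) :
    DifferentiableWithinAt ℝ (f.1 ε) halfPlane.carrier z :=
  (f.contDiffOn ε).differentiableOn (by simp) z hz

/-- The clamping condition in `netAlgebra` exists for this: identities valid on the half plane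
become equations in a commutative ring, open to `linear_combination` and to the abstract theory of
derivations. -/
theorem ext {f g : Net} (h : ∀ ε, ∀ z ∈ halfPlane.carrier, f.1 ε z = g.1 ε z) : f = g := by
  refine Subtype.ext (funext fun ε => funext fun z => ?_)
  rw [← (f.2 ε).2, ← (g.2 ε).2]
  exact h ε _ (clamp_mem z)

theorem add_apply (f g : Net) (ε : Eps) (z : ℝ × ℝ) : (f + g).1 ε z = f.1 ε z + g.1 ε z := rfl

theorem sub_apply (f g : Net) (ε : Eps) (z : ℝ × ℝ) : (f - g).1 ε z = f.1 ε z - g.1 ε z := rfl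

theorem mul_apply (f g : Net) (ε : Eps) (z : ℝ × ℝ) : (f * g).1 ε z = f.1 ε z * g.1 ε z := rfl

theorem smul_apply (r : ℝ) (f : Net) (ε : Eps) (z : ℝ × ℝ) : (r • f).1 ε z = r * f.1 ε z := rfl

theorem one_apply (ε : Eps) (z : ℝ × ℝ) : (1 : Net).1 ε z = 1 := rfl

/-- The net of a family of functions that are smooth on the half plane. -/
def ofSmooth (u : Eps → ℝ × ℝ → ℝ) (hu : ∀ ε, ContDiffOn ℝ ∞ (u ε) halfPlane.carrier) : Net :=
  ⟨fun ε z => u ε (clamp z), fun ε => ⟨(hu ε).congr fun _ hz => congrArg (u ε) (clamp_of_mem hz),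
    fun z => congrArg (u ε) (clamp_clamp z)⟩⟩

theorem ofSmooth_apply {u : Eps → ℝ × ℝ → ℝ} (hu : ∀ ε, ContDiffOn ℝ ∞ (u ε) halfPlane.carrier)
    (ε : Eps) {z : ℝ × ℝ} (hz : z ∈ halfPlane.carrier) : (ofSmooth u hu).1 ε z = u ε z := by
  change u ε (clamp z) = u ε z
  rw [clamp_of_mem hz]

/-- The derivative in the direction `v`, as a function. -/
def dirFun (v : ℝ × ℝ) (f : Net) : Net :=
  ofSmooth (fun ε z => fderivWithin ℝ (f.1 ε) halfPlane.carrier z v) fun ε =>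
    ((f.contDiffOn ε).fderivWithin halfPlane.uniqueDiffOn (by simp)).clm_apply contDiffOn_const

theorem dirFun_apply (v : ℝ × ℝ) (f : Net) (ε : Eps) {z : ℝ × ℝ} (hz : z ∈ halfPlane.carrier) :
    (dirFun v f).1 ε z = fderivWithin ℝ (f.1 ε) halfPlane.carrier z v :=
  ofSmooth_apply (u := fun ε z => fderivWithin ℝ (f.1 ε) halfPlane.carrier z v) _ ε hz

/-- The derivative in the direction `v`. -/
def dir (v : ℝ × ℝ) : Derivation ℝ Net Net :=
  Derivation.mk'
    { toFun := dirFun v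
      map_add' := fun f g => Net.ext fun ε z hz => by
        rw [add_apply, dirFun_apply _ _ _ hz, dirFun_apply _ _ _ hz, dirFun_apply _ _ _ hz]
        change fderivWithin ℝ (f.1 ε + g.1 ε) _ z v = _
        rw [fderivWithin_add (halfPlane.uniqueDiffOn z hz) (f.differentiableWithinAt ε hz)
          (g.differentiableWithinAt ε hz)]
        rfl
      map_smul' := fun r f => Net.ext fun ε z hz => by
        rw [RingHom.id_apply, smul_apply, dirFun_apply _ _ _ hz, dirFun_apply _ _ _ hz]
        change fderivWithin ℝ (r • f.1 ε) _ z v = _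
        rw [fderivWithin_const_smul (halfPlane.uniqueDiffOn z hz) (f.differentiableWithinAt ε hz)]
        rfl }
    fun f g => Net.ext fun ε z hz => by
      change (dirFun v (f * g)).1 ε z = f.1 ε z * (dirFun v g).1 ε z + g.1 ε z * (dirFun v f).1 ε z
      rw [dirFun_apply _ _ _ hz, dirFun_apply _ _ _ hz, dirFun_apply _ _ _ hz]
      change fderivWithin ℝ (f.1 ε * g.1 ε) _ z v = _
      rw [fderivWithin_mul (halfPlane.uniqueDiffOn z hz) (f.differentiableWithinAt ε hz)
          (g.differentiableWithinAt ε hz)]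
      rfl

theorem dir_apply (v : ℝ × ℝ) (f : Net) (ε : Eps) {z : ℝ × ℝ} (hz : z ∈ halfPlane.carrier) :
    (dir v f).1 ε z = fderivWithin ℝ (f.1 ε) halfPlane.carrier z v :=
  dirFun_apply v f ε hz

theorem subset_closure_interior : halfPlane.carrier ⊆ closure (interior halfPlane.carrier) := by
  intro z hz
  have : interior halfPlane.carrier = Ioi 0 ×ˢ univ := by
    simp [halfPlane, interior_prod_eq]
  rw [this, closure_prod_eq, closure_Ioi, closure_univ]
  exact hz

/-- Second derivatives are symmetric up to the boundary because the half plane lies in the closure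
of its interior. -/
theorem dir_comm (v w : ℝ × ℝ) (f : Net) : dir v (dir w f) = dir w (dir v f) := by
  refine Net.ext fun ε z hz => ?_
  have key : ∀ v w : ℝ × ℝ, (dir v (dir w f)).1 ε z =
      fderivWithin ℝ (fderivWithin ℝ (f.1 ε) halfPlane.carrier) halfPlane.carrier z v w := by
    intro v w
    have hd : DifferentiableWithinAt ℝ (fderivWithin ℝ (f.1 ε) halfPlane.carrier)
        halfPlane.carrier z :=
      ((f.contDiffOn ε).fderivWithin halfPlane.uniqueDiffOn (m := ∞) (by simp)).differentiableOn
        (by simp) z hz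
    rw [dir_apply _ _ _ hz, fderivWithin_congr (fun y hy => dir_apply w f ε hy)
      (dir_apply w f ε hz), fderivWithin_clm_apply (halfPlane.uniqueDiffOn z hz) hd
      (differentiableWithinAt_const w)]
    simp
  rw [key, key]
  exact (((f.contDiffOn ε) z hz).isSymmSndFDerivWithinAt
    (by rw [minSmoothness_of_isRCLikeNormedField]; exact WithTop.coe_le_coe.2 le_top) halfPlane.uniqueDiffOn
    (subset_closure_interior hz) hz).eq v w

theorem fderivWithin_eq (f : Net) (ε : Eps) {z : ℝ × ℝ} (hz : z ∈ halfPlane.carrier) :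
    fderivWithin ℝ (f.1 ε) halfPlane.carrier z =
      (dir (1, 0) f).1 ε z • ContinuousLinearMap.fst ℝ ℝ ℝ +
        (dir (0, 1) f).1 ε z • ContinuousLinearMap.snd ℝ ℝ ℝ := by
  refine ContinuousLinearMap.ext fun v => ?_
  have : v = v.1 • ((1 : ℝ), (0 : ℝ)) + v.2 • ((0 : ℝ), (1 : ℝ)) := by ext <;> simp
  conv_lhs => rw [this]
  rw [map_add, map_smul, map_smul, dir_apply _ _ _ hz, dir_apply _ _ _ hz]
  simp [mul_comm]

/-! ### Functions of time -/

theorem contDiffOn_comp_fst {f : ℝ → ℝ} (hf : ContDiffOn ℝ ∞ f (Ici 0)) :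
    ContDiffOn ℝ ∞ (fun z : ℝ × ℝ => f z.1) halfPlane.carrier :=
  hf.comp contDiff_fst.contDiffOn fun _ hz => mem_halfPlane.1 hz

/-- A net of functions of `t`, viewed as a net of functions of `(t, x)`. -/
def time (f : Eps → ℝ → ℝ) (hf : ∀ ε, ContDiffOn ℝ ∞ (f ε) (Ici 0)) : Net :=
  ofSmooth (fun ε z => f ε z.1) fun ε => contDiffOn_comp_fst (hf ε)

theorem time_apply {f : Eps → ℝ → ℝ} (hf : ∀ ε, ContDiffOn ℝ ∞ (f ε) (Ici 0)) (ε : Eps)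
    {z : ℝ × ℝ} (hz : z ∈ halfPlane.carrier) : (time f hf).1 ε z = f ε z.1 :=
  ofSmooth_apply _ _ hz

theorem dir_time {f : Eps → ℝ → ℝ} (hf : ∀ ε, ContDiffOn ℝ ∞ (f ε) (Ici 0)) (v : ℝ × ℝ) (ε : Eps)
    {z : ℝ × ℝ} (hz : z ∈ halfPlane.carrier) :
    (dir v (time f hf)).1 ε z = v.1 * derivWithin (f ε) (Ici 0) z.1 := by
  rw [dir_apply _ _ _ hz, fderivWithin_congr (fun y hy => time_apply hf ε hy)
    (time_apply hf ε hz)]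
  have h1 : HasDerivWithinAt (f ε) (derivWithin (f ε) (Ici 0) z.1) (Ici 0) z.1 :=
    ((hf ε).differentiableOn (by simp) z.1 (mem_halfPlane.1 hz)).hasDerivWithinAt
  have h2 := h1.hasFDerivWithinAt.comp (f := Prod.fst) z hasFDerivWithinAt_fst
    (fun y hy => mem_halfPlane.1 hy)
  change fderivWithin ℝ (f ε ∘ Prod.fst) _ _ _ = _
  rw [h2.fderivWithin (halfPlane.uniqueDiffOn z hz)]
  simp

theorem dir_space_time {f : Eps → ℝ → ℝ} (hf : ∀ ε, ContDiffOn ℝ ∞ (f ε) (Ici 0)) :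
    dir (0, 1) (time f hf) = 0 :=
  Net.ext fun ε z hz => by rw [dir_time hf _ ε hz]; simp

theorem dir_time_of_contDiff {f : Eps → ℝ → ℝ} (hf : ∀ ε, ContDiff ℝ ∞ (f ε)) (v : ℝ × ℝ) :
    dir v (time f fun ε => (hf ε).contDiffOn) =
      v.1 • time (fun ε => deriv (f ε))
        (fun ε => ((contDiff_infty_iff_deriv.1 (hf ε)).2).contDiffOn) :=
  Net.ext fun ε z hz => by
    rw [dir_time _ _ ε hz, smul_apply, time_apply _ ε hz]
    congr 1
    exact (((hf ε).differentiable (by simp)) z.1).derivWithin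
      (uniqueDiffOn_Ici 0 z.1 (mem_halfPlane.1 hz))

/-! ### Growth in the regularization parameter -/

/-- `sup_{Z_ε} |f^ε| = O(ε^{-(m + δ)})` for all `δ > 0`. -/
def Growth (Z : Eps → Set (ℝ × ℝ)) (m : ℝ) (f : Net) : Prop :=
  ∀ δ : ℝ, 0 < δ → ∃ A : ℝ, ∀ᶠ ε : Eps in atZero, ∀ z ∈ Z ε, |f.1 ε z| ≤ A * (ε : ℝ) ^ (-(m + δ))

namespace Growth

variable {Z Z' : Eps → Set (ℝ × ℝ)} {m m' : ℝ} {f g : Net}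

theorem mono (h : Growth Z m f) (hm : m ≤ m') (hZ : ∀ᶠ ε in atZero, Z' ε ⊆ Z ε) :
    Growth Z' m' f := by
  intro δ hδ
  obtain ⟨A, hA⟩ := h δ hδ
  refine ⟨|A|, ?_⟩
  filter_upwards [hA, hZ] with ε h1 h2 z hz
  exact (h1 z (h2 hz)).trans (mul_rpow_neg_mono ε (by linarith))

theorem add (hf : Growth Z m f) (hg : Growth Z m g) : Growth Z m (f + g) := by
  intro δ hδ
  obtain ⟨A, hA⟩ := hf δ hδ
  obtain ⟨B, hB⟩ := hg δ hδ
  refine ⟨A + B, ?_⟩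
  filter_upwards [hA, hB] with ε h1 h2 z hz
  rw [add_apply, add_mul]
  exact (abs_add_le _ _).trans (add_le_add (h1 z hz) (h2 z hz))

theorem mul (hf : Growth Z m f) (hg : Growth Z m' g) : Growth Z (m + m') (f * g) := by
  intro δ hδ
  -- The arbitrary loss `δ` is shared between the two factors; this is what makes `bounded` a module
  -- over the slow nets.
  obtain ⟨A, hA⟩ := hf _ (half_pos hδ)
  obtain ⟨B, hB⟩ := hg _ (half_pos hδ)
  refine ⟨A * B, ?_⟩
  filter_upwards [hA, hB] with ε h1 h2 z hz
  have e : (ε : ℝ) ^ (-(m + m' + δ)) =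
      (ε : ℝ) ^ (-(m + δ / 2)) * (ε : ℝ) ^ (-(m' + δ / 2)) := by
    rw [← Real.rpow_add ε.pos]
    congr 1
    ring
  rw [mul_apply, abs_mul, e]
  calc _ ≤ (A * (ε : ℝ) ^ (-(m + δ / 2))) * (B * (ε : ℝ) ^ (-(m' + δ / 2))) :=
        mul_le_mul (h1 z hz) (h2 z hz) (abs_nonneg _) ((abs_nonneg _).trans (h1 z hz))
    _ = _ := by ring

theorem of_bound {A : ℝ} (hm : 0 ≤ m) (h : ∀ᶠ ε in atZero, ∀ z ∈ Z ε, |f.1 ε z| ≤ A) :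
    Growth Z m f := by
  intro δ hδ
  refine ⟨|A|, h.mono fun ε h1 z hz => (h1 z hz).trans ((le_abs_self A).trans ?_)⟩
  exact le_mul_of_one_le_right (abs_nonneg A) (ε.one_le_rpow_neg (by linarith))

theorem zero : Growth Z m 0 := fun _ _ =>
  ⟨0, Eventually.of_forall fun ε z _ => by
    change |(0 : ℝ)| ≤ _
    simp⟩

end Growth

/-- Iterated directional derivatives. -/
def dirs (l : List (ℝ × ℝ)) (f : Net) : Net := l.foldl (fun f v => dir v f) f

theorem dirs_cons (v : ℝ × ℝ) (l : List (ℝ × ℝ)) (f : Net) : dirs (v :: l) f = dirs l (dir v f) :=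
  rfl

theorem dirs_add (l : List (ℝ × ℝ)) (f g : Net) : dirs l (f + g) = dirs l f + dirs l g := by
  induction l generalizing f g with
  | nil => rfl
  | cons v l ih => rw [dirs_cons, map_add, ih]; rfl

theorem dirs_smul (l : List (ℝ × ℝ)) (r : ℝ) (f : Net) : dirs l (r • f) = r • dirs l f := by
  induction l generalizing f with
  | nil => rfl
  | cons v l ih => rw [dirs_cons, (dir v).map_smul, ih]; rfl

theorem dirs_zero (l : List (ℝ × ℝ)) : dirs l 0 = 0 := by
  simpa using dirs_smul l 0 0

/-- The nets whose derivatives up to order `k` grow slower than any negative power of `ε`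
on `K`. -/
def slowUpTo (K : Set (ℝ × ℝ)) (k : ℕ) : Subalgebra ℝ Net where
  carrier := {f | ∀ l : List (ℝ × ℝ), l.length ≤ k → Growth (fun _ => K) 0 (dirs l f)}
  add_mem' := fun hf hg l hl => by
    rw [dirs_add]
    exact (hf l hl).add (hg l hl)
  mul_mem' := by
    intro f g hf hg l hl
    induction l generalizing f g k with
    | nil =>
      have := (hf [] hl).mul (hg [] hl)
      rwa [zero_add] at this
    | cons v l ih =>
      obtain ⟨k, rfl⟩ : ∃ j, k = j + 1 := ⟨k - 1, by simp at hl; omega⟩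
      have hl' : l.length ≤ k := by simpa using hl
      have aux : ∀ {h : Net}, (∀ l : List (ℝ × ℝ), l.length ≤ k + 1 →
          Growth (fun _ => K) 0 (dirs l h)) → (∀ l : List (ℝ × ℝ), l.length ≤ k →
          Growth (fun _ => K) 0 (dirs l h)) ∧ ∀ l : List (ℝ × ℝ), l.length ≤ k →
          Growth (fun _ => K) 0 (dirs l (dir v h)) := fun hh =>
        ⟨fun l h1 => hh l (by omega), fun l h1 => hh (v :: l) (by simpa using h1)⟩
      rw [dirs_cons, (dir v).leibniz, smul_eq_mul, smul_eq_mul, dirs_add]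
      exact (ih k (aux hf).1 (aux hg).2 hl').add (ih k (aux hg).1 (aux hf).2 hl')
  algebraMap_mem' := by
    intro r l _
    cases l with
    | nil => exact Growth.of_bound le_rfl (A := |r|) (Eventually.of_forall fun ε z _ => le_rfl)
    | cons v l =>
      rw [dirs_cons, (dir v).map_algebraMap, dirs_zero]
      exact .zero

/-- The nets all of whose derivatives grow slower than any negative power of `ε` on `K`. -/
def slow (K : Set (ℝ × ℝ)) : Subalgebra ℝ Net := ⨅ k, slowUpTo K k

theorem mem_slow_iff {K : Set (ℝ × ℝ)} {f : Net} :
    f ∈ slow K ↔ ∀ l, Growth (fun _ => K) 0 (dirs l f) := by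
  rw [slow, Algebra.mem_iInf]
  exact ⟨fun h l => h l.length l le_rfl, fun h _ l _ => h l⟩

theorem dir_mem_slow {K : Set (ℝ × ℝ)} {f : Net} (v : ℝ × ℝ) (hf : f ∈ slow K) :
    dir v f ∈ slow K :=
  mem_slow_iff.2 fun l => mem_slow_iff.1 hf (v :: l)

/-- A net whose derivatives are slow multiples of its powers is slow. -/
theorem mem_slow_of_dir_eq {K : Set (ℝ × ℝ)} {s : Net} (hs : Growth (fun _ => K) 0 s)
    {q : ℝ × ℝ → Net} (hq : ∀ v, q v ∈ slow K) (n : ℕ) (h : ∀ v, dir v s = s ^ n * q v) :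
    s ∈ slow K := by
  have key : ∀ k, s ∈ slowUpTo K k := by
    intro k
    induction k with
    | zero =>
      intro l hl
      obtain rfl : l = [] := List.length_eq_zero_iff.1 (by omega)
      exact hs
    | succ k ih =>
      intro l hl
      cases l with
      | nil => exact hs
      | cons v l =>
        rw [dirs_cons, h]
        exact (slowUpTo K k).mul_mem ((slowUpTo K k).pow_mem ih n)
          ((Algebra.mem_iInf.1 (hq v)) k) l (by simpa using hl)
  exact Algebra.mem_iInf.2 key

theorem preserves_dir (K : Set (ℝ × ℝ)) (v : ℝ × ℝ) : Preserves (slow K) (dir v) :=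
  fun _ => dir_mem_slow v

theorem growth_of_mem_slow {K : Set (ℝ × ℝ)} {f : Net} (hf : f ∈ slow K) :
    Growth (fun _ => K) 0 f := mem_slow_iff.1 hf []

/-- The nets of growth `ε^{-m}`, up to slow growth, on a family of subsets of `K`. -/
def bounded {K : Set (ℝ × ℝ)} {Z : Eps → Set (ℝ × ℝ)} (hZ : ∀ ε, Z ε ⊆ K) (m : ℝ) :
    Submodule (slow K) Net where
  carrier := {f | Growth Z m f}
  zero_mem' := Growth.zero
  add_mem' := Growth.add
  smul_mem' := fun a f hf => by
    have := ((growth_of_mem_slow a.2).mono le_rfl (Eventually.of_forall hZ)).mul hf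
    rwa [zero_add] at this

theorem one_mem_bounded {K : Set (ℝ × ℝ)} {Z : Eps → Set (ℝ × ℝ)} (hZ : ∀ ε, Z ε ⊆ K) {m : ℝ}
    (hm : 0 ≤ m) : (1 : Net) ∈ bounded hZ m :=
  Growth.of_bound hm (A := 1) (Eventually.of_forall fun ε z _ => by rw [one_apply]; simp)

/-! ### Comparison with the total derivatives -/

theorem norm_iteratedFDerivWithin_succ_le (f : Net) (ε : Eps) {z : ℝ × ℝ}
    (hz : z ∈ halfPlane.carrier) (n : ℕ) :
    ‖iteratedFDerivWithin ℝ (n + 1) (f.1 ε) halfPlane.carrier z‖ ≤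
      ‖iteratedFDerivWithin ℝ n ((dir (1, 0) f).1 ε) halfPlane.carrier z‖ +
        ‖iteratedFDerivWithin ℝ n ((dir (0, 1) f).1 ε) halfPlane.carrier z‖ := by
  have hn : (n : ℕ∞ω) ≤ ∞ := by exact_mod_cast le_top
  have key : ∀ (g : Net) (L : ℝ × ℝ →L[ℝ] ℝ), ‖L‖ ≤ 1 →
      ContDiffWithinAt ℝ n (fun y => g.1 ε y • L) halfPlane.carrier z ∧
      ‖iteratedFDerivWithin ℝ n (fun y => g.1 ε y • L) halfPlane.carrier z‖ ≤
        ‖iteratedFDerivWithin ℝ n (g.1 ε) halfPlane.carrier z‖ := by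
    intro g L hL
    have hg : ContDiffWithinAt ℝ n (g.1 ε) halfPlane.carrier z :=
      ((g.contDiffOn ε) z hz).of_le hn
    refine ⟨hg.smul contDiffWithinAt_const, ?_⟩
    have := ((ContinuousLinearMap.id ℝ ℝ).smulRight L).norm_iteratedFDerivWithin_comp_left
      hg halfPlane.uniqueDiffOn hz le_rfl
    refine this.trans ?_
    have h1 : ‖(ContinuousLinearMap.id ℝ ℝ).smulRight L‖ ≤ 1 := by
      rw [ContinuousLinearMap.norm_smulRight_apply]
      simpa using hL
    exact mul_le_of_le_one_left (norm_nonneg _) h1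
  obtain ⟨c1, b1⟩ := key (dir (1, 0) f) (ContinuousLinearMap.fst ℝ ℝ ℝ)
    (ContinuousLinearMap.norm_fst_le ℝ ℝ ℝ)
  obtain ⟨c2, b2⟩ := key (dir (0, 1) f) (ContinuousLinearMap.snd ℝ ℝ ℝ)
    (ContinuousLinearMap.norm_snd_le ℝ ℝ ℝ)
  rw [← norm_iteratedFDerivWithin_fderivWithin halfPlane.uniqueDiffOn hz,
    iteratedFDerivWithin_congr (fun y hy => f.fderivWithin_eq ε hy) hz,
    fun_iteratedFDerivWithin_add_apply c1 c2 halfPlane.uniqueDiffOn hz]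
  exact (norm_add_le _ _).trans (add_le_add b1 b2)

theorem exists_bound_iteratedFDerivWithin {K : Set (ℝ × ℝ)} {Z : Eps → Set (ℝ × ℝ)}
    (hZ : ∀ ε, Z ε ⊆ K) (hK : K ⊆ halfPlane.carrier) {m : ℝ} (n : ℕ) {f : Net}
    (hf : f ∈ mixedReg (preserves_dir K (1, 0)) (preserves_dir K (0, 1)) (bounded hZ m) n)
    {δ : ℝ} (hδ : 0 < δ) :
    ∃ A : ℝ, ∀ᶠ ε : Eps in atZero, ∀ z ∈ Z ε,
      ‖iteratedFDerivWithin ℝ n (f.1 ε) halfPlane.carrier z‖ ≤ A * (ε : ℝ) ^ (-(m + δ)) := by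
  induction n generalizing f with
  | zero =>
    simpa only [norm_iteratedFDerivWithin_zero, Real.norm_eq_abs] using hf δ hδ
  | succ n ih =>
    obtain ⟨A, hA⟩ := ih hf.1.2
    obtain ⟨B, hB⟩ := ih hf.2.2
    refine ⟨A + B, ?_⟩
    filter_upwards [hA, hB] with ε h1 h2 z hz
    refine (norm_iteratedFDerivWithin_succ_le f ε (hK (hZ ε hz)) n).trans ?_
    rw [add_mul]
    exact add_le_add (h1 z hz) (h2 z hz)

theorem derivBound_dir {K : Set (ℝ × ℝ)} (hK : K ⊆ halfPlane.carrier) (v : ℝ × ℝ) {f : Net} {n : ℕ}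
    {m : ℤ} (h : DerivBound halfPlane f.1 K (n + 1) m) :
    DerivBound halfPlane (dir v f).1 K n m :=
  (h.dir v f.contDiffOn hK).congr hK fun ε _ hz => dir_apply v f ε hz

theorem mem_slow_of_derivBound {K : Set (ℝ × ℝ)} (hK : K ⊆ halfPlane.carrier) {f : Net}
    (h : ∀ n, DerivBound halfPlane f.1 K n 0) : f ∈ slow K := by
  refine mem_slow_iff.2 fun l => ?_
  induction l generalizing f with
  | nil =>
    obtain ⟨A, hA⟩ := h 0
    refine Growth.of_bound le_rfl (A := A) (hA.mono fun ε h1 z hz => ?_)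
    have := h1 z hz
    rw [norm_iteratedFDerivWithin_zero, zpow_zero, mul_one] at this
    exact this
  | cons v l ih => exact ih fun n => derivBound_dir hK v (h (n + 1))

theorem growth_of_derivBound {K : Set (ℝ × ℝ)} {f : Net} {p : ℕ}
    (h : DerivBound halfPlane f.1 K 0 (-(p : ℤ))) : Growth (fun _ => K) p f := by
  intro δ hδ
  obtain ⟨A, hA⟩ := h
  refine ⟨|A|, hA.mono fun ε h1 z hz => ?_⟩
  have := h1 z hz
  rw [norm_iteratedFDerivWithin_zero, ← Real.rpow_intCast] at this
  push_cast at this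
  exact this.trans (mul_rpow_neg_mono ε (by linarith))

/-- Directional derivatives of a function of `t` are multiples of its time derivatives, so bounds on
`[0, T]` suffice. -/
theorem time_mem_slow {c : Eps → ℝ → ℝ} (hc : ∀ ε, ContDiff ℝ ∞ (c ε)) {K : Set (ℝ × ℝ)} {T : ℝ}
    (hK : ∀ z ∈ K, z.1 ∈ Icc 0 T)
    (h : ∀ k, ∀ δ : ℝ, 0 < δ → OrderLE T (fun ε => iteratedDeriv k (c ε)) δ) :
    time c (fun ε => (hc ε).contDiffOn) ∈ slow K := by
  refine mem_slow_iff.2 fun l => ?_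
  induction l generalizing c with
  | nil =>
    intro δ hδ
    obtain ⟨A, hA⟩ := h 0 δ hδ
    refine ⟨A, hA.mono fun ε h1 z hz => ?_⟩
    have h2 := h1 z.1 (hK z hz)
    simp only [iteratedDeriv_zero] at h2
    rw [zero_add]
    refine le_trans (le_of_eq ?_) h2
    congr 1
    exact time_apply (fun ε => (hc ε).contDiffOn) ε (mem_halfPlane.2 (hK z hz).1)
  | cons v l ih =>
    rw [dirs_cons, dir_time_of_contDiff hc, dirs_smul]
    have h1 := ih (fun ε => (contDiff_infty_iff_deriv.1 (hc ε)).2) fun k δ hδ => by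
      simpa only [iteratedDeriv_succ'] using h (k + 1) δ hδ
    have h2 : Growth (fun _ => K) 0 (algebraMap ℝ Net v.1) :=
      growth_of_mem_slow ((slow K).algebraMap_mem v.1)
    rw [Algebra.smul_def]
    simpa using h2.mul h1

end Net

open Net

/-! ### The wave equation with a time dependent coefficient -/

/-- A net of solutions of `∂_t² w - c² ∂_x² w = N` with `w = n₀`, `∂_t w = φ_ε + n₁` at `t = 0`,
where `N`, `n₀` and `n₁` have bounded derivatives and the coefficient `c` is positive, of bounded
variation and slow. -/
structure WaveNet (φ : ℝ → ℝ) where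
  /-- the coefficient -/
  c : Eps → ℝ → ℝ
  /-- the solution -/
  w : Net
  /-- the lower bound of the coefficient -/
  a : ℝ
  /-- the upper bound of the coefficient -/
  b : ℝ
  /-- the bound of the variation of the coefficient -/
  B : ℝ
  smooth : ∀ ε, ContDiff ℝ ∞ (c ε)
  a_pos : 0 < a
  a_le : ∀ ε t, 0 ≤ t → a ≤ c ε t
  le_b : ∀ ε t, 0 ≤ t → c ε t ≤ b
  variation : ∀ ε t, 0 ≤ t → ∫ τ in (0 : ℝ)..t, |deriv (c ε) τ| ≤ B
  slow : ∀ T, 1 ≤ T → ∀ k, ∀ δ : ℝ, 0 < δ → OrderLE T (fun ε => iteratedDeriv k (c ε)) δ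
  moderate : IsModerate halfPlane w.1
  rhs : ∀ K ⊆ halfPlane.carrier, IsCompact K → ∀ n, DerivBound halfPlane
    (dir (1, 0) (dir (1, 0) w) - time c (fun ε => (smooth ε).contDiffOn) ^ 2 *
      dir (0, 1) (dir (0, 1) w)).1 K n 0
  init : ∀ K : Set ℝ, IsCompact K → ∀ n, DerivBound line (fun ε x => w.1 ε (0, x)) K n 0
  init' : ∀ K : Set ℝ, IsCompact K → ∀ n,
    DerivBound line (fun ε x => (dir (1, 0) w).1 ε (0, x) - rescale φ ε x) K n 0

namespace WaveNet

variable {φ : ℝ → ℝ} (W : WaveNet φ)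

/-- The coefficient as a net on the half plane. -/
def C : Net := time W.c fun ε => (W.smooth ε).contDiffOn

theorem c_pos (ε : Eps) {t : ℝ} (ht : 0 ≤ t) : 0 < W.c ε t := W.a_pos.trans_le (W.a_le ε t ht)

theorem b_pos : 0 < W.b :=
  (W.c_pos ⟨1, by simp⟩ le_rfl).trans_le (W.le_b ⟨1, by simp⟩ 0 le_rfl)

theorem contDiffOn_sqrt (ε : Eps) : ContDiffOn ℝ ∞ (fun t => (√(W.c ε t))⁻¹) (Ici 0) :=
  ((W.smooth ε).contDiffOn.sqrt fun _ ht => (W.c_pos ε ht).ne').inv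
    fun _ ht => (Real.sqrt_pos.2 (W.c_pos ε ht)).ne'

/-- The net `c^{-1/2}`. -/
def s : Net := time (fun ε t => (√(W.c ε t))⁻¹) W.contDiffOn_sqrt

theorem C_apply (ε : Eps) {z : ℝ × ℝ} (hz : z ∈ halfPlane.carrier) : W.C.1 ε z = W.c ε z.1 :=
  time_apply (fun ε => (W.smooth ε).contDiffOn) ε hz

theorem s_apply (ε : Eps) {z : ℝ × ℝ} (hz : z ∈ halfPlane.carrier) :
    W.s.1 ε z = (√(W.c ε z.1))⁻¹ := time_apply W.contDiffOn_sqrt ε hz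

/-- The only fact about the square root needed in the algebraic identities below. -/
theorem s_sq_mul_C : W.s * W.s * W.C = 1 := by
  refine Net.ext fun ε z hz => ?_
  have h := W.c_pos ε (mem_halfPlane.1 hz)
  rw [mul_apply, mul_apply, W.s_apply ε hz, W.C_apply ε hz, one_apply, ← mul_inv,
    Real.mul_self_sqrt h.le, inv_mul_cancel₀ h.ne']

theorem dir_space_C : dir (0, 1) W.C = 0 := dir_space_time _

theorem dir_space_s : dir (0, 1) W.s = 0 := dir_space_time _

/-- The real constants in the algebra of nets. -/
abbrev const (r : ℝ) : Net := algebraMap ℝ Net r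

theorem const_apply (r : ℝ) (ε : Eps) (z : ℝ × ℝ) : (const r).1 ε z = r := rfl

theorem two_mul_half : (2 : Net) * const (1 / 2) = 1 := by
  have : (2 : Net) = const 2 := (map_ofNat (algebraMap ℝ Net) 2).symm
  rw [this, ← map_mul]
  norm_num

/-- Obtained by differentiating `s² C = 1`. This form, a power of `s` times a slow factor, is what
`mem_slow_of_dir_eq` requires. -/
theorem dir_s (v : ℝ × ℝ) : dir v W.s = W.s ^ 3 * (-const (1 / 2) * dir v W.C) := by
  have h1 : dir v (W.s * W.s * W.C) = 0 := by rw [s_sq_mul_C, (dir v).map_one_eq_zero]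
  rw [(dir v).leibniz, (dir v).leibniz] at h1
  simp only [smul_eq_mul] at h1
  linear_combination const (1 / 2) * W.s * h1 -
    2 * const (1 / 2) * dir v W.s * W.s_sq_mul_C - dir v W.s * two_mul_half

/-- The characteristic derivatives `c^{-1} ∂_t + σ ∂_x`. -/
def D (σ : ℝ) : Derivation ℝ Net Net := (W.s * W.s) • dir (1, 0) + const σ • dir (0, 1)

/-- The characteristic variables `c^{-1/2} (∂_t w - σ c ∂_x w)`. -/
def P (σ : ℝ) : Net := W.s * (dir (1, 0) W.w - const σ * (W.C * dir (0, 1) W.w))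

/-- The coupling `∂_t c / (2 c²)` of the characteristic variables. -/
def g : Net := const (1 / 2) * W.s ^ 4 * dir (1, 0) W.C

/-- The defect `∂_t² w - c² ∂_x² w`. -/
def N : Net := dir (1, 0) (dir (1, 0) W.w) - W.C ^ 2 * dir (0, 1) (dir (0, 1) W.w)

theorem D_apply (σ : ℝ) (f : Net) :
    W.D σ f = W.s * W.s * dir (1, 0) f + const σ * dir (0, 1) f := rfl

theorem C_mul_D (σ : ℝ) (f : Net) :
    W.C * W.D σ f = dir (1, 0) f + const σ * (W.C * dir (0, 1) f) := by
  rw [D_apply]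
  linear_combination dir (1, 0) f * W.s_sq_mul_C

theorem dir_const (v : ℝ × ℝ) (r : ℝ) : dir v (const r) = 0 := (dir v).map_algebraMap r

theorem const_mul_self {σ : ℝ} (hσ : σ * σ = 1) : const σ * const σ = 1 := by
  rw [← map_mul, hσ, map_one]

theorem const_neg (σ : ℝ) : const (-σ) = -const σ := map_neg _ _

/-- The weight `c^(-1/2)` is chosen so that `P σ` drops out of its own equation: differentiating the
weight and the factor `c` in front of `∂_x w` gives terms that combine into a multiple of `P (-σ)`.
-/
theorem D_P {σ : ℝ} (hσ : σ * σ = 1) :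
    W.D σ (W.P σ) = -(W.g * W.P (-σ)) + W.s ^ 3 * W.N := by
  have h1 := W.s_sq_mul_C
  have h2 := W.dir_s (1, 0)
  have h3 := const_mul_self hσ
  have h4 := dir_comm (1, 0) (0, 1) W.w
  simp only [D_apply, P, g, N, (dir _).leibniz, smul_eq_mul, map_sub, dir_const, dir_space_C,
    dir_space_s, const_neg, h2, h4]
  linear_combination (W.s * W.C * dir (0, 1) (dir (0, 1) W.w) -
      const σ * W.s * dir (0, 1) (dir (1, 0) W.w) +
      const σ * W.s ^ 3 * dir (1, 0) W.C * dir (0, 1) W.w) * h1 -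
    W.s * W.C * dir (0, 1) (dir (0, 1) W.w) * h3 +
    const σ * W.s ^ 5 * W.C * dir (1, 0) W.C * dir (0, 1) W.w * two_mul_half

/-- Commutation rests on dividing by `c`: the operators `c⁻¹ ∂_t` and `∂_x` commute because `c` does
not depend on `x`. -/
theorem D_comm (σ τ : ℝ) (f : Net) : W.D σ (W.D τ f) = W.D τ (W.D σ f) := by
  have h := dir_comm (1, 0) (0, 1) f
  simp only [D_apply, map_add, (dir _).leibniz, smul_eq_mul, dir_const, dir_space_s, h]
  ring

theorem dir_space_D (σ : ℝ) (f : Net) : dir (0, 1) (W.D σ f) = W.D σ (dir (0, 1) f) := by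
  have h := dir_comm (1, 0) (0, 1) f
  simp only [D_apply, map_add, (dir _).leibniz, smul_eq_mul, dir_const, dir_space_s, h]
  ring

theorem D_neg (σ : ℝ) (f : Net) : W.D (-σ) f = W.D σ f - (2 * σ) • dir (0, 1) f := by
  rw [D_apply, D_apply, const_neg, Algebra.smul_def, map_mul, map_ofNat]
  ring

/-! ### Slowness of the coefficients of the characteristic system -/

section Slow

variable {K : Set (ℝ × ℝ)} (hK : K ⊆ halfPlane.carrier) (hc : IsCompact K)
include hK hc

theorem C_mem_slow : W.C ∈ Net.slow K := by
  obtain ⟨R, hR⟩ := (hc.image continuous_fst).isBounded.subset_closedBall 0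
  refine time_mem_slow W.smooth (T := max R 1) (fun z hz => ⟨mem_halfPlane.1 (hK hz), ?_⟩)
    (W.slow _ (le_max_right _ _))
  have := hR (mem_image_of_mem _ hz)
  rw [mem_closedBall_zero_iff] at this
  exact (le_abs_self _).trans (this.trans (le_max_left _ _))

theorem s_mem_slow : W.s ∈ Net.slow K := by
  refine mem_slow_of_dir_eq ?_ (fun v => ?_) 3 W.dir_s
  · refine Growth.of_bound le_rfl (A := (√W.a)⁻¹) (Eventually.of_forall fun ε z hz => ?_)
    rw [W.s_apply ε (hK hz), abs_of_nonneg (by positivity)]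
    exact inv_anti₀ (Real.sqrt_pos.2 W.a_pos)
      (Real.sqrt_le_sqrt (W.a_le ε _ (mem_halfPlane.1 (hK hz))))
  · exact (Net.slow K).mul_mem ((Net.slow K).neg_mem ((Net.slow K).algebraMap_mem _))
      (dir_mem_slow v (W.C_mem_slow hK hc))

theorem N_mem_slow : W.N ∈ Net.slow K := mem_slow_of_derivBound hK (W.rhs K hK hc)

theorem preserves_D (σ : ℝ) : Preserves (Net.slow K) (W.D σ) := fun f hf => by
  have hs := W.s_mem_slow hK hc
  rw [D_apply]
  exact (Net.slow K).add_mem ((Net.slow K).mul_mem ((Net.slow K).mul_mem hs hs) (dir_mem_slow _ hf))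
    ((Net.slow K).mul_mem ((Net.slow K).algebraMap_mem _) (dir_mem_slow _ hf))

theorem isTransportSystem {σ : ℝ} (hσ : σ * σ = 1) :
    IsTransportSystem (Net.slow K) (W.D σ) (W.D (-σ)) W.g (W.s ^ 3 * W.N) (W.P σ) (W.P (-σ)) where
  preserves := W.preserves_D hK hc σ
  preserves' := W.preserves_D hK hc (-σ)
  comm := W.D_comm σ (-σ)
  coeff_mem := (Net.slow K).mul_mem ((Net.slow K).mul_mem ((Net.slow K).algebraMap_mem _)
    ((Net.slow K).pow_mem (W.s_mem_slow hK hc) 4)) (dir_mem_slow _ (W.C_mem_slow hK hc))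
  rhs_mem := (Net.slow K).mul_mem ((Net.slow K).pow_mem (W.s_mem_slow hK hc) 3)
    (W.N_mem_slow hK hc)
  eq := W.D_P hσ
  eq' := by
    have := W.D_P (σ := -σ) (by rw [neg_mul_neg, hσ])
    rwa [neg_neg] at this

end Slow

/-! ### Integration along characteristics -/

/-- The distance travelled up to time `t`. -/
def S (ε : Eps) (t : ℝ) : ℝ := ∫ τ in (0 : ℝ)..t, W.c ε τ

theorem S_zero (ε : Eps) : W.S ε 0 = 0 := intervalIntegral.integral_same

theorem hasDerivAt_S (ε : Eps) (t : ℝ) : HasDerivAt (W.S ε) (W.c ε t) t :=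
  ((W.smooth ε).continuous.integral_hasStrictDerivAt 0 t).hasDerivAt

theorem continuous_S (ε : Eps) : Continuous (W.S ε) :=
  continuous_iff_continuousAt.2 fun t => (W.hasDerivAt_S ε t).continuousAt

theorem S_sub (ε : Eps) (t t' : ℝ) : W.S ε t' - W.S ε t = ∫ τ in t..t', W.c ε τ :=
  intervalIntegral.integral_interval_sub_left
    ((W.smooth ε).continuous.intervalIntegrable _ _) ((W.smooth ε).continuous.intervalIntegrable _ _)

theorem le_S_sub (ε : Eps) {t t' : ℝ} (ht : 0 ≤ t) (h : t ≤ t') :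
    W.a * (t' - t) ≤ W.S ε t' - W.S ε t := by
  rw [S_sub]
  have := intervalIntegral.integral_mono_on h (intervalIntegrable_const (c := W.a))
    ((W.smooth ε).continuous.intervalIntegrable (μ := volume) t t')
    fun τ hτ => W.a_le ε τ (ht.trans hτ.1)
  rw [intervalIntegral.integral_const, smul_eq_mul] at this
  linarith

theorem S_sub_le (ε : Eps) {t t' : ℝ} (ht : 0 ≤ t) (h : t ≤ t') :
    W.S ε t' - W.S ε t ≤ W.b * (t' - t) := by
  rw [S_sub]
  have := intervalIntegral.integral_mono_on h
    ((W.smooth ε).continuous.intervalIntegrable (μ := volume) t t')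
    (intervalIntegrable_const (c := W.b)) fun τ hτ => W.le_b ε τ (ht.trans hτ.1)
  rw [intervalIntegral.integral_const, smul_eq_mul] at this
  linarith

theorem S_mono (ε : Eps) {t t' : ℝ} (ht : 0 ≤ t) (h : t ≤ t') : W.S ε t ≤ W.S ε t' := by
  have := W.le_S_sub ε ht h
  have := mul_nonneg W.a_pos.le (sub_nonneg.2 h)
  linarith

theorem S_nonneg (ε : Eps) {t : ℝ} (ht : 0 ≤ t) : 0 ≤ W.S ε t := by
  simpa [S_zero] using W.S_mono ε le_rfl ht

theorem S_le (ε : Eps) {t : ℝ} (ht : 0 ≤ t) : W.S ε t ≤ W.b * t := by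
  simpa [S_zero] using W.S_sub_le ε le_rfl ht

theorem continuousOn_along (f : Net) (ε : Eps) (σ x : ℝ) (t : ℝ) :
    ContinuousOn (fun τ => f.1 ε (τ, x + σ * W.S ε τ)) (Icc 0 t) :=
  (f.contDiffOn ε).continuousOn.comp
    (continuous_id.prodMk (continuous_const.add (continuous_const.mul (W.continuous_S ε)))).continuousOn
    fun _ hτ => mem_halfPlane.2 hτ.1

theorem intervalIntegrable_along (f : Net) (ε : Eps) (σ x : ℝ) {t : ℝ} (ht : 0 ≤ t) :
    IntervalIntegrable (fun τ => f.1 ε (τ, x + σ * W.S ε τ)) volume 0 t :=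
  (W.continuousOn_along f ε σ x t).intervalIntegrable_of_Icc ht

/-- Along the curve `x + σ S(τ)` the derivative in `τ` is `∂_t + σ c ∂_x = c D_σ`. -/
theorem integral_along (f : Net) (ε : Eps) (σ x : ℝ) {t : ℝ} (ht : 0 ≤ t) :
    f.1 ε (t, x + σ * W.S ε t) =
      f.1 ε (0, x) + ∫ τ in (0 : ℝ)..t, (W.C * W.D σ f).1 ε (τ, x + σ * W.S ε τ) := by
  have key := intervalIntegral.integral_eq_sub_of_hasDeriv_right_of_le ht
    (W.continuousOn_along f ε σ x t) (f' := fun τ => (W.C * W.D σ f).1 ε (τ, x + σ * W.S ε τ))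
    (fun τ hτ => ?_) (W.intervalIntegrable_along _ ε σ x ht)
  · rw [key, S_zero, mul_zero, add_zero]
    ring
  · have hz : (τ, x + σ * W.S ε τ) ∈ halfPlane.carrier := mem_halfPlane.2 hτ.1.le
    have h1 := (f.differentiableWithinAt ε hz).hasFDerivWithinAt
    have h2 : HasDerivWithinAt (fun τ => (τ, x + σ * W.S ε τ)) (1, σ * W.c ε τ) (Ioi τ) τ :=
      ((hasDerivAt_id τ).prodMk (((W.hasDerivAt_S ε τ).const_mul σ).const_add x)).hasDerivWithinAt
    have h3 := h1.comp_hasDerivWithinAt τ h2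
      fun r hr => mem_halfPlane.2 (hτ.1.le.trans (le_of_lt hr))
    refine h3.congr_deriv ?_
    rw [fderivWithin_eq f ε hz, C_mul_D, add_apply, mul_apply, mul_apply, const_apply,
      W.C_apply ε hz]
    simp
    ring

/-- A set that contains, with every point, the backward characteristic `x - σ S = const`. -/
def IsBackward (σ : ℝ) (ε : Eps) (Z : Set (ℝ × ℝ)) : Prop :=
  ∀ z ∈ Z, 0 ≤ z.1 ∧ ∀ τ ∈ Icc 0 z.1, (τ, z.2 - σ * (W.S ε z.1 - W.S ε τ)) ∈ Z

theorem eq_along (f : Net) (ε : Eps) (σ : ℝ) {z : ℝ × ℝ} (hz : 0 ≤ z.1) :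
    f.1 ε z = f.1 ε (0, z.2 - σ * W.S ε z.1) +
      ∫ τ in (0 : ℝ)..z.1, (W.C * W.D σ f).1 ε (τ, z.2 - σ * (W.S ε z.1 - W.S ε τ)) := by
  have h := W.integral_along f ε σ (z.2 - σ * W.S ε z.1) hz
  have e : ∀ τ, z.2 - σ * W.S ε z.1 + σ * W.S ε τ = z.2 - σ * (W.S ε z.1 - W.S ε τ) :=
    fun τ => by ring
  simp only [e, sub_self, mul_zero, sub_zero] at h
  exact h

/-- Integration over a bounded time with a bounded factor `c` loses no power of `ε`. This provides
the integration hypothesis of `mem_reg_of_integration`. -/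
theorem growth_of_D {σ : ℝ} {Z : Eps → Set (ℝ × ℝ)} {T m : ℝ} (hZ : ∀ ε, W.IsBackward σ ε (Z ε))
    (hT : ∀ ε, ∀ z ∈ Z ε, z.1 ≤ T) {f : Net} (hf : Growth Z m (W.D σ f))
    (h0 : Growth (fun ε => Z ε ∩ {z | z.1 = 0}) m f) : Growth Z m f := by
  intro δ hδ
  obtain ⟨A, hA⟩ := hf δ hδ
  obtain ⟨B, hB⟩ := h0 δ hδ
  refine ⟨B + W.b * |A| * T, ?_⟩
  filter_upwards [hA, hB] with ε h1 h2 z hz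
  obtain ⟨hz0, hzb⟩ := hZ ε z hz
  set q := (ε : ℝ) ^ (-(m + δ)) with hq
  have hq0 : 0 ≤ q := Real.rpow_nonneg ε.pos.le _
  have hb := W.b_pos
  rw [W.eq_along f ε σ hz0]
  have b1 : |f.1 ε (0, z.2 - σ * W.S ε z.1)| ≤ B * q := by
    refine h2 _ ⟨?_, rfl⟩
    simpa [S_zero] using hzb 0 ⟨le_rfl, hz0⟩
  have b2 : ‖∫ τ in (0 : ℝ)..z.1, (W.C * W.D σ f).1 ε (τ, z.2 - σ * (W.S ε z.1 - W.S ε τ))‖ ≤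
      W.b * (|A| * q) * |z.1 - 0| := by
    refine intervalIntegral.norm_integral_le_of_norm_le_const fun τ hτ => ?_
    rw [uIoc_of_le hz0] at hτ
    have hm := hzb τ ⟨hτ.1.le, hτ.2⟩
    rw [mul_apply, W.C_apply ε (mem_halfPlane.2 hτ.1.le), norm_mul, Real.norm_eq_abs,
      Real.norm_eq_abs, abs_of_pos (W.c_pos ε hτ.1.le)]
    refine mul_le_mul (W.le_b ε τ hτ.1.le) ((h1 _ hm).trans ?_) (abs_nonneg _) hb.le
    gcongr
    exact le_abs_self A
  rw [sub_zero, abs_of_nonneg hz0] at b2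
  refine (abs_add_le _ _).trans ?_
  have b3 : W.b * (|A| * q) * z.1 ≤ W.b * (|A| * q) * T := by
    have := hT ε z hz
    gcongr
  rw [add_mul]
  have e : W.b * (|A| * q) * T = W.b * |A| * T * q := by ring
  rw [Real.norm_eq_abs] at b2
  linarith

end WaveNet

/-! ### Mixed derivatives and slices at fixed time -/

theorem mem_mixedReg_succ {A : Type*} [CommRing A] [Algebra ℝ A] {G : Subalgebra ℝ A}
    {D D' : Derivation ℝ A A} (hD : Preserves G D) (hD' : Preserves G D') {B : Submodule G A}
    {f : A} (h : f ∈ B) (k : ℕ) (h1 : D f ∈ mixedReg hD hD' B k)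
    (h2 : D' f ∈ mixedReg hD hD' B k) : f ∈ mixedReg hD hD' B (k + 1) := by
  induction k with
  | zero => exact ⟨⟨h, h1⟩, h, h2⟩
  | succ k ih =>
    have h3 := ih h1.1.1 h2.1.1
    exact ⟨⟨h3, h1⟩, h3, h2⟩

theorem Net.hasDerivAt_slice (f : Net) (ε : Eps) {t : ℝ} (ht : 0 ≤ t) (x : ℝ) :
    HasDerivAt (fun x => f.1 ε (t, x)) ((dir (0, 1) f).1 ε (t, x)) x := by
  have hz : (t, x) ∈ halfPlane.carrier := mem_halfPlane.2 ht
  have h1 := (f.differentiableWithinAt ε hz).hasFDerivWithinAt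
  have h2 : HasDerivWithinAt (fun x : ℝ => (t, x)) ((0 : ℝ), (1 : ℝ)) univ x :=
    ((hasDerivAt_const x t).prodMk (hasDerivAt_id x)).hasDerivWithinAt
  have h3 := h1.comp_hasDerivWithinAt x h2 fun _ _ => mem_halfPlane.2 ht
  rw [hasDerivWithinAt_univ] at h3
  rw [dir_apply _ _ _ hz]
  exact h3

theorem Net.iteratedDeriv_slice (f : Net) (ε : Eps) {t : ℝ} (ht : 0 ≤ t) (k : ℕ) :
    iteratedDeriv k (fun x => f.1 ε (t, x)) = fun x => ((dir (0, 1))^[k] f).1 ε (t, x) := by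
  induction k generalizing f with
  | zero => rw [iteratedDeriv_zero]; rfl
  | succ k ih =>
    rw [iteratedDeriv_succ', funext fun x => (f.hasDerivAt_slice ε ht x).deriv, ih]
    rfl

theorem DerivBound.exists_iteratedDeriv_le {u : Eps → ℝ → ℝ} {K : Set ℝ} {n : ℕ}
    (h : DerivBound line u K n 0) :
    ∃ A, ∀ᶠ ε in atZero, ∀ x ∈ K, |iteratedDeriv n (u ε) x| ≤ A := by
  obtain ⟨A, hA⟩ := h
  refine ⟨A, hA.mono fun ε h1 x hx => ?_⟩
  have h2 := h1 x hx
  change ‖iteratedFDerivWithin ℝ n (u ε) univ x‖ ≤ _ at h2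
  rwa [iteratedFDerivWithin_univ, norm_iteratedFDeriv_eq_norm_iteratedDeriv, zpow_zero, mul_one]
    at h2

theorem rescale_eq_zero {φ : ℝ → ℝ} (hφ : IsMollifier φ) {h x : ℝ} (hh : 0 < h) (hx : h ≤ |x|) :
    rescale φ h x = 0 := by
  rw [rescale, hφ.eq_zero_of_one_le_abs, zero_div]
  rwa [abs_div, abs_of_pos hh, le_div_iff₀ hh, one_mul]

/-! ### Regularity away from the characteristics through the origin -/

namespace WaveNet

variable {φ : ℝ → ℝ} (W : WaveNet φ)

/-- The slab `[0, T] × [-R, R]`. -/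
def slab (T R : ℝ) : Set (ℝ × ℝ) := Icc 0 T ×ˢ Icc (-R) R

theorem slab_subset (T R : ℝ) : slab T R ⊆ halfPlane.carrier := fun _ hz => mem_halfPlane.2 hz.1.1

theorem isCompact_slab (T R : ℝ) : IsCompact (slab T R) := isCompact_Icc.prod isCompact_Icc

/-- The points at distance between `η` and `R` of the characteristic `σ x = S(t)`. -/
def zone (σ η R T : ℝ) (ε : Eps) : Set (ℝ × ℝ) :=
  {z | z.1 ∈ Icc 0 T ∧ |W.S ε z.1 - σ * z.2| ∈ Icc η R}

theorem abs_of_mul_self {σ : ℝ} (hσ : σ * σ = 1) : |σ| = 1 := by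
  rcases mul_self_eq_one_iff.1 hσ with rfl | rfl <;> simp

theorem zone_subset {σ : ℝ} (hσ : σ * σ = 1) (η R T : ℝ) (ε : Eps) :
    W.zone σ η R T ε ⊆ slab T (R + W.b * T) := by
  rintro z ⟨⟨h0, hT⟩, -, hR⟩
  refine ⟨⟨h0, hT⟩, abs_le.1 ?_⟩
  have h1 : |z.2| = |σ * z.2| := by rw [abs_mul, abs_of_mul_self hσ, one_mul]
  have h2 : |σ * z.2| ≤ |W.S ε z.1 - σ * z.2| + |W.S ε z.1| := by
    have := abs_sub (W.S ε z.1) (W.S ε z.1 - σ * z.2)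
    rw [sub_sub_cancel] at this
    linarith
  have h3 : |W.S ε z.1| ≤ W.b * T := by
    rw [abs_of_nonneg (W.S_nonneg ε h0)]
    exact (W.S_le ε h0).trans (mul_le_mul_of_nonneg_left hT W.b_pos.le)
  linarith

theorem isBackward_zone {σ : ℝ} (hσ : σ * σ = 1) (η R T : ℝ) (ε : Eps) :
    W.IsBackward σ ε (W.zone σ η R T ε) := by
  rintro z ⟨⟨h0, hT⟩, h⟩
  refine ⟨h0, fun τ hτ => ⟨⟨hτ.1, hτ.2.trans hT⟩, ?_⟩⟩
  have e : W.S ε τ - σ * (z.2 - σ * (W.S ε z.1 - W.S ε τ)) = W.S ε z.1 - σ * z.2 := by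
    linear_combination (W.S ε z.1 - W.S ε τ) * hσ
  change |W.S ε τ - σ * (z.2 - σ * (W.S ε z.1 - W.S ε τ))| ∈ _
  rwa [e]

/-- Moderateness is used only for `w` and its first derivatives. Their exponent `M` is then shown to
serve, up to an arbitrarily small loss, for all derivatives off the fronts. -/
theorem exists_growth {K : Set (ℝ × ℝ)} (hK : K ⊆ halfPlane.carrier) (hc : IsCompact K) :
    ∃ M : ℕ, Growth (fun _ => K) M W.w ∧ ∀ v, Growth (fun _ => K) M (dir v W.w) := by
  obtain ⟨p, hp⟩ := W.moderate.exists_uniform hK hc 1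
  exact ⟨p, growth_of_derivBound (hp 0 (Nat.zero_le _)),
    fun v => growth_of_derivBound (derivBound_dir hK v (hp 1 le_rfl))⟩

theorem P_mem {K : Set (ℝ × ℝ)} (hK : K ⊆ halfPlane.carrier) (hc : IsCompact K)
    (B : Submodule (Net.slow K) Net) (h : ∀ v, dir v W.w ∈ B) (σ : ℝ) : W.P σ ∈ B := by
  rw [P]
  refine coeff_mul_mem B (W.s_mem_slow hK hc) (coeff_sub_mem B (h _) ?_)
  exact coeff_mul_mem B ((Net.slow K).algebraMap_mem _)
    (coeff_mul_mem B (W.C_mem_slow hK hc) (h _))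

theorem dir_time_eq (σ : ℝ) :
    dir (1, 0) W.w = (1 / 2 : ℝ) • (W.s * W.C * (W.P σ + W.P (-σ))) := by
  rw [Algebra.smul_def, P, P, const_neg]
  linear_combination (-dir (1, 0) W.w * const (1 / 2) * 2) * W.s_sq_mul_C -
    dir (1, 0) W.w * two_mul_half

theorem dir_space_eq {σ : ℝ} (hσ : σ * σ = 1) :
    dir (0, 1) W.w = (σ / 2 : ℝ) • (W.s * (W.P (-σ) - W.P σ)) := by
  have e : algebraMap ℝ Net (σ / 2) = const σ * const (1 / 2) := by
    rw [← map_mul]; congr 1; ring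
  rw [Algebra.smul_def, P, P, const_neg, e]
  have h := const_mul_self hσ
  linear_combination (-dir (0, 1) W.w * const σ * const σ * const (1 / 2) * 2) * W.s_sq_mul_C -
    dir (0, 1) W.w * const σ * const σ * two_mul_half - dir (0, 1) W.w * h

theorem slice_growth_space {K : Set (ℝ × ℝ)} (T R : ℝ) {Z : Eps → Set (ℝ × ℝ)}
    (hZ : ∀ ε, Z ε ⊆ slab T R ∩ {z | z.1 = 0}) (hZK : ∀ ε, Z ε ⊆ K) {m : ℝ} (hm : 0 ≤ m) :
    dir (0, 1) W.w ∈ regInf (preserves_dir K (0, 1)) (bounded hZK m) := by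
  refine (mem_regInf_iff _ _).2 fun i => ?_
  obtain ⟨A, hA⟩ := (W.init (Icc (-R) R) isCompact_Icc (i + 1)).exists_iteratedDeriv_le
  refine Growth.of_bound hm (A := A) (hA.mono fun ε h1 z hz => ?_)
  have h2 := h1 z.2 (hZ ε hz).1.2
  have h3 : z = (0, z.2) := Prod.ext (hZ ε hz).2 rfl
  rw [W.w.iteratedDeriv_slice ε le_rfl, Function.iterate_succ_apply] at h2
  rwa [h3]

/-- For `ε < η` the mollifier vanishes in a neighbourhood of every point of the slice, so all space
derivatives of the initial velocity agree with those of the bounded remainder. -/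
theorem slice_growth_time (hφ : IsMollifier φ) {K : Set (ℝ × ℝ)} (T R : ℝ) {η : ℝ} (hη : 0 < η)
    {Z : Eps → Set (ℝ × ℝ)} (hZ : ∀ ε, Z ε ⊆ slab T R ∩ {z | z.1 = 0})
    (hZη : ∀ ε, ∀ z ∈ Z ε, η ≤ |z.2|) (hZK : ∀ ε, Z ε ⊆ K) {m : ℝ} (hm : 0 ≤ m) :
    dir (1, 0) W.w ∈ regInf (preserves_dir K (0, 1)) (bounded hZK m) := by
  refine (mem_regInf_iff _ _).2 fun i => ?_
  obtain ⟨A, hA⟩ := (W.init' (Icc (-R) R) isCompact_Icc i).exists_iteratedDeriv_le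
  refine Growth.of_bound hm (A := A) ?_
  filter_upwards [hA, eventually_lt_atZero hη] with ε h1 hε z hz
  have h2 := h1 z.2 (hZ ε hz).1.2
  have h3 : z = (0, z.2) := Prod.ext (hZ ε hz).2 rfl
  have h4 : (fun x => (dir (1, 0) W.w).1 ε (0, x) - rescale φ ε x) =ᶠ[𝓝 z.2]
      fun x => (dir (1, 0) W.w).1 ε (0, x) := by
    have : ∀ᶠ x : ℝ in 𝓝 z.2, (ε : ℝ) < |x| :=
      continuous_abs.continuousAt.eventually (lt_mem_nhds (hε.trans_le (hZη ε z hz)))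
    filter_upwards [this] with x hx
    rw [rescale_eq_zero hφ ε.pos hx.le, sub_zero]
  rw [h4.iteratedDeriv_eq, (dir (1, 0) W.w).iteratedDeriv_slice ε le_rfl] at h2
  rwa [h3]

/-- Away from the characteristic `σ x = S(t)`, the variable `P_σ` is regular in the transversal
direction. -/
theorem growth_transversal (hφ : IsMollifier φ) {η : ℝ} (hη : 0 < η) (R T : ℝ) {M : ℝ}
    (hM : 0 ≤ M) (hw : ∀ v, Growth (fun _ => slab T (R + W.b * T)) M (dir v W.w)) {σ : ℝ}
    (hσ : σ * σ = 1) (i : ℕ) : Growth (W.zone σ η R T) M ((W.D (-σ))^[i] (W.P σ)) := by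
  set K := slab T (R + W.b * T) with hKdef
  have hK : K ⊆ halfPlane.carrier := slab_subset _ _
  have hc : IsCompact K := isCompact_slab _ _
  have hZ : ∀ ε, W.zone σ η R T ε ⊆ K := W.zone_subset hσ η R T
  have hZ0 : ∀ ε, W.zone σ η R T ε ∩ {z | z.1 = 0} ⊆ K := fun ε => inter_subset_left.trans (hZ ε)
  have Sys := W.isTransportSystem hK hc hσ
  have hP : ∀ τ, W.P τ ∈ bounded hZ M := W.P_mem hK hc _
    fun v => (hw v).mono le_rfl (Eventually.of_forall hZ)
  have hZ0' : ∀ ε, W.zone σ η R T ε ∩ {z | z.1 = 0} ⊆ K ∩ {z | z.1 = 0} :=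
    fun ε z hz => ⟨hZ0 ε hz, hz.2⟩
  have hP0 : ∀ τ, W.P τ ∈ regInf (preserves_dir K (0, 1)) (bounded hZ0 M) := by
    intro τ
    rw [P]
    have hx := W.slice_growth_space T (R + W.b * T) hZ0' hZ0 hM
    have ht := W.slice_growth_time hφ T (R + W.b * T) hη hZ0' (fun ε z hz => by
      have h1 := hz.1.2.1
      rw [show z.1 = 0 from hz.2, S_zero, zero_sub, abs_neg, abs_mul, abs_of_mul_self hσ,
        one_mul] at h1
      exact h1) hZ0 hM
    refine coeff_mul_mem _ (W.s_mem_slow hK hc) (coeff_sub_mem _ ht ?_)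
    exact coeff_mul_mem _ ((Net.slow K).algebraMap_mem _)
      (coeff_mul_mem _ (W.C_mem_slow hK hc) hx)
  -- Integration along `D σ` stays in the zone, since `S(t) - σ x` is constant there. At time zero,
  -- regularity in `x` gives regularity in the direction `D (-σ)`.
  have key := (Sys.mem_reg_of_integration (one_mem_bounded hZ hM) (hP σ) (hP (-σ))
    (fun k hk => W.growth_of_D (W.isBackward_zone hσ η R T) (fun ε z hz => hz.1.2) hk
      (Sys.iterate_mem_of_regInf (preserves_dir K (0, 1)) (W.D_neg σ) (W.dir_space_D (-σ))
        (one_mem_bounded hZ0 hM) (hP0 σ) (hP0 (-σ)) k)) i).1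
  exact (mem_reg_iff _ _ _).1 key i le_rfl

/-- Away from both characteristics through the origin, one power of `ε` bounds all derivatives. -/
theorem exists_bound_off_characteristics (hφ : IsMollifier φ) {η : ℝ} (hη : 0 < η) (R T : ℝ) :
    ∃ p : ℕ, ∀ n : ℕ, ∃ A : ℝ, ∀ᶠ ε : Eps in atZero,
      ∀ z ∈ W.zone 1 η R T ε ∩ W.zone (-1) η R T ε,
        ‖iteratedFDerivWithin ℝ n (W.w.1 ε) halfPlane.carrier z‖ ≤ A * (ε : ℝ) ^ (-(p : ℤ)) := by
  set K := slab T (R + W.b * T) with hKdef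
  have hK : K ⊆ halfPlane.carrier := slab_subset _ _
  have hc : IsCompact K := isCompact_slab _ _
  obtain ⟨M, hM, hw⟩ := W.exists_growth hK hc
  have hZ : ∀ ε, W.zone 1 η R T ε ∩ W.zone (-1) η R T ε ⊆ K :=
    fun ε => inter_subset_left.trans (W.zone_subset (by norm_num) η R T ε)
  have hM0 : (0 : ℝ) ≤ M := Nat.cast_nonneg M
  have Sys := W.isTransportSystem hK hc (σ := 1) (by norm_num)
  have h1 := one_mem_bounded hZ hM0
  have hP : W.P 1 ∈ regInf Sys.preserves' (bounded hZ M) := (mem_regInf_iff _ _).2 fun i =>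
    (W.growth_transversal hφ hη R T hM0 hw (by norm_num) i).mono le_rfl
      (Eventually.of_forall fun _ => inter_subset_left)
  have hQ : W.P (-1) ∈ regInf Sys.preserves (bounded hZ M) := (mem_regInf_iff _ _).2 fun i => by
    have := W.growth_transversal hφ hη R T hM0 hw (σ := -1) (by norm_num) i
    rw [neg_neg] at this
    exact this.mono le_rfl (Eventually.of_forall fun _ => inter_subset_right)
  -- The coordinate derivatives are combinations of `D 1` and `D (-1)` with slow coefficients.
  have hle : ∀ k, mixedReg Sys.preserves Sys.preserves' (bounded hZ M) k ≤
      mixedReg (preserves_dir K (1, 0)) (preserves_dir K (0, 1)) (bounded hZ M) k := by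
    refine mixedReg_le _ _ _ _ fun B f hf hf' => ⟨?_, ?_⟩
    · have e : dir (1, 0) f = (1 / 2 : ℝ) • (W.C * (W.D 1 f + W.D (-1) f)) := by
        rw [Algebra.smul_def, D_apply, D_apply, const_neg]
        linear_combination (-dir (1, 0) f * const (1 / 2) * 2) * W.s_sq_mul_C -
          dir (1, 0) f * two_mul_half
      rw [e]
      exact real_smul_mem _ _ (coeff_mul_mem _ (W.C_mem_slow hK hc) (B.add_mem hf hf'))
    · have e : dir (0, 1) f = (1 / 2 : ℝ) • (W.D 1 f - W.D (-1) f) := by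
        rw [W.D_neg, sub_sub_cancel, smul_smul]
        norm_num
      rw [e]
      exact real_smul_mem _ _ (coeff_sub_mem B hf hf')
  have hwB : W.w ∈ bounded hZ M := hM.mono le_rfl (Eventually.of_forall hZ)
  have key : ∀ k, W.w ∈
      mixedReg (preserves_dir K (1, 0)) (preserves_dir K (0, 1)) (bounded hZ M) k := by
    intro k
    cases k with
    | zero => exact hwB
    | succ k =>
      have hPQ := Sys.mem_mixedReg h1 hP hQ k
      refine mem_mixedReg_succ _ _ hwB k (hle k ?_) (hle k ?_)
      · rw [W.dir_time_eq 1]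
        exact real_smul_mem _ _ (coeff_mul_mem _ ((Net.slow K).mul_mem (W.s_mem_slow hK hc)
          (W.C_mem_slow hK hc)) (Submodule.add_mem _ hPQ.1 hPQ.2))
      · rw [W.dir_space_eq (σ := 1) (by norm_num)]
        exact real_smul_mem _ _ (coeff_mul_mem _ (W.s_mem_slow hK hc)
          (coeff_sub_mem _ hPQ.2 hPQ.1))
  -- The exponent exceeds `M` by the loss `δ = 1`, chosen once for all orders.
  refine ⟨M + 1, fun n => ?_⟩
  obtain ⟨A, hA⟩ := exists_bound_iteratedFDerivWithin hZ hK n (key n) one_pos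
  refine ⟨A, hA.mono fun ε h z hz => (h z hz).trans (le_of_eq ?_)⟩
  rw [← Real.rpow_intCast]
  push_cast
  rfl

end WaveNet

/-! ### Split integrals and iterated differences -/

theorem norm_integral_le_of_split {f : ℝ → ℝ} {u t M M' : ℝ} (hu : 0 ≤ u) (hut : u ≤ t)
    (hf : IntervalIntegrable f volume 0 t) (h : ∀ τ, 0 < τ → τ ≤ u → |f τ| ≤ M)
    (h' : ∀ τ, u < τ → τ ≤ t → |f τ| ≤ M') :
    |∫ τ in (0 : ℝ)..t, f τ| ≤ M * u + M' * (t - u) := by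
  have s1 : uIcc 0 u ⊆ uIcc 0 t := by
    rw [uIcc_of_le hu, uIcc_of_le (hu.trans hut)]
    exact Icc_subset_Icc_right hut
  have s2 : uIcc u t ⊆ uIcc 0 t := by
    rw [uIcc_of_le hut, uIcc_of_le (hu.trans hut)]
    exact Icc_subset_Icc_left hu
  rw [← intervalIntegral.integral_add_adjacent_intervals (hf.mono_set s1) (hf.mono_set s2)]
  refine (abs_add_le _ _).trans (add_le_add ?_ ?_)
  · have := intervalIntegral.norm_integral_le_of_norm_le_const (a := 0) (b := u) (C := M) (f := f)
      fun τ hτ => by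
        rw [uIoc_of_le hu] at hτ
        exact h τ hτ.1 hτ.2
    rwa [sub_zero, abs_of_nonneg hu] at this
  · have := intervalIntegral.norm_integral_le_of_norm_le_const (a := u) (b := t) (C := M') (f := f)
      fun τ hτ => by
        rw [uIoc_of_le hut] at hτ
        exact h' τ hτ.1 hτ.2
    rwa [abs_of_nonneg (sub_nonneg.2 hut)] at this

/-- Each difference is bounded by `h` times a derivative through the mean value inequality. -/
theorem abs_fwdDiff_iterate_le {h M : ℝ} (hh : 0 ≤ h) (k : ℕ) {F : ℝ → ℝ} (hF : ContDiff ℝ ∞ F)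
    {x : ℝ} (hM : ∀ y ∈ Icc x (x + k * h), |iteratedDeriv k F y| ≤ M) :
    |(fwdDiff h)^[k] F x| ≤ h ^ k * M := by
  induction k generalizing F M with
  | zero => simpa using hM x (by simp)
  | succ k ih =>
    have hsh : ContDiff ℝ ∞ fun y => F (y + h) := hF.comp (contDiff_id.add contDiff_const)
    have hn : (k : ℕ∞ω) ≤ ∞ := by exact_mod_cast le_top
    have e : ∀ y, iteratedDeriv k (fwdDiff h F) y =
        iteratedDeriv k F (y + h) - iteratedDeriv k F y := fun y => by
      change iteratedDeriv k ((fun y => F (y + h)) - F) y = _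
      rw [iteratedDeriv_sub (hsh.of_le hn).contDiffAt (hF.of_le hn).contDiffAt,
        iteratedDeriv_comp_add_const]
    have hd : ContDiff ℝ ∞ (fwdDiff h F) := hsh.sub hF
    rw [Function.iterate_succ_apply, pow_succ, mul_assoc]
    refine ih hd fun y hy => ?_
    have hk : x + (k + 1 : ℕ) * h = x + k * h + h := by push_cast; ring
    have hkd : Differentiable ℝ (iteratedDeriv k F) := by
      rw [iteratedDeriv_eq_iterate]
      exact (hF.iterate_deriv k).differentiable (by simp)
    have := (convex_Icc x (x + (k + 1 : ℕ) * h)).norm_image_sub_le_of_norm_deriv_le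
      (f := iteratedDeriv k F) (C := M) (fun y _ => hkd y)
      (fun y hy => by rw [← iteratedDeriv_succ]; exact hM y hy)
      (x := y) (y := y + h) ⟨hy.1, by rw [hk]; linarith [hy.2]⟩
      ⟨by linarith [hy.1], by rw [hk]; linarith [hy.2]⟩
    rw [e, mul_comm]
    simpa [abs_of_nonneg hh] using this

/-- Among the samples of `ψ` only the one at `0` survives, with coefficient `± 1`. The errors carry
binomial weights of total mass `2 ^ k`. -/
theorem abs_fwdDiff_iterate_sub_le {F ψ : ℝ → ℝ} {h α β : ℝ} (k : ℕ)
    (hψ : ∀ j : ℕ, 1 ≤ j → ψ j = 0) (hF : ∀ j : ℕ, j ≤ k → |F (j * h) - α * ψ j| ≤ β) :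
    |α * ψ 0| ≤ |(fwdDiff h)^[k] F 0| + 2 ^ k * β := by
  have e1 : (fwdDiff h)^[k] F 0 =
      ∑ j ∈ Finset.range (k + 1), ((-1 : ℝ) ^ (k - j) * k.choose j) * F (j * h) := by
    rw [fwdDiff_iter_eq_sum_shift]
    refine Finset.sum_congr rfl fun j _ => ?_
    rw [zsmul_eq_mul, zero_add, nsmul_eq_mul]
    push_cast
    rfl
  have e2 : (-1 : ℝ) ^ k * (α * ψ 0) =
      ∑ j ∈ Finset.range (k + 1), ((-1 : ℝ) ^ (k - j) * k.choose j) * (α * ψ j) := by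
    rw [Finset.sum_eq_single 0]
    · simp
    · intro j _ hj
      rw [hψ j (Nat.one_le_iff_ne_zero.2 hj)]
      ring
    · simp
  have e3 : |(-1 : ℝ) ^ k * (α * ψ 0)| = |α * ψ 0| := by
    rw [abs_mul, abs_pow, abs_neg, abs_one, one_pow, one_mul]
  have h1 : |(fwdDiff h)^[k] F 0 - (-1 : ℝ) ^ k * (α * ψ 0)| ≤ 2 ^ k * β := by
    rw [e1, e2, ← Finset.sum_sub_distrib]
    refine (Finset.abs_sum_le_sum_abs _ _).trans ?_
    have e4 : (2 : ℝ) ^ k = ∑ j ∈ Finset.range (k + 1), (k.choose j : ℝ) := by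
      exact_mod_cast (Nat.sum_range_choose k).symm
    rw [e4, Finset.sum_mul]
    refine Finset.sum_le_sum fun j hj => ?_
    rw [← mul_sub, abs_mul, abs_mul, abs_pow, abs_neg, abs_one, one_pow, one_mul, Nat.abs_cast]
    exact mul_le_mul_of_nonneg_left (hF j (Nat.lt_succ_iff.1 (Finset.mem_range.1 hj)))
      (Nat.cast_nonneg _)
  rw [← e3]
  have := abs_sub_abs_le_abs_sub ((-1 : ℝ) ^ k * (α * ψ 0)) ((fwdDiff h)^[k] F 0)
  rw [abs_sub_comm] at this
  linarith

/-! ### Sup norm estimate from the variation of the coefficient -/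

namespace WaveNet

variable {φ : ℝ → ℝ} (W : WaveNet φ)

/-- The right hand side of the equations for the characteristic variables. -/
def n : Net := W.s ^ 3 * W.N

theorem C_mul_D_P {σ : ℝ} (hσ : σ * σ = 1) (ε : Eps) (z : ℝ × ℝ) :
    (W.C * W.D σ (W.P σ)).1 ε z =
      -((W.C * W.g).1 ε z * (W.P (-σ)).1 ε z) + (W.C * W.n).1 ε z := by
  have : W.C * W.D σ (W.P σ) = -((W.C * W.g) * W.P (-σ)) + W.C * W.n := by
    rw [W.D_P hσ, n]; ring
  rw [this]
  rfl

/-- Along a characteristic the coupling is `∂_t c / (2 c)`. Its time integral is controlled by the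
total variation, hence uniformly in `ε`, although its pointwise size is only slow. -/
theorem abs_C_mul_g_le (ε : Eps) {z : ℝ × ℝ} (hz : z ∈ halfPlane.carrier) :
    |(W.C * W.g).1 ε z| ≤ |deriv (W.c ε) z.1| / (2 * W.a) := by
  have e1 : W.C * W.g = const (1 / 2) * (W.s * W.s) * dir (1, 0) W.C := by
    rw [g]
    linear_combination (const (1 / 2) * W.s * W.s * dir (1, 0) W.C) * W.s_sq_mul_C
  have e2 : (dir (1, 0) W.C).1 ε z = deriv (W.c ε) z.1 := by
    rw [C, dir_time_of_contDiff W.smooth, smul_apply, time_apply _ ε hz, one_mul]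
  have hc := W.c_pos ε (mem_halfPlane.1 hz)
  rw [e1, mul_apply, mul_apply, mul_apply, e2, const_apply, W.s_apply ε hz, ← mul_inv,
    Real.mul_self_sqrt hc.le, abs_mul,
    abs_of_pos (show (0 : ℝ) < 1 / 2 * (W.c ε z.1)⁻¹ by positivity)]
  calc _ ≤ 1 / 2 * W.a⁻¹ * |deriv (W.c ε) z.1| := by
        have := inv_anti₀ W.a_pos (W.a_le ε _ (mem_halfPlane.1 hz))
        gcongr
    _ = _ := by ring

/-- A sup norm estimate on domains of dependence. -/
theorem abs_P_le {ε : Eps} {Z : Set (ℝ × ℝ)} (hZc : IsCompact Z)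
    (hZ : ∀ σ : ℝ, σ * σ = 1 → W.IsBackward σ ε Z) {T A₀ A₁ : ℝ} (hT : ∀ z ∈ Z, z.1 ≤ T)
    (h0 : ∀ z ∈ Z, z.1 = 0 → ∀ σ : ℝ, σ * σ = 1 → |(W.P σ).1 ε z| ≤ A₀)
    (h1 : ∀ z ∈ Z, |(W.C * W.n).1 ε z| ≤ A₁) {z : ℝ × ℝ} (hz : z ∈ Z) {σ : ℝ} (hσ : σ * σ = 1) :
    |(W.P σ).1 ε z| ≤ 2 * (A₀ + T * A₁) * Real.exp (W.B / W.a) := by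
  set γ : ℝ → ℝ := fun t => |deriv (W.c ε) t| / (2 * W.a) with hγ
  have ha := W.a_pos
  have hγc : Continuous γ :=
    ((contDiff_infty_iff_deriv.1 (W.smooth ε)).2.continuous.abs).div_const _
  set Γ : ℝ → ℝ := fun t => ∫ τ in (0 : ℝ)..t, γ τ with hΓ
  have hΓd : ∀ t, HasDerivAt Γ (γ t) t := fun t =>
    (hγc.integral_hasStrictDerivAt 0 t).hasDerivAt
  have hΓc : Continuous Γ := continuous_iff_continuousAt.2 fun t => (hΓd t).continuousAt
  have hΓ0 : Γ 0 = 0 := intervalIntegral.integral_same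
  have hΓnn : ∀ t, 0 ≤ t → 0 ≤ Γ t := fun t ht =>
    intervalIntegral.integral_nonneg ht fun τ _ => by positivity
  have hΓB : ∀ t, 0 ≤ t → 2 * Γ t ≤ W.B / W.a := fun t ht => by
    have e : Γ t = (∫ τ in (0 : ℝ)..t, |deriv (W.c ε) τ|) / (2 * W.a) :=
      intervalIntegral.integral_div _ _
    rw [e, ← mul_div_assoc, mul_div_mul_left _ _ two_ne_zero]
    exact div_le_div_of_nonneg_right (W.variation ε t ht) ha.le
  have hH : Z ⊆ halfPlane.carrier := fun y hy => mem_halfPlane.2 (hZ 1 (by norm_num) y hy).1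
  have hPc : ∀ τ, ContinuousOn (fun y => |(W.P τ).1 ε y|) Z := fun τ =>
    (((W.P τ).contDiffOn ε).continuousOn.mono hH).abs
  have hexp : Continuous fun y : ℝ × ℝ => Real.exp (-(2 * Γ y.1)) :=
    Real.continuous_exp.comp (continuous_const.mul (hΓc.comp continuous_fst)).neg
  -- Gronwall's argument with a weighted maximum. The exponent contains `2 Γ`, so integrating `γ exp
  -- (2 Γ)` yields a factor `1 / 2`, and the maximum `μ` can be absorbed on the left.
  obtain ⟨y, hy, hmax⟩ := hZc.exists_isMaxOn ⟨z, hz⟩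
    (f := fun y => Real.exp (-(2 * Γ y.1)) * max |(W.P 1).1 ε y| |(W.P (-1)).1 ε y|)
    (hexp.continuousOn.mul ((hPc 1).sup (hPc (-1))))
  set μ := Real.exp (-(2 * Γ y.1)) * max |(W.P 1).1 ε y| |(W.P (-1)).1 ε y| with hμ
  have hμ0 : 0 ≤ μ := by positivity
  have hsup : ∀ τ : ℝ, τ * τ = 1 → ∀ x ∈ Z, |(W.P τ).1 ε x| ≤ μ * Real.exp (2 * Γ x.1) := by
    intro τ hτ x hx
    have h2 : Real.exp (-(2 * Γ x.1)) * max |(W.P 1).1 ε x| |(W.P (-1)).1 ε x| ≤ μ := hmax hx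
    have h3 : |(W.P τ).1 ε x| ≤ max |(W.P 1).1 ε x| |(W.P (-1)).1 ε x| := by
      rcases mul_self_eq_one_iff.1 hτ with rfl | rfl
      · exact le_max_left _ _
      · exact le_max_right _ _
    rw [Real.exp_neg, inv_mul_le_iff₀ (Real.exp_pos _)] at h2
    linarith
  have hA₁ : 0 ≤ A₁ := (abs_nonneg _).trans (h1 z hz)
  have hT0 : 0 ≤ T := (hZ 1 (by norm_num) z hz).1.trans (hT z hz)
  have hA₀ : 0 ≤ A₀ := by
    have hb := hZ 1 (by norm_num) z hz
    exact (abs_nonneg _).trans (h0 _ (hb.2 0 ⟨le_rfl, hb.1⟩) rfl 1 (by norm_num))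
  have hstep : ∀ τ : ℝ, τ * τ = 1 → ∀ x ∈ Z,
      |(W.P τ).1 ε x| ≤ A₀ + T * A₁ + μ / 2 * Real.exp (2 * Γ x.1) := by
    intro τ hτ x hx
    obtain ⟨hx0, hxb⟩ := hZ τ hτ x hx
    rw [W.eq_along (W.P τ) ε τ hx0]
    have b0 : |(W.P τ).1 ε (0, x.2 - τ * W.S ε x.1)| ≤ A₀ := by
      refine h0 _ ?_ rfl τ hτ
      simpa [S_zero] using hxb 0 ⟨le_rfl, hx0⟩
    have hdE : ∀ r, HasDerivAt (fun r => A₁ * r + μ / 2 * Real.exp (2 * Γ r))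
        (A₁ + γ r * (μ * Real.exp (2 * Γ r))) r := fun r => by
      have := ((hasDerivAt_id r).const_mul A₁).add
        ((((hΓd r).const_mul 2).exp).const_mul (μ / 2))
      refine this.congr_deriv ?_
      simp
      ring
    have hEc : Continuous fun r => A₁ + γ r * (μ * Real.exp (2 * Γ r)) := by fun_prop
    have hint : ∫ r in (0 : ℝ)..x.1, (A₁ + γ r * (μ * Real.exp (2 * Γ r))) =
        A₁ * x.1 + μ / 2 * Real.exp (2 * Γ x.1) - μ / 2 := by
      rw [intervalIntegral.integral_eq_sub_of_hasDerivAt (fun r _ => hdE r)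
        (hEc.intervalIntegrable _ _), hΓ0]
      simp
    have b1 : ‖∫ r in (0 : ℝ)..x.1,
        (W.C * W.D τ (W.P τ)).1 ε (r, x.2 - τ * (W.S ε x.1 - W.S ε r))‖ ≤
        ∫ r in (0 : ℝ)..x.1, (A₁ + γ r * (μ * Real.exp (2 * Γ r))) := by
      refine intervalIntegral.norm_integral_le_of_norm_le hx0
        (Eventually.of_forall fun r hr => ?_) (hEc.intervalIntegrable _ _)
      have hm := hxb r ⟨hr.1.le, hr.2⟩
      rw [W.C_mul_D_P hτ, Real.norm_eq_abs, add_comm]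
      refine (abs_add_le _ _).trans (add_le_add (h1 _ hm) ?_)
      rw [abs_neg, abs_mul]
      exact mul_le_mul (W.abs_C_mul_g_le ε (hH hm)) (hsup (-τ) (by rw [neg_mul_neg, hτ]) _ hm)
        (abs_nonneg _) (by positivity)
    rw [hint, Real.norm_eq_abs] at b1
    have b2 : A₁ * x.1 ≤ T * A₁ := by
      rw [mul_comm]
      exact mul_le_mul_of_nonneg_right (hT x hx) hA₁
    exact (abs_add_le _ _).trans (by linarith)
  have hμle : μ ≤ 2 * (A₀ + T * A₁) := by
    have h2 : max |(W.P 1).1 ε y| |(W.P (-1)).1 ε y| ≤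
        A₀ + T * A₁ + μ / 2 * Real.exp (2 * Γ y.1) :=
      max_le (hstep 1 (by norm_num) y hy) (hstep (-1) (by norm_num) y hy)
    have h3 : μ ≤ Real.exp (-(2 * Γ y.1)) * (A₀ + T * A₁ + μ / 2 * Real.exp (2 * Γ y.1)) :=
      mul_le_mul_of_nonneg_left h2 (Real.exp_pos _).le
    have h4 : Real.exp (-(2 * Γ y.1)) * Real.exp (2 * Γ y.1) = 1 := by
      rw [← Real.exp_add]; simp
    have h5 : Real.exp (-(2 * Γ y.1)) ≤ 1 :=
      Real.exp_le_one_iff.2 (by linarith [hΓnn y.1 (hZ 1 (by norm_num) y hy).1])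
    have h6 : Real.exp (-(2 * Γ y.1)) * (A₀ + T * A₁) ≤ A₀ + T * A₁ :=
      mul_le_of_le_one_left (by positivity) h5
    have h7 : Real.exp (-(2 * Γ y.1)) * (A₀ + T * A₁ + μ / 2 * Real.exp (2 * Γ y.1)) =
        Real.exp (-(2 * Γ y.1)) * (A₀ + T * A₁) + μ / 2 := by
      linear_combination (μ / 2) * h4
    linarith
  refine (hsup σ hσ z hz).trans ?_
  have := Real.exp_le_exp.2 (hΓB z.1 (hZ 1 (by norm_num) z hz).1)
  gcongr

end WaveNet

/-! ### Size of the characteristic variables in cones and ahead of the fronts -/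

namespace WaveNet

variable {φ : ℝ → ℝ} (W : WaveNet φ)

/-- The domain of dependence `|x| ≤ R - S(t)`, `0 ≤ t ≤ T`. -/
def cone (T R : ℝ) (ε : Eps) : Set (ℝ × ℝ) :=
  {z | z.1 ∈ Icc 0 T ∧ |z.2| + W.S ε z.1 ≤ R}

/-- The part of the domain of dependence that lies ahead of the wave front. -/
def ahead (σ T R : ℝ) (ε : Eps) : Set (ℝ × ℝ) :=
  W.cone T R ε ∩ {z | W.S ε z.1 + ε ≤ σ * z.2}

theorem cone_subset (T R : ℝ) (ε : Eps) : W.cone T R ε ⊆ slab T R := fun z hz =>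
  ⟨hz.1, abs_le.1 (by linarith [hz.2, W.S_nonneg ε hz.1.1])⟩

theorem isCompact_cone (T R : ℝ) (ε : Eps) : IsCompact (W.cone T R ε) := by
  refine (isCompact_slab T R).of_isClosed_subset ?_ (W.cone_subset T R ε)
  exact (isClosed_Icc.preimage continuous_fst).inter (isClosed_le
    (continuous_snd.abs.add ((W.continuous_S ε).comp continuous_fst)) continuous_const)

theorem isCompact_ahead (σ T R : ℝ) (ε : Eps) : IsCompact (W.ahead σ T R ε) :=
  (W.isCompact_cone T R ε).inter_right (isClosed_le
    (((W.continuous_S ε).comp continuous_fst).add continuous_const)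
    (continuous_const.mul continuous_snd))

theorem isBackward_cone (T R : ℝ) (ε : Eps) {τ : ℝ} (hτ : τ * τ = 1) :
    W.IsBackward τ ε (W.cone T R ε) := by
  rintro z ⟨⟨h0, hT⟩, h⟩
  refine ⟨h0, fun r hr => ⟨⟨hr.1, hr.2.trans hT⟩, ?_⟩⟩
  have h1 := W.S_mono ε hr.1 hr.2
  have h2 := abs_sub z.2 (τ * (W.S ε z.1 - W.S ε r))
  rw [abs_mul, abs_of_mul_self hτ, one_mul, abs_of_nonneg (sub_nonneg.2 h1)] at h2
  change |z.2 - τ * (W.S ε z.1 - W.S ε r)| + W.S ε r ≤ R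
  linarith

/-- The front moves at the maximal speed, so neither family of characteristics, followed backward,
can leave the region ahead of it. -/
theorem isBackward_ahead {σ : ℝ} (hσ : σ * σ = 1) (T R : ℝ) (ε : Eps) {τ : ℝ} (hτ : τ * τ = 1) :
    W.IsBackward τ ε (W.ahead σ T R ε) := by
  rintro z ⟨h, h'⟩
  have hb := W.isBackward_cone T R ε hτ z h
  refine ⟨hb.1, fun r hr => ⟨hb.2 r hr, ?_⟩⟩
  have h1 := W.S_mono ε hr.1 hr.2
  have h2 : σ * τ ≤ 1 := by nlinarith [sq_nonneg (σ - τ)]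
  change W.S ε r + ε ≤ σ * (z.2 - τ * (W.S ε z.1 - W.S ε r))
  have h3 : W.S ε z.1 + ε ≤ σ * z.2 := h'
  nlinarith

/-- `P_σ` at time zero. -/
theorem abs_P_zero_le (R : ℝ) : ∃ L, 0 ≤ L ∧ ∀ᶠ ε : Eps in atZero, ∀ x : ℝ,
    |x| ≤ R → ∀ σ : ℝ, σ * σ = 1 →
      |(W.P σ).1 ε (0, x) - (√(W.c ε 0))⁻¹ * rescale φ ε x| ≤ L := by
  obtain ⟨A, hA⟩ := (W.init (Icc (-R) R) isCompact_Icc 1).exists_iteratedDeriv_le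
  obtain ⟨A', hA'⟩ := (W.init' (Icc (-R) R) isCompact_Icc 0).exists_iteratedDeriv_le
  have hb := W.b_pos
  refine ⟨(√W.a)⁻¹ * (|A'| + W.b * |A|), by positivity, ?_⟩
  filter_upwards [hA, hA'] with ε h1 h2 x hx σ hσ
  have hz : ((0 : ℝ), x) ∈ halfPlane.carrier := mem_halfPlane.2 le_rfl
  have h3 := h1 x (abs_le.1 hx)
  have h4 := h2 x (abs_le.1 hx)
  rw [W.w.iteratedDeriv_slice ε le_rfl, Function.iterate_one] at h3
  rw [iteratedDeriv_zero] at h4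
  have hc := W.c_pos ε (le_refl 0)
  have e : (W.P σ).1 ε (0, x) - (√(W.c ε 0))⁻¹ * rescale φ ε x = (√(W.c ε 0))⁻¹ *
      (((dir (1, 0) W.w).1 ε (0, x) - rescale φ ε x) -
        σ * (W.c ε 0 * (dir (0, 1) W.w).1 ε (0, x))) := by
    rw [P, mul_apply, sub_apply, mul_apply, mul_apply, W.s_apply ε hz, W.C_apply ε hz,
      const_apply]
    ring
  rw [e, abs_mul, abs_of_pos (by positivity)]
  have h5 := inv_anti₀ (Real.sqrt_pos.2 W.a_pos) (Real.sqrt_le_sqrt (W.a_le ε 0 le_rfl))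
  refine mul_le_mul h5 ((abs_sub _ _).trans (add_le_add (h4.trans (le_abs_self _)) ?_))
    (abs_nonneg _) (by positivity)
  rw [abs_mul, abs_of_mul_self hσ, one_mul, abs_mul, abs_of_pos hc]
  exact mul_le_mul (W.le_b ε 0 le_rfl) (h3.trans (le_abs_self _)) (abs_nonneg _) hb.le

theorem C_mul_n_bounded (T R : ℝ) : ∃ L, 0 ≤ L ∧ ∀ᶠ ε : Eps in atZero, ∀ z ∈ slab T R,
    |(W.C * W.n).1 ε z| ≤ L := by
  obtain ⟨A, hA⟩ := W.rhs (slab T R) (slab_subset T R) (isCompact_slab T R) 0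
  have hb := W.b_pos
  refine ⟨W.b * ((√W.a)⁻¹ ^ 3 * |A|), by positivity, hA.mono fun ε h1 z hz => ?_⟩
  have hz' := slab_subset T R hz
  have hc := W.c_pos ε hz.1.1
  have h2 := h1 z hz
  rw [norm_iteratedFDerivWithin_zero, zpow_zero, mul_one] at h2
  have e : (W.C * W.n).1 ε z = W.c ε z.1 * ((√(W.c ε z.1))⁻¹ ^ 3 * W.N.1 ε z) := by
    have : W.C * W.n = W.C * ((W.s * W.s * W.s) * W.N) := by rw [n]; ring
    rw [this, mul_apply, mul_apply, mul_apply, mul_apply, W.s_apply ε hz', W.C_apply ε hz']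
    ring
  have h5 := inv_anti₀ (Real.sqrt_pos.2 W.a_pos) (Real.sqrt_le_sqrt (W.a_le ε z.1 hz.1.1))
  rw [e, abs_mul, abs_mul, abs_of_pos hc, abs_of_pos (by positivity)]
  refine mul_le_mul (W.le_b ε z.1 hz.1.1) (mul_le_mul (by gcongr) (h2.trans (le_abs_self A))
    (abs_nonneg _) (by positivity)) (by positivity) hb.le

theorem abs_rescale_le (hφ : IsMollifier φ) (ε : Eps) (x : ℝ) : |rescale φ ε x| ≤ φ 0 / ε := by
  rw [rescale, abs_div, abs_of_pos ε.pos, abs_of_nonneg (hφ.nonneg _)]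
  exact div_le_div_of_nonneg_right (hφ.le_apply_zero _) ε.pos.le

/-- The characteristic variables are of order `1 / ε`, and bounded ahead of the wave fronts. -/
theorem exists_abs_P_le (hφ : IsMollifier φ) {T : ℝ} (hT : 0 ≤ T) (R : ℝ) :
    ∃ L, 0 ≤ L ∧ ∀ᶠ ε : Eps in atZero,
      (∀ z ∈ W.cone T R ε, ∀ τ : ℝ, τ * τ = 1 → |(W.P τ).1 ε z| ≤ L / ε) ∧
      ∀ σ : ℝ, σ * σ = 1 → ∀ z ∈ W.ahead σ T R ε, ∀ τ : ℝ, τ * τ = 1 → |(W.P τ).1 ε z| ≤ L := by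
  obtain ⟨L₀, hL₀, h0⟩ := W.abs_P_zero_le R
  obtain ⟨L₁, hL₁, h1⟩ := W.C_mul_n_bounded T R
  have ha := W.a_pos
  have hφ0 := hφ.apply_zero_pos
  set E := Real.exp (W.B / W.a) with hE
  have hE0 : 0 ≤ E := (Real.exp_pos _).le
  set s₀ := (√W.a)⁻¹ with hs₀
  have hs0 : 0 ≤ s₀ := by positivity
  refine ⟨2 * (L₀ + s₀ * φ 0 + T * L₁) * E, by positivity, ?_⟩
  filter_upwards [h0, h1] with ε h0 h1
  have hε := ε.pos
  have hsc : (√(W.c ε 0))⁻¹ ≤ s₀ :=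
    inv_anti₀ (Real.sqrt_pos.2 W.a_pos) (Real.sqrt_le_sqrt (W.a_le ε 0 le_rfl))
  have hsc0 : 0 ≤ (√(W.c ε 0))⁻¹ := by positivity
  have hx : ∀ z ∈ W.cone T R ε, z.1 = 0 → z = (0, z.2) ∧ |z.2| ≤ R := fun z hz h => by
    refine ⟨Prod.ext h rfl, ?_⟩
    have := hz.2
    rwa [h, S_zero, add_zero] at this
  constructor
  · intro z hz τ hτ
    have := W.abs_P_le (W.isCompact_cone T R ε) (fun _ h => W.isBackward_cone T R ε h)
      (A₀ := L₀ + s₀ * (φ 0 / ε)) (A₁ := L₁) (fun y hy => hy.1.2) (fun y hy hy0 σ hσ => ?_)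
      (fun y hy => h1 y (W.cone_subset T R ε hy)) hz hτ
    · refine this.trans ?_
      rw [le_div_iff₀ hε]
      have e : 2 * (L₀ + s₀ * (φ 0 / ε) + T * L₁) * E * ε =
          2 * (L₀ * ε + s₀ * φ 0 + T * L₁ * ε) * E := by
        field_simp
      rw [e]
      have a1 : L₀ * ε ≤ L₀ := mul_le_of_le_one_right hL₀ ε.le_one
      have a2 : T * L₁ * ε ≤ T * L₁ := mul_le_of_le_one_right (by positivity) ε.le_one
      gcongr
    · obtain ⟨e, hyR⟩ := hx y hy hy0
      rw [e]
      have a1 := h0 y.2 hyR σ hσ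
      have a2 : |(√(W.c ε 0))⁻¹ * rescale φ ε y.2| ≤ s₀ * (φ 0 / ε) := by
        rw [abs_mul, abs_of_nonneg hsc0]
        exact mul_le_mul hsc (abs_rescale_le hφ ε _) (abs_nonneg _) hs0
      have a3 := abs_add_le ((W.P σ).1 ε (0, y.2) - (√(W.c ε 0))⁻¹ * rescale φ ε y.2)
        ((√(W.c ε 0))⁻¹ * rescale φ ε y.2)
      rw [sub_add_cancel] at a3
      linarith
  · intro σ hσ z hz τ hτ
    have := W.abs_P_le (W.isCompact_ahead σ T R ε) (fun _ h => W.isBackward_ahead hσ T R ε h)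
      (A₀ := L₀) (A₁ := L₁) (fun y hy => hy.1.1.2) (fun y hy hy0 σ' hσ' => ?_)
      (fun y hy => h1 y (W.cone_subset T R ε hy.1)) hz hτ
    · refine this.trans ?_
      have : 0 ≤ s₀ * φ 0 := by positivity
      gcongr
      linarith
    · obtain ⟨e, hyR⟩ := hx y hy.1 hy0
      -- The margin `ε` in `ahead` keeps the initial points off the support of `φ_ε`.
      have hy2 : (ε : ℝ) ≤ |y.2| := by
        have h2 : W.S ε y.1 + ε ≤ σ * y.2 := hy.2
        rw [hy0, S_zero, zero_add] at h2
        have := le_abs_self (σ * y.2)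
        rw [abs_mul, abs_of_mul_self hσ, one_mul] at this
        linarith
      have a1 := h0 y.2 hyR σ' hσ'
      rw [rescale_eq_zero hφ hε hy2, mul_zero, sub_zero] at a1
      rwa [e]

end WaveNet

/-! ### Asymptotics at the wave front -/

namespace WaveNet

variable {φ : ℝ → ℝ} (W : WaveNet φ)

theorem C_mul_g_growth (T R : ℝ) {δ : ℝ} (hδ : 0 < δ) : ∃ G, 0 ≤ G ∧ ∀ᶠ ε : Eps in atZero,
    ∀ z ∈ slab T R, |(W.C * W.g).1 ε z| ≤ G * (ε : ℝ) ^ (-δ) := by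
  have hK := slab_subset T R
  have hc := isCompact_slab T R
  have h : W.C * W.g ∈ Net.slow (slab T R) := (Net.slow _).mul_mem (W.C_mem_slow hK hc)
    (W.isTransportSystem hK hc (σ := 1) (by norm_num)).coeff_mem
  obtain ⟨A, hA⟩ := growth_of_mem_slow h δ hδ
  refine ⟨|A|, abs_nonneg A, hA.mono fun ε h1 z hz => (h1 z hz).trans ?_⟩
  rw [zero_add]
  exact mul_rpow_neg_mono ε le_rfl

/-- The source terms along a characteristic. -/
theorem abs_C_mul_D_P_le {σ : ℝ} (hσ : σ * σ = 1) {ε : Eps} {z : ℝ × ℝ} {G L M : ℝ}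
    (hg : |(W.C * W.g).1 ε z| ≤ G) (hn : |(W.C * W.n).1 ε z| ≤ L) (hP : |(W.P (-σ)).1 ε z| ≤ M) :
    |(W.C * W.D σ (W.P σ)).1 ε z| ≤ G * M + L := by
  rw [W.C_mul_D_P hσ]
  refine (abs_add_le _ _).trans (add_le_add ?_ hn)
  rw [abs_neg, abs_mul]
  exact mul_le_mul hg hP (abs_nonneg _) ((abs_nonneg _).trans hg)

/-- Near the wave front `σ x = S(t)` the transversal variable `P_{-σ}` has slow growth, except for
very small times. -/
theorem abs_P_neg_le_near_front {σ : ℝ} (hσ : σ * σ = 1) {ε : Eps} {T R G L k : ℝ} (hL : 0 ≤ L)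
    (hG : 0 ≤ G) (hk : 0 ≤ k)
    (hg : ∀ z ∈ slab T R, |(W.C * W.g).1 ε z| ≤ G) (hn : ∀ z ∈ slab T R, |(W.C * W.n).1 ε z| ≤ L)
    (hP : ∀ z ∈ W.cone T R ε, ∀ τ : ℝ, τ * τ = 1 → |(W.P τ).1 ε z| ≤ L / ε)
    (hP' : ∀ z ∈ W.ahead σ T R ε, ∀ τ : ℝ, τ * τ = 1 → |(W.P τ).1 ε z| ≤ L)
    {z : ℝ × ℝ} (hz : z ∈ W.cone T R ε) (hzk : W.S ε z.1 - k * ε ≤ σ * z.2)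
    (ht : (k + 1) / W.a * ε ≤ z.1) :
    |(W.P (-σ)).1 ε z| ≤ L + ((G * L + L) * T + (G * L + L) * ((k + 1) / W.a)) := by
  have ha := W.a_pos
  have hε := ε.pos
  have hσ' : -σ * -σ = 1 := by rw [neg_mul_neg, hσ]
  have hb := W.isBackward_cone T R ε hσ' z hz
  have hz0 := hb.1
  -- The transversal characteristic and the front separate backward in time at a rate of at least `2
  -- a`, so a time `(k + 1) ε / a` suffices to pass from `k ε` behind the front to `ε` ahead of it.
  have hahead : ∀ r ∈ Icc 0 z.1, (k + 1) / W.a * ε ≤ z.1 - r →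
      (r, z.2 - -σ * (W.S ε z.1 - W.S ε r)) ∈ W.ahead σ T R ε := by
    intro r hr hrz
    refine ⟨hb.2 r hr, ?_⟩
    change W.S ε r + ε ≤ σ * (z.2 - -σ * (W.S ε z.1 - W.S ε r))
    have h1 := W.le_S_sub ε hr.1 hr.2
    have h2 : (k + 1) * ε ≤ W.a * (z.1 - r) := by
      have := mul_le_mul_of_nonneg_left hrz ha.le
      rwa [← mul_assoc, mul_div_cancel₀ _ ha.ne'] at this
    have h3 : σ * (z.2 - -σ * (W.S ε z.1 - W.S ε r)) = σ * z.2 + (W.S ε z.1 - W.S ε r) := by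
      linear_combination (W.S ε z.1 - W.S ε r) * hσ
    rw [h3]
    have h4 : 0 ≤ W.S ε z.1 - W.S ε r := by linarith [W.S_mono ε hr.1 hr.2]
    nlinarith
  have hκ : 0 ≤ (k + 1) / W.a * ε := by positivity
  rw [W.eq_along (W.P (-σ)) ε (-σ) hz0]
  refine (abs_add_le _ _).trans (add_le_add ?_ ?_)
  · have := hP' _ (hahead 0 ⟨le_rfl, hz0⟩ (by simpa using ht)) (-σ) hσ'
    simpa [S_zero] using this
  · have hGL : 0 ≤ G * L + L := by positivity
    have hcont : IntervalIntegrable (fun τ => (W.C * W.D (-σ) (W.P (-σ))).1 ε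
        (τ, z.2 - -σ * (W.S ε z.1 - W.S ε τ))) volume 0 z.1 := by
      have := W.intervalIntegrable_along (W.C * W.D (-σ) (W.P (-σ))) ε (-σ)
        (z.2 - -σ * W.S ε z.1) hz0
      convert this using 5
      ring
    -- Before the last time span of length `O(ε)` the source is bounded by `G L + L`; within it the
    -- source is of order `G L / ε`, and the short duration compensates the factor `1 / ε`.
    have key := norm_integral_le_of_split (u := z.1 - (k + 1) / W.a * ε) (M := G * L + L)
      (M' := G * (L / ε) + L) (by linarith) (by linarith) hcont
      (fun r hr0 hr => by
        have hm : r ∈ Icc 0 z.1 := ⟨hr0.le, by linarith⟩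
        have hs := W.cone_subset T R ε (hb.2 r hm)
        exact W.abs_C_mul_D_P_le hσ' (hg _ hs) (hn _ hs)
          (hP' _ (hahead r hm (by linarith)) _ (by rw [neg_neg, hσ])))
      (fun r hr0 hr => by
        have hm : r ∈ Icc 0 z.1 := ⟨by linarith, hr⟩
        have hs := W.cone_subset T R ε (hb.2 r hm)
        exact W.abs_C_mul_D_P_le hσ' (hg _ hs) (hn _ hs)
          (hP _ (hb.2 r hm) _ (by rw [neg_neg, hσ])))
    refine key.trans (add_le_add ?_ ?_)
    · refine mul_le_mul_of_nonneg_left ?_ hGL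
      linarith [hz.1.2]
    · have e : (G * (L / ε) + L) * (z.1 - (z.1 - (k + 1) / W.a * ε)) =
          (G * L + L * ε) * ((k + 1) / W.a) := by
        field_simp
        ring
      rw [e]
      have : L * ε ≤ L := mul_le_of_le_one_right hL ε.le_one
      gcongr

/-- At the wave front `σ x = S(t)` the variable `P_σ` is a multiple of `φ_ε`, up to lower order. -/
theorem exists_abs_P_front_sub_le (hφ : IsMollifier φ) {σ : ℝ} (hσ : σ * σ = 1) {t : ℝ}
    (ht : 0 ≤ t) (k : ℕ) : ∃ L, ∀ᶠ ε : Eps in atZero, ∀ j : ℕ, j ≤ k →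
      |(W.P σ).1 ε (t, j * ε + σ * W.S ε t) - (√(W.c ε 0))⁻¹ / ε * φ j| ≤
        L * (ε : ℝ) ^ (-(1 / 2) : ℝ) := by
  -- Wide enough for the cone to contain the curves `j ε + σ S(r)` up to time `t`, as `|x| + S ≤ k +
  -- 2 b t` on them.
  set R := k + 2 * (W.b * t) with hR
  obtain ⟨L₀, hL₀, h0⟩ := W.abs_P_zero_le R
  obtain ⟨L₁, hL₁, h1⟩ := W.C_mul_n_bounded t R
  obtain ⟨L₂, hL₂, h2⟩ := W.exists_abs_P_le hφ ht R
  -- The coupling enters twice, once in the estimate of `P (-σ)` and once in the source of `P σ`;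
  -- the loss `1 / 4` each time yields the exponent `1 / 2`.
  obtain ⟨G, hG, hg⟩ := W.C_mul_g_growth t R (δ := 1 / 4) (by norm_num)
  have ha := W.a_pos
  set L := L₁ + L₂ with hL
  have hL0 : 0 ≤ L := by positivity
  set κ := ((k : ℝ) + 1) / W.a with hκ
  have hκ0 : 0 ≤ κ := by positivity
  set M := L + ((G * L + L) * t + (G * L + L) * κ) with hM
  have hM0 : 0 ≤ M := by positivity
  refine ⟨L₀ + (G * L + L) * κ + (G * M + L) * t, ?_⟩
  filter_upwards [h0, h1, h2, hg] with ε h0 h1 h2 hg j hj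
  have hε := ε.pos
  set q := (ε : ℝ) ^ (-(1 / 4 : ℝ)) with hq
  have hq1 : 1 ≤ q := ε.one_le_rpow_neg (by norm_num)
  have hqq : (ε : ℝ) ^ (-(1 / 2) : ℝ) = q * q := by
    rw [hq, ← Real.rpow_add hε]
    norm_num
  have hqq1 : 1 ≤ q * q := one_le_mul_of_one_le_of_one_le hq1 hq1
  have hjk : (j : ℝ) ≤ k := by exact_mod_cast hj
  have hjε : (j : ℝ) * ε ≤ k := (mul_le_of_le_one_right (Nat.cast_nonneg j) ε.le_one).trans hjk
  have hjε0 : 0 ≤ (j : ℝ) * ε := by positivity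
  have hcone : ∀ r ∈ Icc 0 t, (r, j * (ε : ℝ) + σ * W.S ε r) ∈ W.cone t R ε := by
    intro r hr
    refine ⟨hr, ?_⟩
    change |j * (ε : ℝ) + σ * W.S ε r| + W.S ε r ≤ R
    have a1 := abs_add_le (j * (ε : ℝ)) (σ * W.S ε r)
    have a2 := W.S_nonneg ε hr.1
    rw [abs_mul σ, abs_of_mul_self hσ, one_mul, abs_of_nonneg hjε0, abs_of_nonneg a2] at a1
    have a3 := W.S_le ε hr.1
    have a4 : W.b * r ≤ W.b * t := mul_le_mul_of_nonneg_left hr.2 W.b_pos.le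
    linarith
  have hn' : ∀ z ∈ slab t R, |(W.C * W.n).1 ε z| ≤ L := fun z hz => (h1 z hz).trans (by linarith)
  have hP1 : ∀ z ∈ W.cone t R ε, ∀ τ : ℝ, τ * τ = 1 → |(W.P τ).1 ε z| ≤ L / ε :=
    fun z hz τ hτ => (h2.1 z hz τ hτ).trans (by gcongr; linarith)
  have hP2 : ∀ z ∈ W.ahead σ t R ε, ∀ τ : ℝ, τ * τ = 1 → |(W.P τ).1 ε z| ≤ L :=
    fun z hz τ hτ => (h2.2 σ hσ z hz τ hτ).trans (by linarith)
  have hGq : 0 ≤ G * q := by positivity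
  have hMq : L + ((G * q * L + L) * t + (G * q * L + L) * κ) ≤ M * q := by
    have b1 : L ≤ L * q := le_mul_of_one_le_right hL0 hq1
    have b2 : G * q * L + L ≤ (G * L + L) * q := by nlinarith
    calc _ ≤ L * q + ((G * L + L) * q * t + (G * L + L) * q * κ) := by gcongr
      _ = M * q := by rw [hM]; ring
  have hQ : ∀ r ∈ Icc 0 t, κ * ε ≤ r →
      |(W.P (-σ)).1 ε (r, j * (ε : ℝ) + σ * W.S ε r)| ≤ M * q := by
    intro r hr hκr
    refine (W.abs_P_neg_le_near_front hσ hL0 hGq (Nat.cast_nonneg k) hg hn' hP1 hP2 (hcone r hr)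
      ?_ hκr).trans hMq
    change W.S ε r - k * (ε : ℝ) ≤ σ * (j * (ε : ℝ) + σ * W.S ε r)
    have e : σ * (j * (ε : ℝ) + σ * W.S ε r) = σ * (j * ε) + W.S ε r := by
      linear_combination W.S ε r * hσ
    rw [e]
    have a1 := neg_abs_le (σ * (j * ε))
    rw [abs_mul σ, abs_of_mul_self hσ, one_mul, abs_of_nonneg hjε0] at a1
    have a2 : (j : ℝ) * ε ≤ k * ε := by gcongr
    linarith
  rw [W.integral_along (W.P σ) ε σ (j * ε) ht]
  -- The bound near the front needs times beyond `κ ε`. The minimum also covers `t < κ ε`, in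
  -- particular the vertex `t = 0`.
  have hu0 : 0 ≤ min (κ * ε) t := le_min (by positivity) ht
  have key := norm_integral_le_of_split hu0 (min_le_right (κ * ε) t)
    (W.intervalIntegrable_along (W.C * W.D σ (W.P σ)) ε σ (j * ε) ht)
    (M := G * q * (L / ε) + L) (M' := G * q * (M * q) + L)
    (fun r hr0 hr => by
      have hm : r ∈ Icc 0 t := ⟨hr0.le, hr.trans (min_le_right _ _)⟩
      have hs := W.cone_subset t R ε (hcone r hm)
      exact W.abs_C_mul_D_P_le hσ (hg _ hs) (hn' _ hs)
        (hP1 _ (hcone r hm) _ (by rw [neg_mul_neg, hσ])))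
    (fun r hr0 hr => by
      have hm : r ∈ Icc 0 t := ⟨hu0.trans hr0.le, hr⟩
      have hs := W.cone_subset t R ε (hcone r hm)
      have hκr : κ * ε ≤ r := by
        rcases min_lt_iff.1 hr0 with h | h
        · exact h.le
        · linarith
      exact W.abs_C_mul_D_P_le hσ (hg _ hs) (hn' _ hs) (hQ r hm hκr))
  have k1 : (G * q * (L / ε) + L) * min (κ * ε) t ≤ (G * L + L) * κ * (q * q) := by
    calc _ ≤ (G * q * (L / ε) + L) * (κ * ε) := by
          gcongr
          exact min_le_left _ _
      _ = (G * L * q + L * ε) * κ := by field_simp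
      _ ≤ (G * L * (q * q) + L * (q * q)) * κ := by
          have b1 : q ≤ q * q := le_mul_of_one_le_right (by linarith) hq1
          have b2 := ε.le_one.trans hqq1
          gcongr
      _ = _ := by ring
  have k2 : (G * q * (M * q) + L) * (t - min (κ * ε) t) ≤ (G * M + L) * t * (q * q) := by
    calc _ ≤ (G * q * (M * q) + L * (q * q)) * t := by
          have b1 : L ≤ L * (q * q) := le_mul_of_one_le_right hL0 hqq1
          have b2 : t - min (κ * ε) t ≤ t := by linarith
          have b3 : 0 ≤ t - min (κ * ε) t := by linarith [min_le_right (κ * (ε : ℝ)) t]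
          gcongr
      _ = _ := by ring
  have k3 : |(W.P σ).1 ε (0, j * ε) - (√(W.c ε 0))⁻¹ / ε * φ j| ≤ L₀ * (q * q) := by
    have := h0 (j * ε) (by
      rw [abs_of_nonneg hjε0]
      have := mul_nonneg W.b_pos.le ht
      linarith) σ hσ
    have e : (√(W.c ε 0))⁻¹ * rescale φ ε (j * ε) = (√(W.c ε 0))⁻¹ / ε * φ j := by
      rw [rescale, mul_div_cancel_right₀ _ hε.ne']
      ring
    rw [e] at this
    exact this.trans (le_mul_of_one_le_right hL₀ hqq1)
  rw [hqq, add_sub_right_comm]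
  refine (abs_add_le _ _).trans ?_
  have e : (L₀ + (G * L + L) * κ + (G * M + L) * t) * (q * q) =
    L₀ * (q * q) + ((G * L + L) * κ * (q * q) + (G * M + L) * t * (q * q)) := by ring
  rw [e]
  exact add_le_add k3 (key.trans (add_le_add k1 k2))

/-- The derivatives of `P_σ` at the wave front are not bounded by a common power of `ε`. -/
theorem not_bounded_at_front (hφ : IsMollifier φ) {σ : ℝ} (hσ : σ * σ = 1) {t ρ : ℝ} (ht : 0 ≤ t)
    (hρ : 0 < ρ) (p : ℕ) : ¬ ∃ A : ℝ, ∀ᶠ ε : Eps in atZero, ∀ x, |x - σ * W.S ε t| ≤ ρ →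
      |((dir (0, 1))^[p] (W.P σ)).1 ε (t, x)| ≤ A * (ε : ℝ) ^ (-(p : ℤ)) := by
  rintro ⟨A, hA⟩
  obtain ⟨L, hL⟩ := W.exists_abs_P_front_sub_le hφ hσ ht p
  have hb := W.b_pos
  have hφ0 := hφ.apply_zero_pos
  -- The assumed derivative bound makes the `p`-th difference with step `ε` bounded, while the
  -- samples make it of size `1 / ε`. Multiplied by `ε`, this bounds a positive constant by a net
  -- tending to zero.
  have hev : ∀ᶠ ε : Eps in atZero,
      (√W.b)⁻¹ * φ 0 ≤ A * ε + 2 ^ p * L * (ε : ℝ) ^ (1 / 2 : ℝ) := by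
    -- For these `ε` all points between the samples `0` and `p ε` stay within distance `ρ` of the
    -- front.
    filter_upwards [hA, hL, eventually_lt_atZero (show (0 : ℝ) < ρ / (p + 1) by positivity)]
      with ε h1 h2 h3
    have hε := ε.pos
    have hc := W.c_pos ε (le_refl 0)
    set F : ℝ → ℝ := fun x => (W.P σ).1 ε (t, x + σ * W.S ε t) with hF
    have hFs : ContDiff ℝ ∞ F := by
      refine contDiff_iff_contDiffAt.2 fun x => ?_
      have : ContDiffOn ℝ ∞ F univ := ((W.P σ).contDiffOn ε).comp
        (contDiff_const.prodMk (contDiff_id.add contDiff_const)).contDiffOn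
        fun _ _ => mem_halfPlane.2 ht
      exact (contDiffOn_univ.1 this).contDiffAt
    have hFd : ∀ y, iteratedDeriv p F y =
        ((dir (0, 1))^[p] (W.P σ)).1 ε (t, y + σ * W.S ε t) := fun y => by
      have := congrFun (iteratedDeriv_comp_add_const p (fun x => (W.P σ).1 ε (t, x))
        (σ * W.S ε t)) y
      rw [hF, this, (W.P σ).iteratedDeriv_slice ε ht]
    have h4 : |(fwdDiff (ε : ℝ))^[p] F 0| ≤ (ε : ℝ) ^ p * (A * (ε : ℝ) ^ (-(p : ℤ))) := by
      refine abs_fwdDiff_iterate_le hε.le p hFs fun y hy => ?_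
      rw [hFd]
      refine h1 _ ?_
      rw [add_sub_cancel_right, abs_of_nonneg hy.1]
      refine hy.2.trans ?_
      rw [lt_div_iff₀ (by positivity)] at h3
      nlinarith
    have h5 := abs_fwdDiff_iterate_sub_le (F := F) (ψ := φ) (h := ε)
      (α := (√(W.c ε 0))⁻¹ / ε) (β := L * (ε : ℝ) ^ (-(1 / 2) : ℝ)) p
      (fun j hj => hφ.eq_zero_of_one_le_abs (by rw [Nat.abs_cast]; exact_mod_cast hj)) h2
    rw [zpow_neg, zpow_natCast, mul_left_comm, mul_inv_cancel₀ (by positivity), mul_one] at h4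
    rw [abs_of_pos (by positivity)] at h5
    have h6 : (√W.b)⁻¹ ≤ (√(W.c ε 0))⁻¹ :=
      inv_anti₀ (Real.sqrt_pos.2 hc) (Real.sqrt_le_sqrt (W.le_b ε 0 le_rfl))
    have h7 : (ε : ℝ) * (ε : ℝ) ^ (-(1 / 2) : ℝ) = (ε : ℝ) ^ (1 / 2 : ℝ) := by
      nth_rewrite 1 [← Real.rpow_one (ε : ℝ)]
      rw [← Real.rpow_add hε]
      norm_num
    calc (√W.b)⁻¹ * φ 0 ≤ (√(W.c ε 0))⁻¹ * φ 0 := by gcongr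
      _ = ε * ((√(W.c ε 0))⁻¹ / ε * φ 0) := by field_simp
      _ ≤ ε * (A + 2 ^ p * (L * (ε : ℝ) ^ (-(1 / 2) : ℝ))) := by
          refine mul_le_mul_of_nonneg_left ?_ hε.le
          linarith
      _ = A * ε + 2 ^ p * L * (ε * (ε : ℝ) ^ (-(1 / 2) : ℝ)) := by ring
      _ = _ := by rw [h7]
  have hlim : Tendsto (fun ε : Eps => A * (ε : ℝ) + 2 ^ p * L * (ε : ℝ) ^ (1 / 2 : ℝ)) atZero
      (𝓝 (A * 0 + 2 ^ p * L * 0)) := by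
    refine (tendsto_coe_atZero.const_mul A).add (Tendsto.const_mul _ ?_)
    have := tendsto_coe_atZero.rpow_const (p := 1 / 2) (Or.inr (by norm_num))
    rwa [Real.zero_rpow (by norm_num)] at this
  have := ge_of_tendsto hlim hev
  have h0 : 0 < (√W.b)⁻¹ * φ 0 := by positivity
  simp only [mul_zero, add_zero] at this
  linarith

end WaveNet

/-! ### Convergence of the characteristics -/

/-- A single bump function replaces the indicator of `[0, t]` for all functions with values in `[0,
b]`, so the error is uniform in `ε`. -/
theorem exists_cutoff {t η : ℝ} (hη : 0 < η) (hηt : 2 * η < t) :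
    ∃ χ : ℝ → ℝ, ContDiff ℝ ∞ χ ∧ HasCompactSupport χ ∧ ∀ (f : ℝ → ℝ) (b : ℝ),
      IntervalIntegrable f volume 0 t → (∀ r ∈ Icc 0 t, f r ∈ Icc 0 b) →
        |(∫ r in (0 : ℝ)..t, f r) - ∫ r, f r * χ r| ≤ b * (2 * η) := by
  let χ : ContDiffBump (t / 2) := ⟨t / 2 - η, t / 2, by linarith, by linarith⟩
  refine ⟨χ, χ.contDiff, χ.hasCompactSupport, fun f b hf hfb => ?_⟩
  have ht : 0 ≤ t := by linarith
  have hsupp : Function.support (fun r => f r * χ r) ⊆ Ioc 0 t := by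
    intro r hr
    have h1 : r ∈ Function.support χ := fun h => hr (by simp [h])
    rw [χ.support_eq, Real.ball_eq_Ioo] at h1
    change r ∈ Ioo (t / 2 - t / 2) (t / 2 + t / 2) at h1
    exact ⟨by linarith [h1.1], by linarith [h1.2]⟩
  have hχc : Continuous χ := χ.continuous
  have hfχ : IntervalIntegrable (fun r => f r * χ r) volume 0 t :=
    hf.mul_continuousOn hχc.continuousOn
  have hb0 : 0 ≤ b := (hfb 0 ⟨le_rfl, ht⟩).1.trans (hfb 0 ⟨le_rfl, ht⟩).2
  rw [← intervalIntegral.integral_eq_integral_of_support_subset hsupp,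
    ← intervalIntegral.integral_sub hf hfχ]
  have h1 : ∫ r in (0 : ℝ)..t, (f r - f r * χ r) ≤ ∫ r in (0 : ℝ)..t, b * (1 - χ r) := by
    refine intervalIntegral.integral_mono_on ht (hf.sub hfχ)
      ((continuous_const.mul (continuous_const.sub hχc)).intervalIntegrable _ _) fun r hr => ?_
    have := mul_le_mul_of_nonneg_right (hfb r hr).2 (sub_nonneg.2 (χ.le_one (x := r)))
    linarith
  have h2 : 0 ≤ ∫ r in (0 : ℝ)..t, (f r - f r * χ r) := by
    refine intervalIntegral.integral_nonneg ht fun r hr => ?_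
    have := mul_nonneg (hfb r hr).1 (sub_nonneg.2 (χ.le_one (x := r)))
    linarith
  have h3 : t - 2 * η ≤ ∫ r in (0 : ℝ)..t, χ r := by
    have e : ∫ r in η..(t - η), χ r = t - 2 * η := by
      have : ∀ r ∈ uIcc η (t - η), χ r = 1 := fun r hr => by
        rw [uIcc_of_le (by linarith)] at hr
        refine χ.one_of_mem_closedBall ?_
        rw [Real.closedBall_eq_Icc]
        change r ∈ Icc (t / 2 - (t / 2 - η)) (t / 2 + (t / 2 - η))
        exact ⟨by linarith [hr.1], by linarith [hr.2]⟩
      rw [intervalIntegral.integral_congr this, intervalIntegral.integral_const]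
      simp
      ring
    rw [← e]
    exact intervalIntegral.integral_mono_interval hη.le (by linarith) (by linarith)
      (Eventually.of_forall fun r => χ.nonneg) (hχc.intervalIntegrable _ _)
  have h4 : ∫ r in (0 : ℝ)..t, b * (1 - χ r) = b * (t - ∫ r in (0 : ℝ)..t, χ r) := by
    rw [intervalIntegral.integral_const_mul, intervalIntegral.integral_sub
      intervalIntegrable_const (hχc.intervalIntegrable _ _)]
    simp
  rw [abs_of_nonneg h2]
  refine h1.trans ?_
  rw [h4]
  gcongr
  linarith

/-- Distributional convergence of bounded nets implies convergence of the primitives. -/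
theorem tendsto_primitive {u : Eps → ℝ → ℝ} {c : ℝ → ℝ} {b : ℝ} (hu : ∀ ε, Continuous (u ε))
    (hub : ∀ ε, ∀ t, 0 ≤ t → u ε t ∈ Icc 0 b)
    (hc : ∀ t, 0 ≤ t → IntervalIntegrable c volume 0 t) (hcb : ∀ t, 0 ≤ t → c t ∈ Icc 0 b)
    (h : ∀ χ : ℝ → ℝ, ContDiff ℝ ∞ χ → HasCompactSupport χ →
      Tendsto (fun ε => ∫ t, u ε t * χ t) atZero (𝓝 (∫ t, c t * χ t))) {t : ℝ} (ht : 0 ≤ t) :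
    Tendsto (fun ε => ∫ r in (0 : ℝ)..t, u ε r) atZero (𝓝 (∫ r in (0 : ℝ)..t, c r)) := by
  rcases ht.eq_or_lt with rfl | ht'
  · simp
  rw [Metric.tendsto_nhds]
  intro r hr
  have hb0 : 0 ≤ b := (hcb 0 le_rfl).1.trans (hcb 0 le_rfl).2
  -- Each of the two cutoff errors is at most `r / 4`, and the distributional convergence
  -- contributes another `r / 4`.
  set η := min (t / 4) (r / (8 * (b + 1))) with hη
  have hη0 : 0 < η := by positivity
  have hηt : 2 * η < t := by linarith [min_le_left (t / 4) (r / (8 * (b + 1)))]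
  have hηr : b * (2 * η) ≤ r / 4 := by
    have h1 : η * (8 * (b + 1)) ≤ r :=
      (le_div_iff₀ (by positivity)).1 (min_le_right (t / 4) (r / (8 * (b + 1))))
    nlinarith
  obtain ⟨χ, hχ, hχc, hf⟩ := exists_cutoff hη0 hηt
  filter_upwards [Metric.tendsto_nhds.1 (h χ hχ hχc) (r / 4) (by positivity)] with ε hε
  have h1 := hf (u ε) b ((hu ε).intervalIntegrable _ _) fun s hs => hub ε s hs.1
  have h2 := hf c b (hc t ht) fun s hs => hcb s hs.1
  rw [Real.dist_eq] at hε ⊢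
  rw [abs_le] at h1 h2
  rw [abs_lt] at hε ⊢
  constructor <;> linarith [h1.1, h1.2, h2.1, h2.2, hε.1, hε.2]

theorem intervalIntegrable_speed (c₀ c₁ s t : ℝ) :
    IntervalIntegrable (speed c₀ c₁) volume s t := by
  rw [intervalIntegrable_iff]
  refine Measure.integrableOn_of_bounded (M := max |min c₀ c₁| |max c₀ c₁|)
    (by simp [uIoc, Real.volume_Ioc])
    (measurable_speed c₀ c₁).aestronglyMeasurable (Eventually.of_forall fun r => ?_)
  have := speed_mem_Icc c₀ c₁ r
  exact abs_le_max_abs_abs this.1 this.2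

/-! ### Representatives -/

theorem Represents.isModerate {E : Type*} [NormedAddCommGroup E] [NormedSpace ℝ E] {Ω : Domain E}
    {u : Eps → E → ℝ} {U : GenFun Ω} (h : Represents u U) : IsModerate Ω u := h.1

theorem Represents.isNegligible_sub {E : Type*} [NormedAddCommGroup E] [NormedSpace ℝ E]
    {Ω : Domain E} {u v : Eps → E → ℝ} {U : GenFun Ω} (hu : Represents u U)
    (hv : Represents v U) : IsNegligible Ω (u - v) := by
  obtain ⟨hu, rfl⟩ := hu
  obtain ⟨hv, h⟩ := hv
  exact Ideal.Quotient.eq.1 h.symm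

/-- A bound by a power of `ε` does not depend on the representative. -/
theorem Represents.derivBound {E : Type*} [NormedAddCommGroup E] [NormedSpace ℝ E]
    {Ω : Domain E} {u v : Eps → E → ℝ} {U : GenFun Ω} (hu : Represents u U) (hv : Represents v U)
    {K : Set E} (hK : K ⊆ Ω.carrier) (hc : IsCompact K) {n p : ℕ}
    (h : DerivBound Ω v K n (-(p : ℤ))) : DerivBound Ω u K n (-(p : ℤ)) := by
  have h1 : DerivBound Ω (u - v) K n (-(p : ℤ)) :=
    (hu.isNegligible_sub hv K hK hc n 0).mono (by simp)
  have := DerivBound.add hK hv.isModerate.1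
    (v := u - v) (fun ε => (hu.isModerate.1 ε).sub (hv.isModerate.1 ε)) h h1
  rwa [add_sub_cancel] at this

/-- A bounded `G^∞` coefficient is slow. -/
theorem orderLE_of_isGInfty {C : GenFun line} (hC : IsGInfty C) {u : Eps → ℝ → ℝ}
    (hu : Represents u C) {b : ℝ} (hb : ∀ ε, ∀ t, 0 ≤ t → |u ε t| ≤ b) (T : ℝ) (hT : 1 ≤ T)
    (k : ℕ) (δ : ℝ) (hδ : 0 < δ) : OrderLE T (fun ε => iteratedDeriv k (u ε)) δ := by
  obtain ⟨v, hv, h⟩ := hC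
  obtain ⟨p, hp⟩ := h (Icc 0 T) (subset_univ _) isCompact_Icc
  refine OrderLE.iteratedDeriv_of_uniform hT (p := p)
    (fun ε => contDiffOn_univ.1 (hu.isModerate.1 ε)) ?_ (fun n => ?_) k δ hδ
  · exact ⟨b, Eventually.of_forall fun ε x hx => by simpa using hb ε x hx.1⟩
  · obtain ⟨A, hA⟩ := hu.derivBound hv (subset_univ _) isCompact_Icc (hp n)
    refine ⟨A, hA.mono fun ε h1 x hx => ?_⟩
    have h2 := h1 x hx
    change ‖iteratedFDerivWithin ℝ n (u ε) univ x‖ ≤ _ at h2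
    rw [iteratedFDerivWithin_univ, norm_iteratedFDeriv_eq_norm_iteratedDeriv,
      ← Real.rpow_intCast] at h2
    push_cast at h2
    exact h2

theorem Net.ofSmooth_dir_eqOn (v : ℝ × ℝ) (u : moderate halfPlane) (ε : Eps) {z : ℝ × ℝ}
    (hz : z ∈ halfPlane.carrier) :
    (dir v (ofSmooth u.1 u.2.1)).1 ε z = (moderateDeriv v u).1 ε z := by
  rw [dir_apply _ _ _ hz]
  change _ = fderivWithin ℝ (u.1 ε) halfPlane.carrier z v
  rw [fderivWithin_congr (fun y hy => ofSmooth_apply u.2.1 ε hy) (ofSmooth_apply u.2.1 ε hz)]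

theorem Net.dir_ofSmooth (v : ℝ × ℝ) (u : moderate halfPlane) :
    dir v (ofSmooth u.1 u.2.1) = ofSmooth (moderateDeriv v u).1 (moderateDeriv v u).2.1 :=
  Net.ext fun ε z hz => by rw [ofSmooth_dir_eqOn v u ε hz, ofSmooth_apply _ ε hz]

/-- The net of solutions belonging to a generalized solution. -/
def waveNetOfSolution {φ : ℝ → ℝ} (hφ : IsMollifier φ) {C : GenFun line} (hC : IsGInfty C)
    {u : Eps → ℝ → ℝ} (hu : Represents u C) {a b B : ℝ} (ha : 0 < a)
    (hab : ∀ ε, ∀ t, 0 ≤ t → a ≤ u ε t ∧ u ε t ≤ b)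
    (hB : ∀ ε, IntegrableOn (deriv (u ε)) (Ioi 0) ∧ ∫ t in Ioi (0 : ℝ), |deriv (u ε) t| ≤ B)
    (w : moderate halfPlane)
    (hw : IsSolution C 0 (delta φ hφ) (Ideal.Quotient.mk (negligible halfPlane) w)) :
    WaveNet φ where
  c := u
  w := ofSmooth w.1 w.2.1
  a := a
  b := b
  B := B
  smooth := fun ε => contDiffOn_univ.1 (hu.isModerate.1 ε)
  a_pos := ha
  a_le := fun ε t ht => (hab ε t ht).1
  le_b := fun ε t ht => (hab ε t ht).2
  variation := fun ε t ht => by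
    rw [intervalIntegral.integral_of_le ht]
    exact (setIntegral_mono_set (hB ε).1.abs (Eventually.of_forall fun _ => abs_nonneg _)
      (Eventually.of_forall fun _ h => h.1)).trans (hB ε).2
  slow := fun T hT k δ hδ => orderLE_of_isGInfty hC hu (b := b)
    (fun ε t ht => by rw [abs_of_pos (ha.trans_le (hab ε t ht).1)]; exact (hab ε t ht).2) T hT k δ hδ
  moderate := ⟨fun ε => Net.contDiffOn _ ε, fun K hK hc n => by
    obtain ⟨p, hp⟩ := w.2.2 K hK hc n
    exact ⟨p, hp.congr hK fun ε _ hz => ofSmooth_apply w.2.1 ε hz⟩⟩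
  rhs := fun K hK hc n => by
    obtain ⟨hum, rfl⟩ := hu
    have h := Ideal.Quotient.eq_zero_iff_mem.1 (show Ideal.Quotient.mk (negligible halfPlane)
      (moderateDeriv (1, 0) (moderateDeriv (1, 0) w) -
        moderatePullback (ContinuousLinearMap.fst ℝ ℝ ℝ) (fun _ _ => mem_univ _) ⟨u, hum⟩ ^ 2 *
          moderateDeriv (0, 1) (moderateDeriv (0, 1) w)) = 0 from hw.1)
    -- Of the negligible defect only boundedness of each derivative is retained.
    have h0 := h K hK hc n 0
    refine DerivBound.congr hK (fun ε z hz => ?_) h0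
    rw [dir_ofSmooth, dir_ofSmooth, dir_ofSmooth, dir_ofSmooth, sub_apply, mul_apply, sq,
      mul_apply, ofSmooth_apply _ ε hz, ofSmooth_apply _ ε hz, time_apply _ ε hz]
    change _ = (moderateDeriv (1, 0) (moderateDeriv (1, 0) w)).1 ε z -
      (u ε z.1) ^ 2 * (moderateDeriv (0, 1) (moderateDeriv (0, 1) w)).1 ε z
    rw [sq]
  init := fun K hc n => by
    have h := Ideal.Quotient.eq_zero_iff_mem.1 (show Ideal.Quotient.mk (negligible line)
      (moderatePullback (Ω := line) (Ω' := halfPlane) (ContinuousLinearMap.inr ℝ ℝ ℝ)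
        (fun _ _ => ⟨le_refl (0 : ℝ), mem_univ _⟩) w) = 0 from hw.2.1)
    refine DerivBound.congr (subset_univ _) (fun ε x _ => ?_) (h K (subset_univ _) hc n 0)
    exact ofSmooth_apply w.2.1 ε (mem_halfPlane.2 le_rfl)
  init' := fun K hc n => by
    have h := Ideal.Quotient.eq.1 (show Ideal.Quotient.mk (negligible line)
      (moderatePullback (Ω := line) (Ω' := halfPlane) (ContinuousLinearMap.inr ℝ ℝ ℝ)
        (fun _ _ => ⟨le_refl (0 : ℝ), mem_univ _⟩) (moderateDeriv (1, 0) w)) =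
      Ideal.Quotient.mk (negligible line) ⟨fun ε : Eps => rescale φ ε, isModerate_rescale hφ⟩
      from hw.2.2)
    refine DerivBound.congr (subset_univ _) (fun ε x _ => ?_) (h K (subset_univ _) hc n 0)
    change _ = (moderateDeriv (1, 0) w).1 ε (0, x) - rescale φ ε x
    rw [← ofSmooth_dir_eqOn (1, 0) w ε (mem_halfPlane.2 le_rfl)]

/-! ### The singular support -/

theorem derivBound_inter_iff {E : Type*} [NormedAddCommGroup E] [NormedSpace ℝ E] {Ω : Domain E}
    {O : Set E} (hO : IsOpen O) {u : Eps → E → ℝ} {K : Set E} (hK : K ⊆ O) {n : ℕ} {m : ℤ} :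
    DerivBound (Ω.inter O hO) u K n m ↔ DerivBound Ω u K n m := by
  have : ∀ ε, ∀ x ∈ K, iteratedFDerivWithin ℝ n (u ε) (Ω.inter O hO).carrier x =
      iteratedFDerivWithin ℝ n (u ε) Ω.carrier x :=
    fun ε x hx => iteratedFDerivWithin_inter_open hO (hK hx)
  unfold DerivBound
  refine exists_congr fun A => eventually_congr (Eventually.of_forall fun ε => ?_)
  exact forall₂_congr fun x hx => by rw [this ε x hx]

theorem represents_restrict {E : Type*} [NormedAddCommGroup E] [NormedSpace ℝ E] {Ω : Domain E}
    {O : Set E} (hO : IsOpen O) (w : moderate Ω) :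
    Represents w.1 (restrict O hO (Ideal.Quotient.mk (negligible Ω) w)) :=
  ⟨(moderatePullback (Ω := Ω.inter O hO) (ContinuousLinearMap.id ℝ E) (fun _ hx => hx.1) w).2, rfl⟩

namespace WaveNet

variable {φ : ℝ → ℝ} (W : WaveNet φ)

theorem iterate_dir_space_P (σ : ℝ) (k : ℕ) : (dir (0, 1))^[k] (W.P σ) =
    W.s * ((dir (0, 1))^[k] (dir (1, 0) W.w) -
      const σ * (W.C * (dir (0, 1))^[k] (dir (0, 1) W.w))) := by
  induction k with
  | zero => rfl
  | succ k ih =>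
    rw [Function.iterate_succ_apply', ih]
    simp only [Function.iterate_succ_apply', (dir _).leibniz, smul_eq_mul, map_sub, dir_const,
      dir_space_C, dir_space_s]
    ring

theorem derivBound_iterate_dir {K : Set (ℝ × ℝ)} (hK : K ⊆ halfPlane.carrier) (v : ℝ × ℝ) (k : ℕ)
    {f : Net} {n : ℕ} {m : ℤ} (h : DerivBound halfPlane f.1 K (n + k) m) :
    DerivBound halfPlane ((dir v)^[k] f).1 K n m := by
  induction k generalizing f with
  | zero => exact h
  | succ k ih => exact ih (derivBound_dir hK v h)

/-- The factors `s` and `C` do not depend on `x`, so space derivatives pass to `w` without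
differentiating the coefficient. One order is used up by the first derivatives in `P σ`. -/
theorem exists_bound_iterate_P {K : Set (ℝ × ℝ)} (hK : K ⊆ halfPlane.carrier) {σ : ℝ}
    (hσ : σ * σ = 1) (k : ℕ) {m : ℤ} (h : DerivBound halfPlane W.w.1 K (k + 1) m) :
    ∃ A : ℝ, ∀ᶠ ε : Eps in atZero, ∀ z ∈ K,
      |((dir (0, 1))^[k] (W.P σ)).1 ε z| ≤ A * (ε : ℝ) ^ m := by
  obtain ⟨A, hA⟩ := derivBound_iterate_dir hK (0, 1) k (n := 0)
    (by rw [zero_add]; exact derivBound_dir hK (1, 0) h)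
  obtain ⟨A', hA'⟩ := derivBound_iterate_dir hK (0, 1) k (n := 0)
    (by rw [zero_add]; exact derivBound_dir hK (0, 1) h)
  have hb := W.b_pos
  refine ⟨(√W.a)⁻¹ * (A + W.b * A'), ?_⟩
  filter_upwards [hA, hA'] with ε h1 h2 z hz
  have hz0 := mem_halfPlane.1 (hK hz)
  have h3 := h1 z hz
  have h4 := h2 z hz
  rw [norm_iteratedFDerivWithin_zero, Real.norm_eq_abs] at h3 h4
  have hc := W.c_pos ε hz0
  have h5 := inv_anti₀ (Real.sqrt_pos.2 W.a_pos) (Real.sqrt_le_sqrt (W.a_le ε z.1 hz0))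
  rw [W.iterate_dir_space_P, mul_apply, sub_apply, mul_apply, mul_apply, const_apply,
    W.s_apply ε (hK hz), W.C_apply ε (hK hz), abs_mul, abs_of_pos (by positivity), mul_assoc]
  refine mul_le_mul h5 ?_ (abs_nonneg _) (by positivity)
  refine (abs_sub _ _).trans ?_
  rw [add_mul, abs_mul σ, abs_of_mul_self hσ, one_mul, abs_mul, abs_of_pos hc, mul_assoc W.b]
  exact add_le_add h3 (mul_le_mul (W.le_b ε _ hz0) h4 (abs_nonneg _) hb.le)

theorem abs_S_sub_le (ε : Eps) {t t' : ℝ} (ht : 0 ≤ t) (ht' : 0 ≤ t') :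
    |W.S ε t' - W.S ε t| ≤ W.b * |t' - t| := by
  rcases le_total t t' with h | h
  · rw [abs_of_nonneg (sub_nonneg.2 (W.S_mono ε ht h)), abs_of_nonneg (sub_nonneg.2 h)]
    exact W.S_sub_le ε ht h
  · rw [abs_sub_comm, abs_sub_comm t', abs_of_nonneg (sub_nonneg.2 (W.S_mono ε ht' h)),
      abs_of_nonneg (sub_nonneg.2 h)]
    exact W.S_sub_le ε ht' h

/-- Points off the limiting characteristics have a neighbourhood that lies off the regularized
characteristics. -/
theorem exists_ball_subset_zone {z : ℝ × ℝ} (hz : 0 ≤ z.1) {s : ℝ}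
    (hs : Tendsto (fun ε => W.S ε z.1) atZero (𝓝 s)) (h1 : z.2 ≠ s) (h2 : z.2 ≠ -s) :
    ∃ ρ η R T : ℝ, 0 < ρ ∧ 0 < η ∧ ∀ᶠ ε : Eps in atZero,
      halfPlane.carrier ∩ Metric.ball z ρ ⊆ W.zone 1 η R T ε ∩ W.zone (-1) η R T ε := by
  have hb := W.b_pos
  -- Of the distance `3 η` one share is lost to the convergence of `S`, one to the variation over
  -- the ball, and one remains.
  set η := min |s - z.2| |s + z.2| / 3 with hη
  have hη0 : 0 < η := by
    have a1 : 0 < |s - z.2| := abs_pos.2 fun h => h1 (by linarith)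
    have a2 : 0 < |s + z.2| := abs_pos.2 fun h => h2 (by linarith)
    positivity
  have hη1 : 3 * η ≤ |s - z.2| := by
    rw [hη, mul_div_cancel₀ _ three_ne_zero]; exact min_le_left _ _
  have hη2 : 3 * η ≤ |s + z.2| := by
    rw [hη, mul_div_cancel₀ _ three_ne_zero]; exact min_le_right _ _
  set ρ := min 1 (η / (W.b + 1)) with hρ
  have hρ0 : 0 < ρ := by positivity
  have hρ1 : (W.b + 1) * ρ ≤ η := by
    have := (le_div_iff₀ (by positivity)).1 (min_le_right 1 (η / (W.b + 1)))
    linarith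
  refine ⟨ρ, η, W.b * (z.1 + 1) + (|z.2| + 1), z.1 + 1, hρ0, hη0, ?_⟩
  filter_upwards [Metric.tendsto_nhds.1 hs η hη0] with ε hε y hy
  rw [Real.dist_eq] at hε
  have hy0 := mem_halfPlane.1 hy.1
  have hyd : dist y z < ρ := hy.2
  rw [Prod.dist_eq, max_lt_iff, Real.dist_eq, Real.dist_eq] at hyd
  have hρle : ρ ≤ 1 := min_le_left _ _
  have hS := W.abs_S_sub_le ε hz hy0
  have hS' : W.b * |y.1 - z.1| ≤ W.b * ρ := mul_le_mul_of_nonneg_left hyd.1.le hb.le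
  have hyT : y.1 ≤ z.1 + 1 := by linarith [(abs_lt.1 hyd.1).2]
  have hSy := W.S_le ε hy0
  have hSy0 := W.S_nonneg ε hy0
  have hSyT : W.b * y.1 ≤ W.b * (z.1 + 1) := mul_le_mul_of_nonneg_left hyT hb.le
  have hy2 : |y.2| ≤ |z.2| + 1 := by
    have := abs_add_le (y.2 - z.2) z.2
    rw [sub_add_cancel] at this
    linarith [hyd.2]
  have key : ∀ τ : ℝ, τ * τ = 1 → 3 * η ≤ |s - τ * z.2| →
      y ∈ W.zone τ η (W.b * (z.1 + 1) + (|z.2| + 1)) (z.1 + 1) ε := by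
    intro τ hτ h
    have hτ1 := abs_of_mul_self hτ
    refine ⟨⟨hy0, hyT⟩, ?_, ?_⟩
    · have e : s - τ * z.2 = (W.S ε y.1 - τ * y.2) +
          (-(W.S ε z.1 - s) + (-(W.S ε y.1 - W.S ε z.1) + τ * (y.2 - z.2))) := by ring
      have a1 := abs_add_le (W.S ε y.1 - τ * y.2)
        (-(W.S ε z.1 - s) + (-(W.S ε y.1 - W.S ε z.1) + τ * (y.2 - z.2)))
      have a2 := abs_add_le (-(W.S ε z.1 - s)) (-(W.S ε y.1 - W.S ε z.1) + τ * (y.2 - z.2))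
      have a3 := abs_add_le (-(W.S ε y.1 - W.S ε z.1)) (τ * (y.2 - z.2))
      rw [← e] at a1
      rw [abs_neg] at a2 a3
      rw [abs_mul, hτ1, one_mul] at a3
      nlinarith [hyd.2]
    · have a1 := abs_sub (W.S ε y.1) (τ * y.2)
      rw [abs_mul, hτ1, one_mul, abs_of_nonneg hSy0] at a1
      linarith
  exact ⟨key 1 (by norm_num) (by rwa [one_mul]), key (-1) (by norm_num) (by
    rwa [neg_one_mul, sub_neg_eq_add])⟩

end WaveNet

theorem singSupp_eq {c₀ c₁ : ℝ} (hc₀ : 0 < c₀) (hc₁ : 0 < c₁) {φ : ℝ → ℝ} (hφ : IsMollifier φ)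
    {C : GenFun line} (hreg : Regularizes C (speed c₀ c₁)) (hC : IsGInfty C)
    {U : GenFun halfPlane} (hU : IsSolution C 0 (delta φ hφ) U) :
    singSupp U = {z : ℝ × ℝ | 0 ≤ z.1 ∧ (z.2 = ∫ s in (0 : ℝ)..z.1, speed c₀ c₁ s ∨
      z.2 = -∫ s in (0 : ℝ)..z.1, speed c₀ c₁ s)} := by
  obtain ⟨u, hu, ⟨a, b, ha, hab⟩, ⟨B, hB⟩, hlim⟩ := hreg
  obtain ⟨w, rfl⟩ := Ideal.Quotient.mk_surjective U
  set W := waveNetOfSolution hφ hC hu ha hab hB w hU with hW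
  have hWw : ∀ ε, ∀ z ∈ halfPlane.carrier, W.w.1 ε z = w.1 ε z :=
    fun ε z hz => ofSmooth_apply w.2.1 ε hz
  have hmin : 0 < min c₀ c₁ := lt_min hc₀ hc₁
  have hS : ∀ t, 0 ≤ t → Tendsto (fun ε => W.S ε t) atZero
      (𝓝 (∫ s in (0 : ℝ)..t, speed c₀ c₁ s)) := fun t ht =>
    tendsto_primitive (b := max b (max c₀ c₁)) (fun ε => (W.smooth ε).continuous)
      (fun ε t ht => ⟨ha.le.trans (hab ε t ht).1, (hab ε t ht).2.trans (le_max_left _ _)⟩)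
      (fun t _ => intervalIntegrable_speed c₀ c₁ 0 t)
      (fun t _ => ⟨hmin.le.trans (speed_mem_Icc c₀ c₁ t).1,
        (speed_mem_Icc c₀ c₁ t).2.trans (le_max_right _ _)⟩) hlim ht
  ext z
  constructor
  · rintro ⟨hz, hzO⟩
    have hz0 := mem_halfPlane.1 hz
    refine ⟨hz0, ?_⟩
    by_contra hne
    obtain ⟨h1, h2⟩ := not_or.1 hne
    obtain ⟨ρ, η, R, T, hρ, hη, hsub⟩ := W.exists_ball_subset_zone hz0 (hS z.1 hz0) h1 h2
    obtain ⟨p, hp⟩ := W.exists_bound_off_characteristics hφ hη R T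
    refine hzO (mem_sUnion.2 ⟨Metric.ball z ρ, ⟨Metric.isOpen_ball, w.1,
      represents_restrict _ w, fun K hK _ => ⟨p, fun n => ?_⟩⟩, Metric.mem_ball_self hρ⟩)
    rw [derivBound_inter_iff Metric.isOpen_ball (fun x hx => (hK hx).2)]
    have hb : DerivBound halfPlane W.w.1 K n (-(p : ℤ)) := by
      obtain ⟨A, hA⟩ := hp n
      refine ⟨A, ?_⟩
      filter_upwards [hA, hsub] with ε h3 h4 x hx
      exact h3 x (h4 (hK hx))
    exact hb.congr (fun x hx => (hK hx).1) fun ε x hx => (hWw ε x hx).symm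
  · rintro ⟨hz0, hz2⟩
    have hz : z ∈ halfPlane.carrier := mem_halfPlane.2 hz0
    refine ⟨hz, ?_⟩
    rintro ⟨O, ⟨hO, v, hv, hvb⟩, hzO⟩
    set s := ∫ s in (0 : ℝ)..z.1, speed c₀ c₁ s with hs
    obtain ⟨σ, hσ, hzσ⟩ : ∃ σ : ℝ, σ * σ = 1 ∧ z.2 = σ * s := by
      rcases hz2 with h | h
      · exact ⟨1, by norm_num, by rw [h, one_mul]⟩
      · exact ⟨-1, by norm_num, by rw [h, neg_one_mul]⟩
    obtain ⟨r, hr, hrO⟩ := Metric.isOpen_iff.1 hO z hzO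
    set ρ := r / 3 with hρ
    have hρ0 : 0 < ρ := by positivity
    -- A segment at fixed time suffices. Its half length `2 ρ` allows for the window `ρ` around the
    -- regularized front and for the distance from that front to the limiting one.
    set K : Set (ℝ × ℝ) := {z.1} ×ˢ Icc (z.2 - 2 * ρ) (z.2 + 2 * ρ) with hK
    have hKH : K ⊆ halfPlane.carrier := fun y hy =>
      mem_halfPlane.2 (by rw [show y.1 = z.1 from hy.1]; exact hz0)
    have hKO : K ⊆ O := fun y hy => hrO (by
      rw [Metric.mem_ball, Prod.dist_eq, show y.1 = z.1 from hy.1, dist_self, Real.dist_eq]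
      refine max_lt hr (abs_lt.2 ⟨?_, ?_⟩) <;> linarith [hy.2.1, hy.2.2])
    have hKc : IsCompact K := isCompact_singleton.prod isCompact_Icc
    obtain ⟨p, hp⟩ := hvb K (fun y hy => ⟨hKH hy, hKO hy⟩) hKc
    -- Order `p + 1` against exponent `p`: since `P σ` contains first derivatives of `w`, this
    -- bounds its `p`-th space derivative by `ε ^ (-p)`, which the front excludes.
    have hw := (represents_restrict hO w).derivBound hv (fun y hy => ⟨hKH hy, hKO hy⟩) hKc
      (hp (p + 1))
    rw [derivBound_inter_iff hO hKO] at hw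
    obtain ⟨A, hA⟩ := W.exists_bound_iterate_P hKH hσ p (hw.congr hKH hWw)
    refine W.not_bounded_at_front hφ hσ hz0 hρ0 p ⟨A, ?_⟩
    filter_upwards [hA, Metric.tendsto_nhds.1 (hS z.1 hz0) ρ hρ0] with ε h1 h2 x hx
    refine h1 (z.1, x) ⟨rfl, ?_⟩
    rw [Real.dist_eq] at h2
    have h3 : |x - z.2| ≤ 2 * ρ := by
      have e : x - z.2 = (x - σ * W.S ε z.1) + σ * (W.S ε z.1 - s) := by rw [hzσ]; ring
      rw [e]
      refine (abs_add_le _ _).trans ?_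
      rw [abs_mul, WaveNet.abs_of_mul_self hσ, one_mul]
      linarith
    rw [abs_le] at h3
    exact ⟨by linarith [h3.1], by linarith [h3.2]⟩

end Colombeau

end

theorem theorem5p1 (c₀ c₁ : ℝ) (hc₀ : 0 < c₀) (hc₁ : 0 < c₁) (hne : c₀ ≠ c₁)
    (φ : ℝ → ℝ) (hφ : IsMollifier φ) :
    (∀ ψ : ℝ → ℝ, IsMollifier ψ → ∀ h : Eps → ℝ, (∀ ε, 0 < h ε) → Tendsto h atZero (𝓝 0) →
      IsSlowScale (fun ε => 1 / h ε) →
      ∃ C : GenFun line, Represents (fun ε => mollify (speed c₀ c₁) ψ (h ε)) C ∧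
        Regularizes C (speed c₀ c₁) ∧ IsGInfty C) ∧
    ∀ C : GenFun line, Regularizes C (speed c₀ c₁) → IsGInfty C →
      ∀ U : GenFun halfPlane, IsSolution C 0 (delta φ hφ) U →
        singSupp U = {z : ℝ × ℝ | 0 ≤ z.1 ∧
          (z.2 = ∫ s in (0 : ℝ)..z.1, speed c₀ c₁ s ∨
            z.2 = -∫ s in (0 : ℝ)..z.1, speed c₀ c₁ s)} :=
  ⟨fun _ hψ _ hh h0 hs => exists_regularizes_mollify_speed hψ hh hc₀ hc₁ h0 hs,
    fun _ hreg hC _ hU => singSupp_eq hc₀ hc₁ hφ hreg hC hU⟩
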